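/- Let $\mathcal H,\mathcal H'$ be separable complex Hilbert spaces and let $G$, $G'$ be positive semidefinite densely defined self-adjoint operators on $\mathcal H$, $\mathcal H'$ such that $\inf\{\|G\varphi\| : \varphi\in\mathcal D(G),\ \|\varphi\|=1\}=0$, and likewise for $G'$. A state is a positive trace-class operator of unit trace; $\operatorname{Tr}G\rho\in[0,+\infty]$ denotes $\sum_i\|\sqrt G\varphi_i\|^2$ for any decomposition $\rho=\sum_i|\varphi_i\rangle\langle\varphi_i|$ (with the value $+\infty$ if some $\varphi_i\notin\mathcal D(\sqrt G)$). Let $\mathfrak B_G(\mathcal H)$ be the space of $\sqrt G$-bounded operators, i.e. linear operators $A:\mathcal D(\sqrt G)\to\mathcal H$ with $\|A\varphi\|^2\le a^2\|\varphi\|^2+b^2\|\sqrt G\varphi\|^2$ for all $\varphi\in\mathcal D(\sqrt G)$ and some $a,b\ge0$ (bounded operators are identified with their restrictions to $\mathcal D(\sqrt G)$); the $\sqrt G$-bound $b_{\sqrt G}(A)$ is the infimum of the admissible $b$. For $E\ge 0$ put $$\|A\|_E^G=\sup\Big\{\sqrt{\operatorname{Tr}A\rho A^*}\ :\ \rho\text{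 a state},\ \operatorname{Tr}G\rho\le E\Big\},\qquad \operatorname{Tr}A\rho A^*=\sum_i\|A\varphi_i\|^2 ,$$ with $\sup\emptyset=0$. For $E>0$ these are equivalent norms on $\mathfrak B_G(\mathcal H)$. Use the same notation for $G'$. Let $\Phi:\mathfrak B(\mathcal H)\to\mathfrak B(\mathcal H')$ be a normal completely positive linear map with $\Phi(I_{\mathcal H})\le I_{\mathcal H'}$, with predual $\Phi_*$ given by $\operatorname{Tr}\Phi_*(\rho)A=\operatorname{Tr}\Phi(A)\rho$. Put $Y_\Phi(E)=\sup\{\operatorname{Tr}G\Phi_*(\rho):\rho\text{ a state on }\mathcal H',\ \operatorname{Tr}G'\rho\le E\}$. The map $\Phi$ is called $GG'$-limited if $\operatorname{Tr}G\Phi_*(\rho)<+\infty$ for every state $\rho$ on $\mathcal H'$ with $\operatorname{Tr}G'\rho<+\infty$. A Stinespring representation of $\Phi$ is a separable Hilbert space $\mathcal K$ with a bounded $V:\mathcal H'\to\mathcal H\otimes\mathcal K$ such that $\Phi(A)=V^*(A\otimes I_{\mathcal K})V$ for all $A\in\mathfrak B(\mathcal H)$; it is minimal if the vectors $(A\otimes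 I_{\mathcal K})V\varphi$ span a dense subspace, and then $\dim\mathcal K$ is the Choi rank of $\Phi$. For $A\in\mathfrak B_G(\mathcal H)$, $A\otimes I_{\mathcal K}$ denotes the unique $\sqrt G\otimes I_{\mathcal K}$-bounded linear operator on $\mathcal D(\sqrt G\otimes I_{\mathcal K})$ with $\varphi\otimes\psi\mapsto A\varphi\otimes\psi$ for $\varphi\in\mathcal D(\sqrt G)$, $\psi\in\mathcal K$. The operator $G$ is called discrete if $G=\sum_{k\ge0}E_k|\tau_k\rangle\langle\tau_k|$ with $\mathcal D(G)=\{\varphi:\sum_kE_k^2|\langle\tau_k|\varphi\rangle|^2<\infty\}$ for an orthonormal basis $(\tau_k)_{k\ge0}$ and a nondecreasing sequence $E_k\to+\infty$. **A)** If $\Phi$ is $GG'$-limited, then for every $E>0$ it is continuous from $(\mathfrak B(\mathcal H),\|\cdot\|_E^G)$ to $(\mathfrak B(\mathcal H'),\|\cdot\|_E^{G'})$ and $Y_\Phi(E)<+\infty$. Moreover, $\Phi$ has a Stinespring representation, every Stinespring representation $(\mathcal K,V)$ satisfies $V\mathcal D(\sqrt{G'})\subseteq\mathcal D(\sqrt G\otimes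 I_{\mathcal K})$, and all of them define, by $$\Phi(A)\varphi=V^*(A\otimes I_{\mathcal K})V\varphi,\qquad A\in\mathfrak B_G(\mathcal H),\ \varphi\in\mathcal D(\sqrt{G'}),$$ one and the same linear operator $\Phi:\mathfrak B_G(\mathcal H)\to\mathfrak B_{G'}(\mathcal H')$. It extends the original map and is bounded: for all $A\in\mathfrak B_G(\mathcal H)$ and $E>0$, $$\|\Phi(A)\|_E^{G'}\le\sqrt{\|\Phi(I_{\mathcal H})\|}\,\|A\|^G_{Y_\Phi(E)}\le\sqrt{\max\{1,Y_\Phi(E)/E\}\,\|\Phi(I_{\mathcal H})\|}\,\|A\|_E^G .$$ The limit $k_\Phi=\lim_{E\to+\infty}Y_\Phi(E)/E$ exists and is finite, and $$b_{\sqrt{G'}}(\Phi(A))\le\sqrt{k_\Phi\|\Phi(I_{\mathcal H})\|}\;b_{\sqrt G}(A)\qquad\text{for all }A\in\mathfrak B_G(\mathcal H);$$ in particular $b_{\sqrt G}(A)=0$ implies $b_{\sqrt{G'}}(\Phi(A))=0$. **B)** Let $G'$ be discrete, and suppose that either a) $\Phi$ has finite Choi rank, or b) $G$ is discrete and $\Phi(I_{\mathcal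 H})=\Phi(P)$ for some finite-rank projector $P\in\mathfrak B(\mathcal H)$. If for some $E>0$ the map $\Phi$ is continuous from $(\mathfrak B(\mathcal H),\|\cdot\|_E^G)$ to $(\mathfrak B(\mathcal H'),\|\cdot\|_E^{G'})$, then $\Phi$ is $GG'$-limited. -/

import Mathlib

open scoped InnerProductSpace TensorProduct ENNReal NNReal CStarAlgebra Topology

universe u v w

noncomputable section

/-! ## Positive self-adjoint operators and their square roots -/

/-- A positive semidefinite, densely defined, self-adjoint (in general unbounded) operator. -/
structure PosOp (H : Type*) [NormedAddCommGroup H] [InnerProductSpace ℂ H] [CompleteSpace H] where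
  op : H →ₗ.[ℂ] H
  dense_domain : Dense (op.domain : Set H)
  selfAdjoint : IsSelfAdjoint op
  nonneg : ∀ x : op.domain, 0 ≤ (⟪(x : H), op x⟫_ℂ).re

namespace PosOp

variable {H : Type*} [NormedAddCommGroup H] [InnerProductSpace ℂ H] [CompleteSpace H]

theorem mem_graph_iff_adjoint (G : PosOp H) (y z : H) :
    (y, z) ∈ G.op.graph ↔ ∀ a b, (a, b) ∈ G.op.graph → ⟪b, y⟫_ℂ = ⟪a, z⟫_ℂ := by
  have h : G.op.adjoint.graph = G.op.graph.adjoint :=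
    LinearPMap.adjoint_graph_eq_graph_adjoint G.dense_domain
  rw [LinearPMap.isSelfAdjoint_def.1 G.selfAdjoint] at h
  conv_lhs => rw [h]
  simp [Submodule.mem_adjoint_iff, sub_eq_zero]

theorem graph_inner_symm (G : PosOp H) {x y x' y' : H} (h : (x, y) ∈ G.op.graph)
    (h' : (x', y') ∈ G.op.graph) : ⟪y, x'⟫_ℂ = ⟪x, y'⟫_ℂ :=
  (G.mem_graph_iff_adjoint x' y').1 h' x y h

theorem graph_inner_nonneg (G : PosOp H) {x y : H} (h : (x, y) ∈ G.op.graph) :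
    0 ≤ (⟪x, y⟫_ℂ).re := by
  rw [LinearPMap.mem_graph_iff] at h
  obtain ⟨u, rfl, rfl⟩ := h
  exact G.nonneg u

theorem graph_norm_le (G : PosOp H) {x y : H} (h : (x, y) ∈ G.op.graph) :
    ‖x‖ ≤ ‖x + y‖ ∧ ‖y‖ ≤ ‖x + y‖ := by
  have h1 := G.graph_inner_nonneg h
  have h2 : ‖x + y‖ ^ 2 = ‖x‖ ^ 2 + 2 * (⟪x, y⟫_ℂ).re + ‖y‖ ^ 2 := by
    simpa using norm_add_sq (𝕜 := ℂ) x y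
  constructor
  · exact le_of_sq_le_sq (by nlinarith [sq_nonneg ‖y‖]) (norm_nonneg _)
  · exact le_of_sq_le_sq (by nlinarith [sq_nonneg ‖x‖]) (norm_nonneg _)

/-- The resolvent `(1 + G)⁻¹`. -/
theorem exists_resolvent (G : PosOp H) : ∃ R : H →L[ℂ] H,
    ∀ x y, (x, y) ∈ G.op.graph ↔ R (x + y) = x := by
  have hcl : IsClosed (G.op.graph : Set (H × H)) := IsSelfAdjoint.isClosed G.selfAdjoint
  have : CompleteSpace G.op.graph := hcl.completeSpace_coe
  let f : G.op.graph →L[ℂ] H :=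
    (ContinuousLinearMap.fst ℂ H H + ContinuousLinearMap.snd ℂ H H).comp G.op.graph.subtypeL
  have hf : ∀ p : G.op.graph, f p = p.1.1 + p.1.2 := fun p => rfl
  have hanti : AntilipschitzWith 1 f := by
    refine AddMonoidHomClass.antilipschitz_of_bound f fun p => ?_
    obtain ⟨⟨x, y⟩, hp⟩ := p
    have := G.graph_norm_le hp
    simpa [hf, Prod.norm_def] using this
  have hclr : IsClosed (Set.range f) := hanti.isClosed_range f.uniformContinuous
  have hrange : (f : G.op.graph →ₗ[ℂ] H).range = ⊤ := by
    have hc : ((f : G.op.graph →ₗ[ℂ] H).range).topologicalClosure = (f : G.op.graph →ₗ[ℂ] H).range :=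
      IsClosed.submodule_topologicalClosure_eq (by rw [LinearMap.coe_range]; exact hclr)
    rw [← hc, Submodule.topologicalClosure_eq_top_iff, Submodule.eq_bot_iff]
    intro z hz
    rw [Submodule.mem_orthogonal] at hz
    have hzg : (z, -z) ∈ G.op.graph := by
      rw [mem_graph_iff_adjoint]
      intro a b hab
      have := hz (a + b) ⟨⟨(a, b), hab⟩, rfl⟩
      rw [inner_add_left] at this
      rw [inner_neg_right]
      linear_combination this
    have h1 := G.graph_inner_nonneg hzg
    rw [inner_neg_right, Complex.neg_re] at h1
    have h2 : (⟪z, z⟫_ℂ).re = ‖z‖ ^ 2 := by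
      simpa using inner_self_eq_norm_sq (𝕜 := ℂ) z
    have : ‖z‖ ^ 2 ≤ 0 := by linarith
    simpa using this
  have hker : (f : G.op.graph →ₗ[ℂ] H).ker = ⊥ := LinearMap.ker_eq_bot.2 hanti.injective
  let e := ContinuousLinearEquiv.ofBijective f hker hrange
  have he : ∀ p : G.op.graph, e p = f p := fun p => rfl
  refine ⟨(ContinuousLinearMap.fst ℂ H H).comp (G.op.graph.subtypeL.comp
    (e.symm : H →L[ℂ] G.op.graph)), fun x y => ?_⟩
  have hval : ((ContinuousLinearMap.fst ℂ H H).comp (G.op.graph.subtypeL.comp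
    (e.symm : H →L[ℂ] G.op.graph))) (x + y) = (e.symm (x + y)).1.1 := rfl
  rw [hval]
  have h1 : (e.symm (x + y)).1.1 + (e.symm (x + y)).1.2 = x + y := by
    rw [← hf, ← he, e.apply_symm_apply]
  constructor
  · intro h
    have : e.symm (x + y) = ⟨(x, y), h⟩ := by
      rw [ContinuousLinearEquiv.symm_apply_eq, he, hf]
    rw [this]
  · intro h
    have h2 : (e.symm (x + y)).1.2 = y := by
      rw [h] at h1; exact add_left_cancel h1
    have h3 : ((e.symm (x + y)).1.1, (e.symm (x + y)).1.2) ∈ G.op.graph := (e.symm (x + y)).2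
    rwa [h, h2] at h3

/-- Existence of the positive self-adjoint square root. -/
theorem exists_sqrt (G : PosOp H) : ∃ S : PosOp H, ∀ x y : H,
    (x, y) ∈ G.op.graph ↔ ∃ z, (x, z) ∈ S.op.graph ∧ (z, y) ∈ S.op.graph := by
  obtain ⟨R, hR⟩ := G.exists_resolvent
  have hRg : ∀ h, (R h, h - R h) ∈ G.op.graph := fun h => by rw [hR]; simp
  have real_of_symm : ∀ x y : H, ⟪x, y⟫_ℂ = ⟪y, x⟫_ℂ → (((⟪x, y⟫_ℂ).re : ℝ) : ℂ) = ⟪x, y⟫_ℂ := by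
    intro x y h
    rw [← Complex.conj_eq_iff_re, inner_conj_symm, h]
  have hself : ∀ x : H, (⟪x, x⟫_ℂ).re = ‖x‖ ^ 2 := fun x => by
    simpa using inner_self_eq_norm_sq (𝕜 := ℂ) x
  have hRpos : 0 ≤ R := by
    rw [ContinuousLinearMap.nonneg_iff_isPositive, ContinuousLinearMap.isPositive_iff_complex]
    intro h
    have hg := hRg h
    have e1 : ⟪R h, h⟫_ℂ = ⟪R h, R h⟫_ℂ + ⟪R h, h - R h⟫_ℂ := by
      rw [← inner_add_right]; simp
    have e2 : ⟪h, R h⟫_ℂ = ⟪R h, R h⟫_ℂ + ⟪h - R h, R h⟫_ℂ := by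
      rw [← inner_add_left]; simp
    refine ⟨real_of_symm _ _ ?_, ?_⟩
    · rw [e1, e2, G.graph_inner_symm hg hg]
    · change 0 ≤ (⟪R h, h⟫_ℂ).re
      rw [e1, Complex.add_re, hself]
      have := G.graph_inner_nonneg hg
      positivity
  have hRpos' : 0 ≤ 1 - R := by
    rw [ContinuousLinearMap.nonneg_iff_isPositive, ContinuousLinearMap.isPositive_iff_complex]
    intro h
    have hg := hRg h
    have e0 : (1 - R) h = h - R h := rfl
    rw [e0]
    have e1 : ⟪h - R h, h⟫_ℂ = ⟪h - R h, h - R h⟫_ℂ + ⟪h - R h, R h⟫_ℂ := by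
      rw [← inner_add_right, sub_add_cancel]
    have e2 : ⟪h, h - R h⟫_ℂ = ⟪h - R h, h - R h⟫_ℂ + ⟪R h, h - R h⟫_ℂ := by
      rw [← inner_add_left, sub_add_cancel]
    refine ⟨real_of_symm _ _ ?_, ?_⟩
    · rw [e1, e2, G.graph_inner_symm hg hg]
    · change 0 ≤ (⟪h - R h, h⟫_ℂ).re
      rw [e1, G.graph_inner_symm hg hg, Complex.add_re, hself]
      have := G.graph_inner_nonneg hg
      positivity
  set r := CFC.sqrt R with hr
  set c := CFC.sqrt (1 - R) with hc
  set q := CFC.sqrt r with hq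
  have hr0 : 0 ≤ r := CFC.sqrt_nonneg R
  have hc0 : 0 ≤ c := CFC.sqrt_nonneg _
  have hq0 : 0 ≤ q := CFC.sqrt_nonneg _
  have hrr : r * r = R := CFC.sqrt_mul_sqrt_self R hRpos
  have hcc : c * c = 1 - R := CFC.sqrt_mul_sqrt_self _ hRpos'
  have hqq : q * q = r := CFC.sqrt_mul_sqrt_self r hr0
  have comm_sqrt : ∀ a b : H →L[ℂ] H, Commute a b → Commute (CFC.sqrt a) b :=
    fun a b h => Commute.cfcₙ_nnreal h _
  have hcomm0 : Commute (1 - R) R := (Commute.one_left R).sub_left (Commute.refl R)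
  have hcomm : Commute r c := comm_sqrt _ _ (comm_sqrt _ _ hcomm0).symm
  have hcommq : Commute q c := comm_sqrt _ _ hcomm
  have sym : ∀ a : H →L[ℂ] H, 0 ≤ a → ∀ x y, ⟪a x, y⟫_ℂ = ⟪x, a y⟫_ℂ := fun a ha x y =>
    ((ContinuousLinearMap.nonneg_iff_isPositive a).1 ha).isSymmetric x y
  have hrrx : ∀ x, r (r x) = R x := fun x => congrArg (fun T : H →L[ℂ] H => T x) hrr
  have hccx : ∀ x, c (c x) = x - R x := fun x => congrArg (fun T : H →L[ℂ] H => T x) hcc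
  have hrcx : ∀ x, r (c x) = c (r x) := fun x => congrArg (fun T : H →L[ℂ] H => T x) hcomm.eq
  have hqcx : ∀ x, q (c x) = c (q x) := fun x => congrArg (fun T : H →L[ℂ] H => T x) hcommq.eq
  have hqqx : ∀ x, q (q x) = r x := fun x => congrArg (fun T : H →L[ℂ] H => T x) hqq
  have hRinj : ∀ x, R x = 0 → x = 0 := fun x hx => by
    have := hRg x
    rw [hx, sub_zero] at this
    exact G.op.graph_fst_eq_zero_snd this rfl
  have hrinj : ∀ x, r x = 0 → x = 0 := fun x hx => hRinj x (by rw [← hrrx, hx, map_zero])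
  let g : Submodule ℂ (H × H) := ((r.prod c : H →L[ℂ] H × H) : H →ₗ[ℂ] H × H).range
  have hg : ∀ x y, (x, y) ∈ g ↔ ∃ w, r w = x ∧ c w = y := fun x y => by
    simp [g, LinearMap.mem_range]
  have hgf : g.toLinearPMap.graph = g := by
    refine Submodule.toLinearPMap_graph_eq g ?_
    rintro ⟨x, y⟩ hxy hx
    obtain ⟨w, hw1, hw2⟩ := (hg x y).1 hxy
    simp only at hx
    have : w = 0 := hrinj w (hw1.trans hx)
    rw [← hw2, this, map_zero]
  have hdense : Dense (g.toLinearPMap.domain : Set H) := by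
    rw [Submodule.dense_iff_topologicalClosure_eq_top, Submodule.topologicalClosure_eq_top_iff,
      Submodule.eq_bot_iff]
    intro z hz
    rw [Submodule.mem_orthogonal] at hz
    have hmem : r (r z) ∈ g.toLinearPMap.domain := by
      rw [Submodule.toLinearPMap_domain]
      exact ⟨(r (r z), c (r z)), (hg _ _).2 ⟨r z, rfl, rfl⟩, rfl⟩
    have h1 := hz _ hmem
    rw [sym r hr0, inner_self_eq_zero] at h1
    exact hrinj z h1
  let S : PosOp H :=
    { op := g.toLinearPMap
      dense_domain := hdense
      selfAdjoint := by
        rw [LinearPMap.isSelfAdjoint_def]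
        apply LinearPMap.eq_of_eq_graph
        rw [LinearPMap.adjoint_graph_eq_graph_adjoint hdense, hgf]
        ext ⟨y, z⟩
        rw [Submodule.mem_adjoint_iff, hg]
        constructor
        · intro h
          have h1 : c y = r z := by
            refine ext_inner_left ℂ fun x => ?_
            have := h (r x) (c x) ((hg _ _).2 ⟨x, rfl, rfl⟩)
            rw [sub_eq_zero, sym c hc0, sym r hr0] at this
            exact this
          refine ⟨r y + c z, ?_, ?_⟩
          · rw [map_add, hrrx, hrcx, ← h1, hccx]; simp
          · rw [map_add, ← hrcx, h1, hrrx, hccx]; simp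
        · rintro ⟨w, rfl, rfl⟩ a b hab
          obtain ⟨v, rfl, rfl⟩ := (hg _ _).1 hab
          rw [sym c hc0, sym r hr0, hrcx, sub_self]
      nonneg := by
        intro x
        have hx : ((x : H), g.toLinearPMap x) ∈ g := hgf.le (LinearPMap.mem_graph _ x)
        obtain ⟨w, hw1, hw2⟩ := (hg _ _).1 hx
        rw [← hw1, ← hw2, ← hqqx, sym q hq0, hqcx]
        have := ((ContinuousLinearMap.nonneg_iff_isPositive c).1 hc0).re_inner_nonneg_right (q w)
        exact this }
  have hS : S.op.graph = g := hgf
  refine ⟨S, fun x y => ?_⟩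
  rw [hS, hR]
  constructor
  · intro h
    refine ⟨c (r (x + y)), (hg _ _).2 ⟨r (x + y), by rw [hrrx, h], rfl⟩,
      (hg _ _).2 ⟨c (x + y), by rw [hrcx], ?_⟩⟩
    rw [hccx, h]; simp
  · rintro ⟨z, h1, h2⟩
    obtain ⟨u, rfl, rfl⟩ := (hg _ _).1 h1
    obtain ⟨v, hv1, rfl⟩ := (hg _ _).1 h2
    have hu : u = r (r u + c v) := by
      rw [map_add, hrrx, hrcx, hv1, hccx]; simp
    have hv : v = c (r u + c v) := by
      rw [map_add, ← hrcx, ← hv1, hrrx, hccx]; simp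
    have hR2 : R (r u + c v) = r u := by
      rw [← hrrx, ← hu]
    exact hR2

/-- The square root `√G`: the positive self-adjoint operator `S` with `S² = G`
(as operators with domains). -/
def sqrt (G : PosOp H) : PosOp H := G.exists_sqrt.choose

theorem sqrt_spec (G : PosOp H) (x y : H) :
    (x, y) ∈ G.op.graph ↔ ∃ z, (x, z) ∈ G.sqrt.op.graph ∧ (z, y) ∈ G.sqrt.op.graph :=
  G.exists_sqrt.choose_spec x y

/-- `inf {‖G φ‖ : φ ∈ D(G), ‖φ‖ = 1} = 0`. -/
def InfZero (G : PosOp H) : Prop :=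
  IsGLB {t : ℝ | ∃ x : G.op.domain, ‖(x : H)‖ = 1 ∧ t = ‖G.op x‖} 0

/-- `G` is discrete: `G = ∑ₖ Eₖ |τₖ⟩⟨τₖ|` with its natural domain, for an orthonormal basis `τ`
and a nondecreasing sequence `E` tending to `+∞`. -/
def IsDiscrete (G : PosOp H) : Prop :=
  ∃ (τ : HilbertBasis ℕ ℂ H) (E : ℕ → ℝ), Monotone E ∧ Filter.Tendsto E Filter.atTop Filter.atTop ∧
    (∀ x : H, x ∈ G.op.domain ↔ Summable fun k => E k ^ 2 * ‖⟪τ k, x⟫_ℂ‖ ^ 2) ∧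
    ∀ x : G.op.domain, HasSum (fun k => ((E k : ℂ) * ⟪τ k, (x : H)⟫_ℂ) • τ k) (G.op x)

end PosOp

/-! ## Relatively bounded operators -/

section RelBounded

variable {X Y : Type*} [NormedAddCommGroup X] [InnerProductSpace ℂ X]
  [NormedAddCommGroup Y] [InnerProductSpace ℂ Y]

/-- `‖A φ‖² ≤ a² ‖φ‖² + b² ‖S φ‖²` for all `φ ∈ D(S)`. -/
def RelBoundWith (S : X →ₗ.[ℂ] X) (A : S.domain →ₗ[ℂ] Y) (a b : ℝ) : Prop :=
  ∀ x : S.domain, ‖A x‖ ^ 2 ≤ a ^ 2 * ‖(x : X)‖ ^ 2 + b ^ 2 * ‖S x‖ ^ 2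

/-- `A`, defined on `D(S)`, is relatively bounded with respect to `S`. -/
def IsRelBounded (S : X →ₗ.[ℂ] X) (A : S.domain →ₗ[ℂ] Y) : Prop :=
  ∃ a b : ℝ, 0 ≤ a ∧ 0 ≤ b ∧ RelBoundWith S A a b

/-- The relative bound of `A` with respect to `S`. -/
def relBound (S : X →ₗ.[ℂ] X) (A : S.domain →ₗ[ℂ] Y) : ℝ :=
  sInf {b : ℝ | 0 ≤ b ∧ ∃ a : ℝ, 0 ≤ a ∧ RelBoundWith S A a b}

/-- The space of `S`-bounded operators on `X`; operators that coincide on `D(S)` are identified. -/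
def relBoundedOps (S : X →ₗ.[ℂ] X) : Submodule ℂ (S.domain →ₗ[ℂ] X) where
  carrier := {A | IsRelBounded S A}
  zero_mem' := ⟨0, 0, le_rfl, le_rfl, fun x => by simp⟩
  add_mem' := by
    rintro A B ⟨a, b, ha, hb, hA⟩ ⟨a', b', ha', hb', hB⟩
    refine ⟨2 * (a + a'), 2 * (b + b'), by positivity, by positivity, fun x => ?_⟩
    have h1 := hA x
    have h2 := hB x
    have h3 : ‖(A + B) x‖ ^ 2 ≤ 2 * ‖A x‖ ^ 2 + 2 * ‖B x‖ ^ 2 := by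
      have h4 : ‖(A + B) x‖ ≤ ‖A x‖ + ‖B x‖ := norm_add_le _ _
      have h5 := norm_nonneg ((A + B) x)
      nlinarith [sq_nonneg (‖A x‖ - ‖B x‖)]
    have h6 : 2 * (a ^ 2 + a' ^ 2) ≤ (2 * (a + a')) ^ 2 := by nlinarith [mul_nonneg ha ha']
    have h7 : 2 * (b ^ 2 + b' ^ 2) ≤ (2 * (b + b')) ^ 2 := by nlinarith [mul_nonneg hb hb']
    have h8 := mul_le_mul_of_nonneg_right h6 (sq_nonneg ‖(x : X)‖)
    have h9 := mul_le_mul_of_nonneg_right h7 (sq_nonneg ‖S x‖)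
    linarith
  smul_mem' := by
    rintro t A ⟨a, b, ha, hb, hA⟩
    refine ⟨‖t‖ * a, ‖t‖ * b, by positivity, by positivity, fun x => ?_⟩
    have h1 := mul_le_mul_of_nonneg_left (hA x) (sq_nonneg ‖t‖)
    have h2 : ‖(t • A) x‖ = ‖t‖ * ‖A x‖ := by rw [LinearMap.smul_apply, norm_smul]
    rw [h2]
    linarith

/-- A bounded operator, restricted to `D(S)`. -/
def boundedRestrict (S : X →ₗ.[ℂ] X) (A : X →L[ℂ] X) : relBoundedOps S :=
  ⟨(A : X →ₗ[ℂ] X).domRestrict S.domain, ‖A‖, 0, norm_nonneg A, le_rfl, fun x => by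
    have h : ‖A (x : X)‖ ≤ ‖A‖ * ‖(x : X)‖ := A.le_opNorm x
    have h' := pow_le_pow_left₀ (norm_nonneg _) h 2
    rw [mul_pow] at h'
    simpa using h'⟩

end RelBounded

/-! ## Traces and states -/

section States

variable {H : Type*} [NormedAddCommGroup H] [InnerProductSpace ℂ H] [CompleteSpace H]

/-- An index set of a fixed orthonormal basis of `H`. -/
def onbIndex (H : Type*) [NormedAddCommGroup H] [InnerProductSpace ℂ H] [CompleteSpace H] : Set H :=
  (exists_hilbertBasis ℂ H).choose

/-- A fixed orthonormal basis of `H`. The traces below do not depend on it. -/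
def onb (H : Type*) [NormedAddCommGroup H] [InnerProductSpace ℂ H] [CompleteSpace H] :
    HilbertBasis (onbIndex H) ℂ H :=
  (exists_hilbertBasis ℂ H).choose_spec.choose

/-- The trace; used for trace-class operators only. -/
def opTrace (T : H →L[ℂ] H) : ℂ := ∑' i, ⟪onb H i, T (onb H i)⟫_ℂ

/-- The trace (finite or infinite) of a positive operator. -/
def posTrace (ρ : H →L[ℂ] H) : ℝ≥0∞ := ∑' i, ENNReal.ofReal (⟪onb H i, ρ (onb H i)⟫_ℂ).re

/-- A positive trace-class operator. -/
def IsPosTraceClass (ρ : H →L[ℂ] H) : Prop := ρ.IsPositive ∧ posTrace ρ ≠ ⊤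

/-- A state (density operator): a positive trace-class operator with unit trace. -/
def IsState (ρ : H →L[ℂ] H) : Prop := ρ.IsPositive ∧ posTrace ρ = 1

open Classical in
/-- `‖A φ‖²`, with the value `+∞` if `φ` is not in the domain of `A`. -/
def sqNormOp (A : H →ₗ.[ℂ] H) (x : H) : ℝ≥0∞ :=
  if h : x ∈ A.domain then ENNReal.ofReal (‖A ⟨x, h⟩‖ ^ 2) else ⊤

/-- `Tr A ρ A*`, computed as `∑ᵢ ‖A φᵢ‖²` from the decomposition `ρ = ∑ᵢ |φᵢ⟩⟨φᵢ|` with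
`φᵢ = ρ^{1/2} eᵢ`. -/
def trConj (A : H →ₗ.[ℂ] H) (ρ : H →L[ℂ] H) : ℝ≥0∞ :=
  ∑' i, sqNormOp A (CFC.sqrt ρ (onb H i))

namespace PosOp

/-- `Tr G ρ = Tr √G ρ √G`, finite or infinite. -/
def energy (G : PosOp H) (ρ : H →L[ℂ] H) : ℝ≥0∞ := trConj G.sqrt.op ρ

/-- The space of `√G`-bounded operators on `H`. -/
abbrev BG (G : PosOp H) : Submodule ℂ (G.sqrt.op.domain →ₗ[ℂ] H) := relBoundedOps G.sqrt.op

/-- The inclusion of the bounded operators into the `√G`-bounded ones. -/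
abbrev incl (G : PosOp H) (A : H →L[ℂ] H) : G.BG := boundedRestrict G.sqrt.op A

/-- The operator `E`-norm `sup {√(Tr A ρ A*) : ρ a state, Tr G ρ ≤ E}`. -/
def eNorm (G : PosOp H) (E : ℝ≥0∞) (A : G.BG) : ℝ≥0∞ :=
  ⨆ (ρ : H →L[ℂ] H) (_ : IsState ρ) (_ : G.energy ρ ≤ E),
    (trConj ⟨G.sqrt.op.domain, A.1⟩ ρ) ^ (1 / 2 : ℝ)

/-- The `√G`-bound of a `√G`-bounded operator. -/
def bound (G : PosOp H) (A : G.BG) : ℝ := relBound G.sqrt.op A.1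

end PosOp

end States

/-! ## Maps between algebras of bounded operators -/

section Maps

variable {H H' : Type*} [NormedAddCommGroup H] [InnerProductSpace ℂ H] [CompleteSpace H]
  [NormedAddCommGroup H'] [InnerProductSpace ℂ H'] [CompleteSpace H']

/-- Normality: suprema of increasing nets are preserved. -/
def IsNormalMap (Φ : (H →L[ℂ] H) →CP (H' →L[ℂ] H')) : Prop :=
  ∀ s : Set (H →L[ℂ] H), s.Nonempty → DirectedOn (· ≤ ·) s →
    ∀ A, IsLUB s A → IsLUB (Φ '' s) (Φ A)

open Classical in
/-- The predual map on positive trace-class operators: `Φ_*(ρ)` is the positive trace-class operator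
`σ` with `Tr σ A = Tr Φ(A) ρ` for all bounded `A`. For normal completely positive `Φ` it exists
and is unique. -/
def predual (Φ : (H →L[ℂ] H) →CP (H' →L[ℂ] H')) (ρ : H' →L[ℂ] H') : H →L[ℂ] H :=
  if h : ∃ σ : H →L[ℂ] H, IsPosTraceClass σ ∧ ∀ A : H →L[ℂ] H, opTrace (σ * A) = opTrace (Φ A * ρ)
  then h.choose else 0

/-- `Tr G Φ_*(ρ) < ∞` for every state `ρ` with `Tr G' ρ < ∞`. -/
def IsLimited (G : PosOp H) (G' : PosOp H') (Φ : (H →L[ℂ] H) →CP (H' →L[ℂ] H')) : Prop :=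
  ∀ ρ : H' →L[ℂ] H', IsState ρ → G'.energy ρ < ⊤ → G.energy (predual Φ ρ) < ⊤

/-- `Y_Φ(E) = sup {Tr G Φ_*(ρ) : ρ a state, Tr G' ρ ≤ E}`. -/
def outEnergy (G : PosOp H) (G' : PosOp H') (Φ : (H →L[ℂ] H) →CP (H' →L[ℂ] H')) (E : ℝ≥0) :
    ℝ≥0∞ :=
  ⨆ (ρ : H' →L[ℂ] H') (_ : IsState ρ) (_ : G'.energy ρ ≤ E), G.energy (predual Φ ρ)

/-- Continuity of `Φ` from `(B(H), ‖·‖_E^G)` to `(B(H'), ‖·‖_E^{G'})`. -/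
def IsENormContinuous (G : PosOp H) (G' : PosOp H') (Φ : (H →L[ℂ] H) →CP (H' →L[ℂ] H'))
    (E : ℝ≥0) : Prop :=
  ∀ A : H →L[ℂ] H, ∀ ε : ℝ≥0∞, 0 < ε → ∃ δ : ℝ≥0∞, 0 < δ ∧ ∀ B : H →L[ℂ] H,
    G.eNorm E (G.incl (B - A)) < δ → G'.eNorm E (G'.incl (Φ B - Φ A)) < ε

/-! ### Stinespring representations -/

/-- The Hilbert space tensor product `H ⊗ K`. -/
abbrev HTensor (H K : Type*) [NormedAddCommGroup H] [InnerProductSpace ℂ H]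
    [NormedAddCommGroup K] [InnerProductSpace ℂ K] : Type _ :=
  UniformSpace.Completion (H ⊗[ℂ] K)

variable {K : Type*} [NormedAddCommGroup K] [InnerProductSpace ℂ K]

/-- The vector `x ⊗ y`. -/
def tens (x : H) (y : K) : HTensor H K := ((x ⊗ₜ[ℂ] y : H ⊗[ℂ] K) : HTensor H K)

variable (K) in
/-- `A ⊗ I_K` for a bounded operator `A`. -/
def ampl (A : H →L[ℂ] H) : HTensor H K →L[ℂ] HTensor H K := (A.rTensor K).completion

/-- `Φ(A) = V* (A ⊗ I_K) V` for all bounded `A`. -/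
def IsStinespring (Φ : (H →L[ℂ] H) →CP (H' →L[ℂ] H')) (V : H' →L[ℂ] HTensor H K) : Prop :=
  ∀ A : H →L[ℂ] H, Φ A = (ContinuousLinearMap.adjoint V).comp ((ampl K A).comp V)

/-- The vectors `(A ⊗ I_K) V φ` span a dense subspace. -/
def IsMinimalDilation (V : H' →L[ℂ] HTensor H K) : Prop :=
  Dense (Submodule.span ℂ {ξ : HTensor H K | ∃ (A : H →L[ℂ] H) (x : H'), ξ = ampl K A (V x)} :
    Set (HTensor H K))

/-- `Φ` has finite Choi rank: the space `K` of a minimal Stinespring representation is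
finite-dimensional. -/
def HasFiniteChoiRank (Φ : (H →L[ℂ] H) →CP (H' →L[ℂ] H')) : Prop :=
  ∃ (K : Type) (_ : NormedAddCommGroup K) (_ : InnerProductSpace ℂ K)
    (V : H' →L[ℂ] HTensor H K),
    FiniteDimensional ℂ K ∧ IsStinespring Φ V ∧ IsMinimalDilation V

variable (K) in
/-- The unbounded operator `S ⊗ I_K`: its graph is the closure of the span of the pairs
`(x ⊗ y, S x ⊗ y)`, `x ∈ D(S)`, `y ∈ K`. -/
def amplPMap (S : H →ₗ.[ℂ] H) : HTensor H K →ₗ.[ℂ] HTensor H K :=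
  (Submodule.span ℂ {p : HTensor H K × HTensor H K |
    ∃ (x : S.domain) (y : K), p = (tens (x : H) y, tens (S x) y)}).topologicalClosure.toLinearPMap

/-- `T` is the `S ⊗ I_K`-bounded extension to `D(S ⊗ I_K)` of the operator `A ⊗ I_K`, which is
defined on the algebraic tensor product of `D(S)` and `K`. -/
def IsAmplExtension (S : H →ₗ.[ℂ] H) (A : S.domain →ₗ[ℂ] H)
    (T : (amplPMap K S).domain →ₗ[ℂ] HTensor H K) : Prop :=
  IsRelBounded (amplPMap K S) T ∧
    ∀ (x : S.domain) (y : K) (h : tens (x : H) y ∈ (amplPMap K S).domain),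
      T ⟨tens (x : H) y, h⟩ = tens (A x) y

/-- `Ψ(A) φ = V* (A ⊗ I_K) V φ` for every `√G`-bounded `A` and `φ ∈ D(√G')`; in particular `V`
maps `D(√G')` into `D(√G ⊗ I_K)`. -/
def IsInducedBy (G : PosOp H) (G' : PosOp H') (V : H' →L[ℂ] HTensor H K)
    (Ψ : G.BG →ₗ[ℂ] G'.BG) : Prop :=
  ∀ A : G.BG, ∃ T : (amplPMap K G.sqrt.op).domain →ₗ[ℂ] HTensor H K,
    IsAmplExtension G.sqrt.op A.1 T ∧
    ∀ x : G'.sqrt.op.domain, ∃ h : V (x : H') ∈ (amplPMap K G.sqrt.op).domain,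
      (Ψ A).1 x = ContinuousLinearMap.adjoint V (T ⟨V (x : H'), h⟩)

end Maps

end

set_option linter.unusedSectionVars false

noncomputable section

/-! ## Cutoffs of a positive operator -/

section Cutoff

/-! States are handled through families of vectors: for ρ = ∑ |ψ_i⟩⟨ψ_i| all energies and norms
become sums over the ψ_i. Put D² = G(1+G)⁻¹. The geometric series λ = ∑_{j≥1} (λ/(1+λ))^j turns into
‖√G x‖² = ∑_j ‖D^{j+1} x‖² (`PosOp.sqNormOp_sqrt_eq_tsum`), a sum of bounded forms, and this
replaces the spectral theorem: Parseval and an exchange of sums show that Tr Gρ does not depend on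
the decomposition. For a √G-bounded A the operators A(1 - D^{2n}) are bounded, converge to A on
D(√G) and are dominated by the relative bound of A, so statements about bounded operators pass to A
by dominated convergence.

Part A. A Stinespring operator V, together with an orthonormal basis f_k of K, gives slices V_k x of
V x, and Φ_*(∑ |φ_i⟩⟨φ_i|) is decomposed by the vectors V_k φ_i
(`IsStinespring.decomposes_predual`). If the output energies were unbounded at some E, a mixture
with weights 2^{-(n+1)} would be a state of energy at most E with infinite output energy; hence
Y_Φ(E) is finite. Infimum zero of G' allows a subnormalized family to be completed at negligible
energy cost, so the output energy of one vector x is at most Y_Φ(E)(‖x‖² + ‖√G' x‖²/E). This puts V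
x into D(√G ⊗ I) and gives the relative bounds. The norm inequality follows because the V_k φ_i are
a subnormalized family of energy at most Y_Φ(E) and ‖V*‖² = ‖Φ(I)‖. Since V*(A ⊗ I)V x is the limit
of Φ(A(1 - D^{2n})) x, it does not depend on V. Scaling shows that Y_Φ(E)/E is nonincreasing, so the
limit k_Φ exists; the √G-bounds are compared by letting E tend to infinity.

Part B is a duality argument. The operator |η⟩⟨√G d| has E-norm at most ‖η‖ ‖d‖ √E, whatever the
size of √G d. Continuity of Φ therefore bounds ⟨y, Φ(|η⟩⟨√G d|) x⟩ by a multiple of ‖d‖. This number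
is ⟨√G d, s⟩, where s is the slice of V x along (⟨η| ⊗ I)V y, so self-adjointness puts s into D(√G)
with a norm bound (`IsENormContinuous.exists_norm_sqrt_slice_le`). With finite Choi rank these
directions fill K and finitely many slices suffice. If Φ(I) = Φ(P), all slices lie in the range of
P, and √G is bounded on the finite-dimensional part of that range inside D(√G). -/

theorem ofReal_norm_sq_eq_enorm_sq {H : Type*} [NormedAddCommGroup H] (x : H) :
    ENNReal.ofReal (‖x‖ ^ 2) = ‖x‖ₑ ^ 2 := by
  rw [ENNReal.ofReal_pow (norm_nonneg _), ofReal_norm]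

variable {H : Type*} [NormedAddCommGroup H] [InnerProductSpace ℂ H]

theorem sqNormOp_of_mem {A : H →ₗ.[ℂ] H} {x : H} (h : x ∈ A.domain) :
    sqNormOp A x = ‖A ⟨x, h⟩‖ₑ ^ 2 := by
  rw [sqNormOp, dif_pos h, ofReal_norm_sq_eq_enorm_sq]

theorem sqNormOp_of_mem_graph {A : H →ₗ.[ℂ] H} {x y : H} (h : (x, y) ∈ A.graph) :
    sqNormOp A x = ‖y‖ₑ ^ 2 := by
  have hx := LinearPMap.mem_domain_of_mem_graph h
  rw [sqNormOp_of_mem hx, (LinearPMap.image_iff hx).2 h]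

theorem mem_domain_of_sqNormOp_ne_top {A : H →ₗ.[ℂ] H} {x : H} (h : sqNormOp A x ≠ ⊤) :
    x ∈ A.domain := by
  by_contra hx
  exact h (by rw [sqNormOp, dif_neg hx])

theorem sqNormOp_smul (A : H →ₗ.[ℂ] H) {c : ℂ} (hc : c ≠ 0) (x : H) :
    sqNormOp A (c • x) = ‖c‖ₑ ^ 2 * sqNormOp A x := by
  by_cases hx : x ∈ A.domain
  · have h : (c • x, c • A ⟨x, hx⟩) ∈ A.graph :=
      A.graph.smul_mem c (A.mem_graph ⟨x, hx⟩)
    rw [sqNormOp_of_mem_graph h, sqNormOp_of_mem hx, enorm_smul, mul_pow]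
  · have hx' : c • x ∉ A.domain := fun h => hx (by
      simpa [smul_smul, inv_mul_cancel₀ hc] using A.domain.smul_mem c⁻¹ h)
    rw [sqNormOp, dif_neg hx', sqNormOp, dif_neg hx, ENNReal.mul_top]
    simpa using hc

theorem sqNormOp_zero (A : H →ₗ.[ℂ] H) : sqNormOp A 0 = 0 := by
  rw [sqNormOp_of_mem_graph A.graph.zero_mem]; simp

variable [CompleteSpace H]

namespace PosOp

/-- A vector at which the form `d ↦ ⟪S d, x⟫` is bounded belongs to the domain of `S`. -/
theorem exists_mem_graph_of_bound (S : PosOp H) {x : H} {c : ℝ} (hc : 0 ≤ c)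
    (h : ∀ a b, (a, b) ∈ S.op.graph → ‖⟪b, x⟫_ℂ‖ ≤ c * ‖a‖) :
    ∃ z, (x, z) ∈ S.op.graph ∧ ‖z‖ ≤ c := by
  -- Self-adjointness identifies D(S) with the adjoint domain, where membership means continuity of
  -- d ↦ ⟪x, S d⟫.
  have hx : x ∈ S.op.domain := by
    rw [← LinearPMap.isSelfAdjoint_def.1 S.selfAdjoint, LinearPMap.mem_adjoint_domain_iff]
    refine AddMonoidHomClass.continuous_of_bound
      ((innerₛₗ ℂ x).comp S.op.toFun) c fun d => ?_
    have h1 := h d (S.op d) (S.op.mem_graph d)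
    rw [norm_inner_symm] at h1
    exact h1
  refine ⟨S.op ⟨x, hx⟩, S.op.mem_graph ⟨x, hx⟩, ?_⟩
  set z := S.op ⟨x, hx⟩
  have hz : (x, z) ∈ S.op.graph := S.op.mem_graph ⟨x, hx⟩
  have hcl : IsClosed {d : H | ‖⟪d, z⟫_ℂ‖ ≤ c * ‖d‖} :=
    isClosed_le (by fun_prop) (by fun_prop)
  have hsub : (S.op.domain : Set H) ⊆ {d : H | ‖⟪d, z⟫_ℂ‖ ≤ c * ‖d‖} := by
    intro d hd
    have hg := S.op.mem_graph ⟨d, hd⟩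
    have h1 := h _ _ hg
    rwa [S.graph_inner_symm hg hz] at h1
  -- By density the bound holds for every d, in particular for d = z, which gives ‖z‖² ≤ c‖z‖.
  have hall : ‖⟪z, z⟫_ℂ‖ ≤ c * ‖z‖ := closure_minimal hsub hcl (S.dense_domain z)
  rw [inner_self_eq_norm_sq_to_K] at hall
  norm_num at hall
  by_contra! hlt
  nlinarith

/-- A self-adjoint contraction `D` such that `1 - D ^ (2 * n)` maps into the domain of `G`;
namely `D ^ 2 = 1 - (1 + G)⁻¹`. -/
theorem exists_root (G : PosOp H) : ∃ D : H →L[ℂ] H, IsSelfAdjoint D ∧ ‖D‖ ≤ 1 ∧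
    ∀ (n : ℕ) (x : H), (x - (D ^ (2 * n)) x, ∑ j ∈ Finset.range n, (D ^ (2 * (j + 1))) x) ∈
      G.op.graph := by
  obtain ⟨R, hR⟩ := G.exists_resolvent
  have hRg : ∀ h, (R h, h - R h) ∈ G.op.graph := fun h => by rw [hR]; simp
  have hself : ∀ x : H, (⟪x, x⟫_ℂ).re = ‖x‖ ^ 2 := fun x => by
    simpa using inner_self_eq_norm_sq (𝕜 := ℂ) x
  have hCpos : 0 ≤ 1 - R := by
    rw [ContinuousLinearMap.nonneg_iff_isPositive, ContinuousLinearMap.isPositive_iff_complex]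
    intro h
    have hg := hRg h
    have e0 : (1 - R) h = h - R h := rfl
    rw [e0]
    have e1 : ⟪h - R h, h⟫_ℂ = ⟪h - R h, h - R h⟫_ℂ + ⟪h - R h, R h⟫_ℂ := by
      rw [← inner_add_right, sub_add_cancel]
    have e2 : ⟪h, h - R h⟫_ℂ = ⟪h - R h, h - R h⟫_ℂ + ⟪R h, h - R h⟫_ℂ := by
      rw [← inner_add_left, sub_add_cancel]
    refine ⟨?_, ?_⟩
    · change (((⟪h - R h, h⟫_ℂ).re : ℝ) : ℂ) = ⟪h - R h, h⟫_ℂ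
      rw [← Complex.conj_eq_iff_re, inner_conj_symm, e1, e2, G.graph_inner_symm hg hg]
    · change 0 ≤ (⟪h - R h, h⟫_ℂ).re
      rw [e1, G.graph_inner_symm hg hg, Complex.add_re, hself]
      have := G.graph_inner_nonneg hg
      positivity
  set D := CFC.sqrt (1 - R) with hD
  have hDD : D * D = 1 - R := CFC.sqrt_mul_sqrt_self _ hCpos
  have hD0 : 0 ≤ D := CFC.sqrt_nonneg _
  have hDs : IsSelfAdjoint D := IsSelfAdjoint.of_nonneg hD0
  refine ⟨D, hDs, ?_, fun n x => ?_⟩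
  · refine ContinuousLinearMap.opNorm_le_bound _ zero_le_one fun x => ?_
    rw [one_mul]
    refine le_of_sq_le_sq ?_ (norm_nonneg _)
    have h1 : ⟪D x, D x⟫_ℂ = ⟪x, (D * D) x⟫_ℂ :=
      ((ContinuousLinearMap.nonneg_iff_isPositive D).1 hD0).isSymmetric x (D x)
    have h2 : (D * D) x = x - R x := by rw [hDD]; rfl
    have hg := hRg x
    have h3 : ⟪x, x - R x⟫_ℂ = ⟪x, x⟫_ℂ - ⟪R x, R x⟫_ℂ - ⟪x - R x, R x⟫_ℂ := by
      rw [inner_sub_right, inner_sub_left]; ring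
    rw [← hself (D x), h1, h2, h3, Complex.sub_re, Complex.sub_re, hself, hself,
      G.graph_inner_symm hg hg]
    nlinarith [G.graph_inner_nonneg hg, sq_nonneg ‖R x‖]
  -- Graph membership of (x', y') means R(x' + y') = x'; here it becomes the geometric identity R
  -- ∑_{j<n} D^{2j} = 1 - D^{2n}.
  · have hRD : R = 1 - D ^ 2 := by rw [sq, hDD, sub_sub_cancel]
    have hgeom : ∀ n : ℕ, x - (D ^ (2 * n)) x + ∑ j ∈ Finset.range n, (D ^ (2 * (j + 1))) x =
        ∑ j ∈ Finset.range n, (D ^ (2 * j)) x := by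
      intro n
      induction n with
      | zero => simp
      | succ n ih =>
        rw [Finset.sum_range_succ, Finset.sum_range_succ _ n, ← ih]
        abel
    rw [hR, hgeom]
    have : (R * ∑ j ∈ Finset.range n, (D ^ 2) ^ j) = 1 - D ^ (2 * n) := by
      rw [hRD, mul_neg_geom_sum, pow_mul]
    have h2 := congrArg (fun T : H →L[ℂ] H => T x) this
    simpa [pow_mul] using h2

/-- A self-adjoint contraction `D` with `D ^ 2 = 1 - (1 + G)⁻¹`. -/
def root (G : PosOp H) : H →L[ℂ] H := G.exists_root.choose

theorem root_isSelfAdjoint (G : PosOp H) : IsSelfAdjoint G.root := G.exists_root.choose_spec.1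

theorem root_norm_le (G : PosOp H) : ‖G.root‖ ≤ 1 := G.exists_root.choose_spec.2.1

theorem root_graph (G : PosOp H) (n : ℕ) (x : H) :
    (x - (G.root ^ (2 * n)) x, ∑ j ∈ Finset.range n, (G.root ^ (2 * (j + 1))) x) ∈ G.op.graph :=
  G.exists_root.choose_spec.2.2 n x

theorem norm_root_pow_apply_le (G : PosOp H) (n : ℕ) (x : H) : ‖(G.root ^ n) x‖ ≤ ‖x‖ := by
  induction n with
  | zero => simp
  | succ n ih =>
    rw [pow_succ']
    refine (G.root.le_opNorm _).trans (le_trans ?_ ih)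
    exact mul_le_of_le_one_left (norm_nonneg _) G.root_norm_le

theorem inner_root_pow (G : PosOp H) (m n : ℕ) (x : H) :
    ⟪(G.root ^ m) x, (G.root ^ n) x⟫_ℂ = ⟪x, (G.root ^ (m + n)) x⟫_ℂ := by
  have h := ((G.root_isSelfAdjoint.pow m).isSymmetric) x ((G.root ^ n) x)
  rw [pow_add]
  exact h

theorem re_inner_root_pow (G : PosOp H) {m n k : ℕ} (h : m + n = 2 * k) (x : H) :
    (⟪(G.root ^ m) x, (G.root ^ n) x⟫_ℂ).re = ‖(G.root ^ k) x‖ ^ 2 := by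
  rw [inner_root_pow, h, two_mul, ← inner_root_pow]
  simpa using inner_self_eq_norm_sq (𝕜 := ℂ) ((G.root ^ k) x)

theorem re_inner_eq_norm_sqrt_sq (G : PosOp H) {x y z : H} (h : (x, y) ∈ G.op.graph)
    (hz : (x, z) ∈ G.sqrt.op.graph) : (⟪x, y⟫_ℂ).re = ‖z‖ ^ 2 := by
  obtain ⟨z', h1, h2⟩ := (G.sqrt_spec x y).1 h
  have e : z' = z := LinearPMap.mem_graph_snd_inj _ h1 hz rfl
  subst e
  rw [← G.sqrt.graph_inner_symm h1 h2]
  simpa using inner_self_eq_norm_sq (𝕜 := ℂ) z'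

/-- The image of a cutoff vector under `√G`, with its norm. -/
theorem exists_sqrt_cutoff (G : PosOp H) (n : ℕ) (x : H) :
    ∃ z, (x - (G.root ^ (2 * n)) x, z) ∈ G.sqrt.op.graph ∧
      ‖z‖ ^ 2 ≤ ∑ j ∈ Finset.range n, ‖(G.root ^ (j + 1)) x‖ ^ 2 ∧
      ∀ y, (x, y) ∈ G.sqrt.op.graph →
        ∑ j ∈ Finset.range n, ‖(G.root ^ (j + 1)) x‖ ^ 2 = (⟪y, z⟫_ℂ).re := by
  obtain ⟨z, h1, h2⟩ := (G.sqrt_spec _ _).1 (G.root_graph n x)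
  have hsum : (⟪x, ∑ j ∈ Finset.range n, (G.root ^ (2 * (j + 1))) x⟫_ℂ).re =
      ∑ j ∈ Finset.range n, ‖(G.root ^ (j + 1)) x‖ ^ 2 := by
    rw [inner_sum, Complex.re_sum]
    refine Finset.sum_congr rfl fun j _ => ?_
    have := G.re_inner_root_pow (m := 0) (n := 2 * (j + 1)) (k := j + 1) (by ring) x
    simpa using this
  refine ⟨z, h1, ?_, fun y hy => ?_⟩
  -- Expanding ‖z‖² gives the sum in question minus the terms ‖D^{n+j+1} x‖², which are dropped.
  · rw [← G.re_inner_eq_norm_sqrt_sq (G.root_graph n x) h1, inner_sub_left, Complex.sub_re, hsum]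
    refine sub_le_self _ ?_
    rw [inner_sum, Complex.re_sum]
    refine Finset.sum_nonneg fun j _ => ?_
    rw [G.re_inner_root_pow (k := n + (j + 1)) (by ring)]
    positivity
  · rw [← hsum, ← G.sqrt.graph_inner_symm hy h2]

/-- The partial sum s equals Re ⟪y, z⟫ for a z with ‖z‖² ≤ s, so s ≤ ‖y‖ √s by Cauchy–Schwarz. -/
theorem sum_root_le (G : PosOp H) {x y : H} (h : (x, y) ∈ G.sqrt.op.graph) (n : ℕ) :
    ∑ j ∈ Finset.range n, ‖(G.root ^ (j + 1)) x‖ ^ 2 ≤ ‖y‖ ^ 2 := by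
  obtain ⟨z, -, h2, h3⟩ := G.exists_sqrt_cutoff n x
  have h4 := h3 y h
  have h5 : (⟪y, z⟫_ℂ).re ≤ ‖y‖ * ‖z‖ := re_inner_le_norm (𝕜 := ℂ) y z
  nlinarith [norm_nonneg y, norm_nonneg z, sq_nonneg (‖y‖ - ‖z‖)]

/-- The vectors x - D^{2n} x tend to x while their images under √G stay in the ball of radius c.
Hence d ↦ ⟪√G d, x⟫ is bounded by c‖d‖, and self-adjointness applies. -/
theorem exists_mem_graph_of_sum_root_le (G : PosOp H) {x : H} {c : ℝ} (hc : 0 ≤ c)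
    (h : ∀ n, ∑ j ∈ Finset.range n, ‖(G.root ^ (j + 1)) x‖ ^ 2 ≤ c ^ 2) :
    ∃ y, (x, y) ∈ G.sqrt.op.graph ∧ ‖y‖ ≤ c := by
  have hsm : Summable fun j => ‖(G.root ^ (j + 1)) x‖ ^ 2 :=
    summable_of_sum_range_le (fun _ => by positivity) h
  have h0 : Filter.Tendsto (fun n => ‖(G.root ^ n) x‖ ^ 2) Filter.atTop (𝓝 0) :=
    (Filter.tendsto_add_atTop_iff_nat 1).1 hsm.tendsto_atTop_zero
  have h1 : Filter.Tendsto (fun n => (G.root ^ n) x) Filter.atTop (𝓝 0) := by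
    rw [tendsto_zero_iff_norm_tendsto_zero]
    have := h0.sqrt
    simpa using this
  have h2 : Filter.Tendsto (fun n => x - (G.root ^ (2 * n)) x) Filter.atTop (𝓝 x) := by
    have := (h1.comp (Filter.tendsto_id.const_mul_atTop' (zero_lt_two (α := ℕ)))).const_sub x
    simpa using this
  refine G.sqrt.exists_mem_graph_of_bound hc fun a b hab => ?_
  have h3 : Filter.Tendsto (fun n => ‖⟪b, x - (G.root ^ (2 * n)) x⟫_ℂ‖) Filter.atTop
      (𝓝 ‖⟪b, x⟫_ℂ‖) := (tendsto_const_nhds.inner h2).norm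
  refine le_of_tendsto h3 (Filter.Eventually.of_forall fun n => ?_)
  obtain ⟨z, hz1, hz2, -⟩ := G.exists_sqrt_cutoff n x
  rw [G.sqrt.graph_inner_symm hab hz1]
  have hz : ‖z‖ ≤ c := le_of_sq_le_sq (hz2.trans (h n)) hc
  calc ‖⟪a, z⟫_ℂ‖ ≤ ‖a‖ * ‖z‖ := norm_inner_le_norm a z
    _ ≤ c * ‖a‖ := by nlinarith [norm_nonneg a]

/-- `‖√G x‖² = ∑ⱼ ‖Dʲ⁺¹ x‖²`, where `D ^ 2 = 1 - (1 + G)⁻¹`. -/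
theorem sqNormOp_sqrt_eq_tsum (G : PosOp H) (x : H) :
    sqNormOp G.sqrt.op x = ∑' j : ℕ, ‖(G.root ^ (j + 1)) x‖ₑ ^ 2 := by
  have hfin : ∀ n, ∑ j ∈ Finset.range n, ‖(G.root ^ (j + 1)) x‖ₑ ^ 2 =
      ENNReal.ofReal (∑ j ∈ Finset.range n, ‖(G.root ^ (j + 1)) x‖ ^ 2) := fun n => by
    rw [ENNReal.ofReal_sum_of_nonneg fun _ _ => by positivity]
    simp_rw [ofReal_norm_sq_eq_enorm_sq]
  refine le_antisymm ?_ ?_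
  · by_cases htop : ∑' j : ℕ, ‖(G.root ^ (j + 1)) x‖ₑ ^ 2 = ⊤
    · rw [htop]; exact le_top
    set t := ∑' j : ℕ, ‖(G.root ^ (j + 1)) x‖ₑ ^ 2
    obtain ⟨y, hy, hyc⟩ := G.exists_mem_graph_of_sum_root_le (x := x) (c := √t.toReal)
      (Real.sqrt_nonneg _) fun n => by
        rw [Real.sq_sqrt ENNReal.toReal_nonneg, ← ENNReal.ofReal_le_iff_le_toReal htop, ← hfin]
        exact ENNReal.sum_le_tsum _
    rw [sqNormOp_of_mem_graph hy, ← ofReal_norm_sq_eq_enorm_sq, ENNReal.ofReal_le_iff_le_toReal htop]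
    have := pow_le_pow_left₀ (norm_nonneg _) hyc 2
    rwa [Real.sq_sqrt ENNReal.toReal_nonneg] at this
  · by_cases hx : x ∈ G.sqrt.op.domain
    · rw [sqNormOp_of_mem hx, ENNReal.tsum_eq_iSup_nat]
      refine iSup_le fun n => ?_
      rw [hfin, ← ofReal_norm_sq_eq_enorm_sq]
      exact ENNReal.ofReal_le_ofReal (G.sum_root_le (G.sqrt.op.mem_graph ⟨x, hx⟩) n)
    · rw [sqNormOp, dif_neg hx]; exact le_top

/-- `D ^ (2 * n)` applied to a vector of `D(√G)`. -/
theorem root_pow_mem (G : PosOp H) {x : H} (hx : x ∈ G.sqrt.op.domain) (n : ℕ) :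
    (G.root ^ (2 * n)) x ∈ G.sqrt.op.domain := by
  obtain ⟨z, hz, -⟩ := G.exists_sqrt_cutoff n x
  have := G.sqrt.op.domain.sub_mem hx (LinearPMap.mem_domain_of_mem_graph hz)
  simpa using this

/-- D^{2n} shifts the series by 2n places, leaving a tail: this is why the energy of D^{2n} x never
exceeds that of x and tends to 0. -/
theorem sqNormOp_sqrt_root_pow (G : PosOp H) (x : H) (n : ℕ) :
    sqNormOp G.sqrt.op ((G.root ^ (2 * n)) x) = ∑' j : ℕ, ‖(G.root ^ (j + 2 * n + 1)) x‖ₑ ^ 2 := by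
  rw [sqNormOp_sqrt_eq_tsum]
  refine tsum_congr fun j => ?_
  rw [show j + 2 * n + 1 = (j + 1) + 2 * n by ring, pow_add _ (j + 1)]
  rfl

theorem sqNormOp_sqrt_root_pow_le (G : PosOp H) (x : H) (n : ℕ) :
    sqNormOp G.sqrt.op ((G.root ^ (2 * n)) x) ≤ sqNormOp G.sqrt.op x := by
  rw [sqNormOp_sqrt_root_pow, sqNormOp_sqrt_eq_tsum]
  exact ENNReal.tsum_comp_le_tsum_of_injective (add_left_injective (2 * n))
    fun j => ‖(G.root ^ (j + 1)) x‖ₑ ^ 2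

theorem tendsto_sqNormOp_sqrt_root_pow (G : PosOp H) {x : H} (hx : x ∈ G.sqrt.op.domain) :
    Filter.Tendsto (fun n => sqNormOp G.sqrt.op ((G.root ^ (2 * n)) x)) Filter.atTop (𝓝 0) := by
  simp_rw [sqNormOp_sqrt_root_pow]
  have hne : ∑' j : ℕ, ‖(G.root ^ (j + 1)) x‖ₑ ^ 2 ≠ ⊤ := by
    rw [← sqNormOp_sqrt_eq_tsum, sqNormOp_of_mem hx]
    simp
  exact (ENNReal.tendsto_sum_nat_add _ hne).comp
    (Filter.tendsto_id.const_mul_atTop' (zero_lt_two (α := ℕ)))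

theorem tendsto_root_pow (G : PosOp H) {x : H} (hx : x ∈ G.sqrt.op.domain) :
    Filter.Tendsto (fun n => (G.root ^ (2 * n)) x) Filter.atTop (𝓝 0) := by
  have hsm : Summable fun j => ‖(G.root ^ (j + 1)) x‖ ^ 2 :=
    summable_of_sum_range_le (fun _ => by positivity)
      (G.sum_root_le (G.sqrt.op.mem_graph ⟨x, hx⟩))
  have h0 : Filter.Tendsto (fun n => ‖(G.root ^ n) x‖ ^ 2) Filter.atTop (𝓝 0) :=
    (Filter.tendsto_add_atTop_iff_nat 1).1 hsm.tendsto_atTop_zero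
  have h1 : Filter.Tendsto (fun n => (G.root ^ n) x) Filter.atTop (𝓝 0) := by
    rw [tendsto_zero_iff_norm_tendsto_zero]
    simpa using h0.sqrt
  exact h1.comp (Filter.tendsto_id.const_mul_atTop' (zero_lt_two (α := ℕ)))

/-- The bounded operator `A (1 - D ^ (2 * n))`. -/
theorem exists_cutoff (G : PosOp H) (A : G.BG) (n : ℕ) : ∃ B : H →L[ℂ] H,
    ∀ (x : H) (h : x - (G.root ^ (2 * n)) x ∈ G.sqrt.op.domain), B x = A.1 ⟨_, h⟩ := by
  have hmem : ∀ x, x - (G.root ^ (2 * n)) x ∈ G.sqrt.op.domain := fun x => by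
    obtain ⟨z, hz, -⟩ := G.exists_sqrt_cutoff n x
    exact LinearPMap.mem_domain_of_mem_graph hz
  obtain ⟨a, b, ha, hb, hA⟩ := A.2
  let Q : H →ₗ[ℂ] G.sqrt.op.domain :=
    ((1 - G.root ^ (2 * n) : H →L[ℂ] H) : H →ₗ[ℂ] H).codRestrict _ hmem
  -- The 2 bounds 1 - D^{2n}; the image under √G has squared norm at most n‖x‖², and n + 1 dominates
  -- √n.
  refine ⟨(A.1.comp Q).mkContinuous (2 * a + b * (n + 1)) fun x => ?_, fun x h => rfl⟩
  obtain ⟨z, hz, hz2, -⟩ := G.exists_sqrt_cutoff n x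
  have h1 := hA (Q x)
  have h2 : G.sqrt.op (Q x) = z := ((LinearPMap.image_iff (hmem x)).2 hz).symm
  have h3 : ‖(Q x : H)‖ ≤ 2 * ‖x‖ := by
    refine (norm_sub_le x ((G.root ^ (2 * n)) x)).trans ?_
    linarith [G.norm_root_pow_apply_le (2 * n) x]
  have h4 : ‖z‖ ^ 2 ≤ n * ‖x‖ ^ 2 := by
    refine hz2.trans ((Finset.sum_le_sum (g := fun _ => ‖x‖ ^ 2) fun j _ => ?_).trans ?_)
    · exact pow_le_pow_left₀ (norm_nonneg _) (G.norm_root_pow_apply_le _ x) 2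
    · simp
  rw [h2] at h1
  refine le_of_sq_le_sq (h1.trans ?_) (by positivity)
  have h5 : ‖(Q x : H)‖ ^ 2 ≤ 4 * ‖x‖ ^ 2 := by nlinarith [norm_nonneg (Q x : H)]
  have hn : (0 : ℝ) ≤ n := Nat.cast_nonneg n
  calc a ^ 2 * ‖(Q x : H)‖ ^ 2 + b ^ 2 * ‖z‖ ^ 2
      ≤ a ^ 2 * (4 * ‖x‖ ^ 2) + b ^ 2 * (n * ‖x‖ ^ 2) := by gcongr
    _ ≤ (4 * a ^ 2 + b ^ 2 * (n + 1) ^ 2 + 4 * a * (b * (n + 1))) * ‖x‖ ^ 2 := by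
      have : b ^ 2 * n ≤ b ^ 2 * (n + 1) ^ 2 := by
        refine mul_le_mul_of_nonneg_left ?_ (by positivity)
        nlinarith
      have h6 : 0 ≤ 4 * a * (b * (n + 1)) := by positivity
      nlinarith [sq_nonneg ‖x‖]
    _ = ((2 * a + b * (n + 1)) * ‖x‖) ^ 2 := by ring

/-- The bounded operator `A (1 - D ^ (2 * n))`. -/
def cutoff (G : PosOp H) (A : G.BG) (n : ℕ) : H →L[ℂ] H := (G.exists_cutoff A n).choose

/-- On `D(√G)` the cutoff of `A` differs from `A` by `A D ^ (2 * n)`. -/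
theorem sub_cutoff_apply (G : PosOp H) (A : G.BG) (n : ℕ) (x : G.sqrt.op.domain) :
    A.1 x - G.cutoff A n x = A.1 ⟨(G.root ^ (2 * n)) x, G.root_pow_mem x.2 n⟩ := by
  have h : (x : H) - (G.root ^ (2 * n)) x ∈ G.sqrt.op.domain :=
    G.sqrt.op.domain.sub_mem x.2 (G.root_pow_mem x.2 n)
  rw [cutoff, (G.exists_cutoff A n).choose_spec x h, ← map_sub]
  congr 1
  ext
  simp

/-- For a bound `‖A x‖² ≤ a² ‖x‖² + b² ‖√G x‖²`, the error of the cutoff is dominated. -/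
theorem norm_sub_cutoff_sq_le (G : PosOp H) (A : G.BG) {a b : ℝ}
    (h : RelBoundWith G.sqrt.op A.1 a b) (n : ℕ) (x : G.sqrt.op.domain) :
    ‖A.1 x - G.cutoff A n x‖ ^ 2 ≤ a ^ 2 * ‖(x : H)‖ ^ 2 + b ^ 2 * ‖G.sqrt.op x‖ ^ 2 := by
  rw [sub_cutoff_apply]
  refine (h _).trans ?_
  have h1 := G.norm_root_pow_apply_le (2 * n) x
  have h2 := G.sqNormOp_sqrt_root_pow_le x n
  rw [sqNormOp_of_mem (G.root_pow_mem x.2 n), sqNormOp_of_mem x.2,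
    ← ofReal_norm_sq_eq_enorm_sq, ← ofReal_norm_sq_eq_enorm_sq,
    ENNReal.ofReal_le_ofReal_iff (by positivity)] at h2
  have h3 := pow_le_pow_left₀ (norm_nonneg _) h1 2
  exact add_le_add (mul_le_mul_of_nonneg_left h3 (sq_nonneg a))
    (mul_le_mul_of_nonneg_left h2 (sq_nonneg b))

/-- The error is A D^{2n} x, and in its relative bound both ‖D^{2n} x‖ and ‖√G D^{2n} x‖ tend to 0.
-/
theorem tendsto_cutoff (G : PosOp H) (A : G.BG) (x : G.sqrt.op.domain) :
    Filter.Tendsto (fun n => G.cutoff A n x) Filter.atTop (𝓝 (A.1 x)) := by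
  obtain ⟨a, b, ha, hb, hA⟩ := A.2
  rw [tendsto_iff_norm_sub_tendsto_zero]
  have h1 := (G.tendsto_root_pow x.2).norm.pow 2
  have h2 := (ENNReal.tendsto_toReal ENNReal.zero_ne_top).comp
    (G.tendsto_sqNormOp_sqrt_root_pow x.2)
  have h3 := ((h1.const_mul (a ^ 2)).add (h2.const_mul (b ^ 2))).sqrt
  simp only [norm_zero, ENNReal.toReal_zero, ne_eq, OfNat.ofNat_ne_zero, not_false_eq_true,
    zero_pow, mul_zero, add_zero, Real.sqrt_zero] at h3
  refine squeeze_zero (fun _ => norm_nonneg _) (fun n => ?_) h3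
  rw [norm_sub_rev, sub_cutoff_apply]
  refine Real.le_sqrt_of_sq_le ((hA _).trans_eq ?_)
  rw [Function.comp, sqNormOp_of_mem (G.root_pow_mem x.2 n), ← ofReal_norm_sq_eq_enorm_sq,
    ENNReal.toReal_ofReal (by positivity)]

end PosOp

end Cutoff

/-! ## Decompositions of positive trace-class operators into vectors -/

section Families

variable {H : Type*} [NormedAddCommGroup H] [InnerProductSpace ℂ H]

theorem re_inner_self_eq_norm_sq (x : H) : (⟪x, x⟫_ℂ).re = ‖x‖ ^ 2 := by
  simpa using inner_self_eq_norm_sq (𝕜 := ℂ) x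

theorem enorm_inner_symm (x y : H) : ‖⟪x, y⟫_ℂ‖ₑ = ‖⟪y, x⟫_ℂ‖ₑ := by
  rw [← ofReal_norm, ← ofReal_norm, norm_inner_symm]

/-- Parseval's identity. -/
theorem HilbertBasis.enorm_sq_eq_tsum {κ : Type*} (b : HilbertBasis κ ℂ H) (x : H) :
    ‖x‖ₑ ^ 2 = ∑' k, ‖⟪b k, x⟫_ℂ‖ₑ ^ 2 := by
  have h := b.hasSum_inner_mul_inner x x
  have h1 : ∀ k, ⟪x, b k⟫_ℂ * ⟪b k, x⟫_ℂ = ((‖⟪b k, x⟫_ℂ‖ ^ 2 : ℝ) : ℂ) := fun k => by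
    rw [← inner_conj_symm x (b k), mul_comm, Complex.mul_conj, Complex.normSq_eq_norm_sq]
  simp_rw [h1] at h
  have h2 : ⟪x, x⟫_ℂ = ((‖x‖ ^ 2 : ℝ) : ℂ) := by
    rw [inner_self_eq_norm_sq_to_K]; simp
  rw [h2, Complex.hasSum_ofReal] at h
  simp_rw [← ofReal_norm_sq_eq_enorm_sq]
  rw [← h.tsum_eq, ENNReal.ofReal_tsum_of_nonneg (fun _ => by positivity) h.summable]

theorem summable_norm_sq_of_tsum_enorm_ne_top {ι : Type*} {F : Type*} [NormedAddCommGroup F]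
    {ψ : ι → F} (h : ∑' i, ‖ψ i‖ₑ ^ 2 ≠ ⊤) : Summable fun i => ‖ψ i‖ ^ 2 := by
  simpa using ENNReal.summable_toReal h

theorem ofReal_tsum_norm_sq {ι : Type*} {F : Type*} [NormedAddCommGroup F]
    {ψ : ι → F} (h : Summable fun i => ‖ψ i‖ ^ 2) :
    ENNReal.ofReal (∑' i, ‖ψ i‖ ^ 2) = ∑' i, ‖ψ i‖ₑ ^ 2 := by
  rw [ENNReal.ofReal_tsum_of_nonneg (fun _ => by positivity) h]
  simp_rw [ofReal_norm_sq_eq_enorm_sq]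

theorem norm_coe_sqrt_sq (t : ℝ≥0) : ‖((NNReal.sqrt t : ℝ) : ℂ)‖ₑ ^ 2 = t := by
  rw [← ofReal_norm_sq_eq_enorm_sq, Complex.norm_real, Real.norm_of_nonneg (NNReal.coe_nonneg _),
    ← NNReal.coe_pow, NNReal.sq_sqrt, ENNReal.ofReal_coe_nnreal]

theorem sqNormOp_sqrt_smul (A : H →ₗ.[ℂ] H) {t : ℝ≥0} (ht : t ≠ 0) (x : H) :
    sqNormOp A (((NNReal.sqrt t : ℝ) : ℂ) • x) = t * sqNormOp A x := by
  rw [sqNormOp_smul, norm_coe_sqrt_sq]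
  simpa using ht

theorem enorm_sqrt_smul (t : ℝ≥0) (x : H) :
    ‖((NNReal.sqrt t : ℝ) : ℂ) • x‖ₑ ^ 2 = t * ‖x‖ₑ ^ 2 := by
  rw [enorm_smul, mul_pow, norm_coe_sqrt_sq]

theorem hasSum_inner_rankOne {ι : Type*} {ψ : ι → H} {σ : H →L[ℂ] H}
    (h : HasSum (fun i => InnerProductSpace.rankOne ℂ (ψ i) (ψ i)) σ) (x y : H) :
    HasSum (fun i => ⟪x, ψ i⟫_ℂ * ⟪ψ i, y⟫_ℂ) ⟪x, σ y⟫_ℂ := by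
  have h1 := h.mapL ((innerSL ℂ x).comp (ContinuousLinearMap.apply ℂ H y))
  simpa [inner_smul_right, mul_comm] using h1

theorem hasSum_norm_inner_rankOne {ι : Type*} {ψ : ι → H} {σ : H →L[ℂ] H}
    (h : HasSum (fun i => InnerProductSpace.rankOne ℂ (ψ i) (ψ i)) σ) (x : H) :
    HasSum (fun i => ((‖⟪ψ i, x⟫_ℂ‖ ^ 2 : ℝ) : ℂ)) ⟪x, σ x⟫_ℂ := by
  have := hasSum_inner_rankOne h x x
  refine this.congr_fun fun i => ?_
  rw [← inner_conj_symm x (ψ i), mul_comm, Complex.mul_conj, Complex.normSq_eq_norm_sq]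

/-- The two families of vectors define the same quadratic form `∑ᵢ |⟪ψᵢ, h⟫|²`. -/
def SameForm {ι κ : Type*} (ψ : ι → H) (φ : κ → H) : Prop :=
  ∀ h, ∑' i, ‖⟪ψ i, h⟫_ℂ‖ₑ ^ 2 = ∑' k, ‖⟪φ k, h⟫_ℂ‖ₑ ^ 2

/-- `σ = ∑ᵢ |ψᵢ⟩⟨ψᵢ|` in the sense of quadratic forms. -/
def Decomposes {ι : Type*} (ψ : ι → H) (σ : H →L[ℂ] H) : Prop :=
  ∀ h, ∑' i, ‖⟪ψ i, h⟫_ℂ‖ₑ ^ 2 = ENNReal.ofReal (⟪h, σ h⟫_ℂ).re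

theorem Decomposes.sameForm {ι κ : Type*} {ψ : ι → H} {φ : κ → H} {σ : H →L[ℂ] H}
    (h : Decomposes ψ σ) (h' : Decomposes φ σ) : SameForm ψ φ := fun x => by rw [h, h']

variable [CompleteSpace H]

/-- After Parseval for each T ψ_i and an exchange of sums, the n-th term is the common form
evaluated at T* e_n. -/
theorem SameForm.tsum_enorm_sq {ι κ : Type*} {ψ : ι → H} {φ : κ → H} (h : SameForm ψ φ)
    (T : H →L[ℂ] H) : ∑' i, ‖T (ψ i)‖ₑ ^ 2 = ∑' k, ‖T (φ k)‖ₑ ^ 2 := by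
  simp_rw [(onb H).enorm_sq_eq_tsum (T _)]
  rw [ENNReal.tsum_comm, ENNReal.tsum_comm (α := κ)]
  refine tsum_congr fun n => ?_
  simp_rw [← ContinuousLinearMap.adjoint_inner_left, enorm_inner_symm _ (ψ _),
    enorm_inner_symm _ (φ _)]
  exact h _

theorem SameForm.tsum_enorm_sq_self {ι κ : Type*} {ψ : ι → H} {φ : κ → H} (h : SameForm ψ φ) :
    ∑' i, ‖ψ i‖ₑ ^ 2 = ∑' k, ‖φ k‖ₑ ^ 2 := h.tsum_enorm_sq (ContinuousLinearMap.id ℂ H)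

/-- The series for ‖√G x‖² reduces this to bounded operators, with the value +∞ outside the domain
included. It makes Tr Gρ independent of the decomposition. -/
theorem SameForm.tsum_sqNormOp_sqrt {ι κ : Type*} {ψ : ι → H} {φ : κ → H} (h : SameForm ψ φ)
    (G : PosOp H) : ∑' i, sqNormOp G.sqrt.op (ψ i) = ∑' k, sqNormOp G.sqrt.op (φ k) := by
  simp_rw [G.sqNormOp_sqrt_eq_tsum]
  rw [ENNReal.tsum_comm, ENNReal.tsum_comm (α := κ)]
  exact tsum_congr fun n => h.tsum_enorm_sq _

/-- A `√G`-bounded operator as a partially defined one. -/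
abbrev PosOp.toPMap (G : PosOp H) (A : G.BG) : H →ₗ.[ℂ] H := ⟨G.sqrt.op.domain, A.1⟩

theorem summable_norm_sqrt_sq {ι : Type*} {ψ : ι → H} (G : PosOp H)
    (hS : ∑' i, sqNormOp G.sqrt.op (ψ i) ≠ ⊤) (hmem : ∀ i, ψ i ∈ G.sqrt.op.domain) :
    Summable fun i => ‖G.sqrt.op ⟨ψ i, hmem i⟩‖ ^ 2 := by
  simp_rw [fun i => sqNormOp_of_mem (hmem i)] at hS
  exact summable_norm_sq_of_tsum_enorm_ne_top hS

theorem mem_sqrt_domain_of_tsum_ne_top {ι : Type*} {ψ : ι → H} {G : PosOp H}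
    (hS : ∑' i, sqNormOp G.sqrt.op (ψ i) ≠ ⊤) (i : ι) : ψ i ∈ G.sqrt.op.domain :=
  mem_domain_of_sqNormOp_ne_top (ENNReal.ne_top_of_tsum_ne_top hS i)

theorem tendsto_tsum_cutoff {ι : Type*} {ψ : ι → H} (G : PosOp H) (A : G.BG)
    (h1 : ∑' i, ‖ψ i‖ₑ ^ 2 ≠ ⊤) (hS : ∑' i, sqNormOp G.sqrt.op (ψ i) ≠ ⊤) :
    Filter.Tendsto (fun n => ∑' i, ‖G.cutoff A n (ψ i)‖ₑ ^ 2) Filter.atTop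
      (𝓝 (∑' i, sqNormOp (G.toPMap A) (ψ i))) := by
  have hmem := mem_sqrt_domain_of_tsum_ne_top hS
  obtain ⟨a, b, ha, hb, hA⟩ := A.2
  have hsum := ((summable_norm_sq_of_tsum_enorm_ne_top h1).mul_left (a ^ 2)).add
    ((summable_norm_sqrt_sq G hS hmem).mul_left (b ^ 2))
  -- Both A ψ and A ψ minus its cutoff obey the same relative bound; the factor 4 comes from (u +
  -- v)² ≤ 2u² + 2v².
  have hbd : ∀ n i, ‖G.cutoff A n (ψ i)‖ ^ 2 ≤
      4 * (a ^ 2 * ‖ψ i‖ ^ 2 + b ^ 2 * ‖G.sqrt.op ⟨ψ i, hmem i⟩‖ ^ 2) := fun n i => by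
    have e1 := G.norm_sub_cutoff_sq_le A hA n ⟨ψ i, hmem i⟩
    have e2 := hA ⟨ψ i, hmem i⟩
    have e3 := norm_sub_le (A.1 ⟨ψ i, hmem i⟩) (A.1 ⟨ψ i, hmem i⟩ - G.cutoff A n (ψ i))
    rw [sub_sub_cancel] at e3
    nlinarith [norm_nonneg (G.cutoff A n (ψ i)),
      sq_nonneg (‖A.1 ⟨ψ i, hmem i⟩‖ - ‖A.1 ⟨ψ i, hmem i⟩ - G.cutoff A n (ψ i)‖)]
  have hbd' : ∀ i, ‖A.1 ⟨ψ i, hmem i⟩‖ ^ 2 ≤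
      4 * (a ^ 2 * ‖ψ i‖ ^ 2 + b ^ 2 * ‖G.sqrt.op ⟨ψ i, hmem i⟩‖ ^ 2) := fun i =>
    (hA ⟨ψ i, hmem i⟩).trans (le_mul_of_one_le_left (by positivity) (by norm_num))
  have hT := tendsto_tsum_of_dominated_convergence (𝓕 := Filter.atTop)
    (f := fun n i => ‖G.cutoff A n (ψ i)‖ ^ 2) (g := fun i => ‖A.1 ⟨ψ i, hmem i⟩‖ ^ 2)
    (hsum.mul_left 4) (fun i => ((G.tendsto_cutoff A ⟨ψ i, hmem i⟩).norm.pow 2))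
    (Filter.Eventually.of_forall fun n i => by
      rw [Real.norm_of_nonneg (by positivity)]; exact hbd n i)
  have e : ∀ n, ∑' i, ‖G.cutoff A n (ψ i)‖ₑ ^ 2 =
      ENNReal.ofReal (∑' i, ‖G.cutoff A n (ψ i)‖ ^ 2) := fun n =>
    (ofReal_tsum_norm_sq (Summable.of_nonneg_of_le (fun _ => by positivity) (hbd n)
      (hsum.mul_left 4))).symm
  have e' : ∑' i, sqNormOp (G.toPMap A) (ψ i) =
      ENNReal.ofReal (∑' i, ‖A.1 ⟨ψ i, hmem i⟩‖ ^ 2) := by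
    rw [ofReal_tsum_norm_sq (Summable.of_nonneg_of_le (fun _ => by positivity) hbd'
      (hsum.mul_left 4))]
    exact tsum_congr fun i => sqNormOp_of_mem (A := G.toPMap A) (hmem i)
  simp_rw [e, e']
  exact ENNReal.tendsto_ofReal hT

/-- A need not be closable, so no series of bounded forms is at hand. The sums agree for every
cutoff, and finite trace and energy allow the passage to the limit. -/
theorem SameForm.tsum_sqNormOp {ι κ : Type*} {ψ : ι → H} {φ : κ → H} (h : SameForm ψ φ)
    (G : PosOp H) (A : G.BG) (h1 : ∑' i, ‖ψ i‖ₑ ^ 2 ≠ ⊤)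
    (hS : ∑' i, sqNormOp G.sqrt.op (ψ i) ≠ ⊤) :
    ∑' i, sqNormOp (G.toPMap A) (ψ i) = ∑' k, sqNormOp (G.toPMap A) (φ k) := by
  refine tendsto_nhds_unique (tendsto_tsum_cutoff G A h1 hS) ?_
  simp_rw [h.tsum_enorm_sq]
  rw [h.tsum_enorm_sq_self] at h1
  rw [h.tsum_sqNormOp_sqrt] at hS
  exact tendsto_tsum_cutoff G A h1 hS

theorem Decomposes.posTrace_eq {ι : Type*} {ψ : ι → H} {σ : H →L[ℂ] H} (h : Decomposes ψ σ) :
    posTrace σ = ∑' i, ‖ψ i‖ₑ ^ 2 := by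
  simp_rw [(onb H).enorm_sq_eq_tsum, enorm_inner_symm _ (ψ _)]
  rw [ENNReal.tsum_comm, posTrace]
  exact tsum_congr fun n => (h _).symm

theorem decomposes_sqrt {σ : H →L[ℂ] H} (hσ : σ.IsPositive) :
    Decomposes (fun i => CFC.sqrt σ (onb H i)) σ := by
  intro h
  have hσ0 : 0 ≤ σ := (ContinuousLinearMap.nonneg_iff_isPositive σ).2 hσ
  have hs := (ContinuousLinearMap.nonneg_iff_isPositive _).1 (CFC.sqrt_nonneg σ)
  have h1 : ∀ x y, ⟪CFC.sqrt σ x, y⟫_ℂ = ⟪x, CFC.sqrt σ y⟫_ℂ := hs.isSymmetric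
  have h2 : σ h = CFC.sqrt σ (CFC.sqrt σ h) :=
    congrArg (fun T : H →L[ℂ] H => T h) (CFC.sqrt_mul_sqrt_self σ hσ0).symm
  simp_rw [h1]
  rw [← (onb H).enorm_sq_eq_tsum, h2, ← h1, re_inner_self_eq_norm_sq, ofReal_norm_sq_eq_enorm_sq]

theorem Decomposes.energy_eq {ι : Type*} {ψ : ι → H} {σ : H →L[ℂ] H} (h : Decomposes ψ σ)
    (hσ : σ.IsPositive) (G : PosOp H) : G.energy σ = ∑' i, sqNormOp G.sqrt.op (ψ i) :=
  ((decomposes_sqrt hσ).sameForm h).tsum_sqNormOp_sqrt G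

theorem Decomposes.trConj_eq {ι : Type*} {ψ : ι → H} {σ : H →L[ℂ] H} (h : Decomposes ψ σ)
    (hσ : σ.IsPositive) (G : PosOp H) (A : G.BG) (h1 : ∑' i, ‖ψ i‖ₑ ^ 2 ≠ ⊤)
    (hS : ∑' i, sqNormOp G.sqrt.op (ψ i) ≠ ⊤) :
    trConj (G.toPMap A) σ = ∑' i, sqNormOp (G.toPMap A) (ψ i) :=
  ((h.sameForm (decomposes_sqrt hσ)).tsum_sqNormOp G A h1 hS).symm

theorem decomposes_of_hasSum {ι : Type*} {ψ : ι → H} {σ : H →L[ℂ] H}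
    (h : HasSum (fun i => InnerProductSpace.rankOne ℂ (ψ i) (ψ i)) σ) : Decomposes ψ σ := by
  intro x
  have h1 := hasSum_norm_inner_rankOne h x
  have h2 := Complex.hasSum_re h1
  simp only [Complex.ofReal_re] at h2
  rw [← h2.tsum_eq, ENNReal.ofReal_tsum_of_nonneg (fun _ => by positivity) h2.summable]
  simp_rw [ofReal_norm_sq_eq_enorm_sq]

theorem isPositive_of_hasSum {ι : Type*} {ψ : ι → H} {σ : H →L[ℂ] H}
    (h : HasSum (fun i => InnerProductSpace.rankOne ℂ (ψ i) (ψ i)) σ) : σ.IsPositive := by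
  rw [ContinuousLinearMap.isPositive_iff_complex]
  intro x
  have h1 := hasSum_norm_inner_rankOne h x
  have h2 := Complex.hasSum_re h1
  have h3 : ((⟪x, σ x⟫_ℂ).re : ℂ) = ⟪x, σ x⟫_ℂ := by
    refine HasSum.unique ?_ h1
    exact Complex.hasSum_ofReal.2 h2
  have h4 : ⟪σ x, x⟫_ℂ = ⟪x, σ x⟫_ℂ := by
    rw [← inner_conj_symm, ← h3, Complex.conj_ofReal]
  rw [h4]
  exact ⟨h3, h2.nonneg fun i => by simp only [Complex.ofReal_re]; positivity⟩

theorem summable_rankOne {ι : Type*} {ψ : ι → H} (h : ∑' i, ‖ψ i‖ₑ ^ 2 ≠ ⊤) :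
    Summable fun i => InnerProductSpace.rankOne ℂ (ψ i) (ψ i) := by
  refine Summable.of_norm_bounded (summable_norm_sq_of_tsum_enorm_ne_top h) fun i => ?_
  rw [InnerProductSpace.norm_rankOne, sq]

theorem exists_decomposes {ι : Type*} {ψ : ι → H} (h : ∑' i, ‖ψ i‖ₑ ^ 2 ≠ ⊤) :
    ∃ σ : H →L[ℂ] H, σ.IsPositive ∧ Decomposes ψ σ :=
  ⟨_, isPositive_of_hasSum (summable_rankOne h).hasSum,
    decomposes_of_hasSum (summable_rankOne h).hasSum⟩

/-- Finite trace makes the rank-one series absolutely convergent in operator norm; its sum has the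
same quadratic form as σ, and polarization identifies the two. -/
theorem Decomposes.hasSum_rankOne {ι : Type*} {ψ : ι → H} {σ : H →L[ℂ] H} (h : Decomposes ψ σ)
    (hσ : σ.IsPositive) (h1 : ∑' i, ‖ψ i‖ₑ ^ 2 ≠ ⊤) :
    HasSum (fun i => InnerProductSpace.rankOne ℂ (ψ i) (ψ i)) σ := by
  have hs := (summable_rankOne h1).hasSum
  set τ := ∑' i, InnerProductSpace.rankOne ℂ (ψ i) (ψ i)
  have hτ := isPositive_of_hasSum hs
  suffices τ = σ by rwa [this] at hs
  have key : (τ : H →ₗ[ℂ] H) = (σ : H →ₗ[ℂ] H) := by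
    rw [← ext_inner_map]
    intro x
    have e1 := decomposes_of_hasSum hs x
    rw [h x] at e1
    obtain ⟨a1, a2 : 0 ≤ (⟪τ x, x⟫_ℂ).re⟩ :=
      (ContinuousLinearMap.isPositive_iff_complex τ).1 hτ x
    obtain ⟨b1, b2 : 0 ≤ (⟪σ x, x⟫_ℂ).re⟩ :=
      (ContinuousLinearMap.isPositive_iff_complex σ).1 hσ x
    have c1 : (⟪x, σ x⟫_ℂ).re = (⟪σ x, x⟫_ℂ).re := inner_re_symm (𝕜 := ℂ) _ _
    have c2 : (⟪x, τ x⟫_ℂ).re = (⟪τ x, x⟫_ℂ).re := inner_re_symm (𝕜 := ℂ) _ _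
    rw [c1, c2, ENNReal.ofReal_eq_ofReal_iff b2 a2] at e1
    change ⟪τ x, x⟫_ℂ = ⟪σ x, x⟫_ℂ
    rw [← a1, ← b1]
    exact congrArg _ e1.symm
  ext x
  exact LinearMap.congr_fun key x

end Families

/-! ## Traces of products -/

section Traces

variable {H : Type*} [NormedAddCommGroup H] [InnerProductSpace ℂ H] [CompleteSpace H]

/-- The double series converges absolutely: |uv| ≤ |u|² + |v|², and both squares are summable by
Parseval. -/
theorem tsum_tsum_inner_mul_inner {ι κ : Type*} (b : HilbertBasis κ ℂ H) {ψ χ : ι → H}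
    (hψ : ∑' i, ‖ψ i‖ₑ ^ 2 ≠ ⊤) (hχ : ∑' i, ‖χ i‖ₑ ^ 2 ≠ ⊤) :
    ∑' n, ∑' i, ⟪b n, χ i⟫_ℂ * ⟪ψ i, b n⟫_ℂ = ∑' i, ⟪ψ i, χ i⟫_ℂ := by
  have hs : ∀ {φ : ι → H}, ∑' i, ‖φ i‖ₑ ^ 2 ≠ ⊤ →
      Summable fun p : κ × ι => ‖⟪b p.1, φ p.2⟫_ℂ‖ ^ 2 := fun {φ} hφ => by
    refine summable_norm_sq_of_tsum_enorm_ne_top ?_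
    rw [ENNReal.tsum_prod (f := fun n i => ‖⟪b n, φ i⟫_ℂ‖ₑ ^ 2), ENNReal.tsum_comm]
    simp_rw [← b.enorm_sq_eq_tsum]
    exact hφ
  have hsum : Summable (Function.uncurry fun n i => ⟪b n, χ i⟫_ℂ * ⟪ψ i, b n⟫_ℂ) := by
    refine Summable.of_norm_bounded ((hs hχ).add (hs hψ)) fun p => ?_
    simp only [Function.uncurry, norm_mul]
    rw [norm_inner_symm (ψ p.2)]
    nlinarith [sq_nonneg (‖⟪b p.1, χ p.2⟫_ℂ‖ - ‖⟪b p.1, ψ p.2⟫_ℂ‖),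
      sq_nonneg ‖⟪b p.1, χ p.2⟫_ℂ‖, sq_nonneg ‖⟪b p.1, ψ p.2⟫_ℂ‖]
  rw [← hsum.tsum_comm]
  refine tsum_congr fun i => ?_
  rw [← b.tsum_inner_mul_inner]
  simp_rw [mul_comm]

theorem tsum_enorm_clm_ne_top {ι : Type*} {ψ : ι → H} (hψ : ∑' i, ‖ψ i‖ₑ ^ 2 ≠ ⊤)
    {F : Type*} [NormedAddCommGroup F] [InnerProductSpace ℂ F]
    (T : H →L[ℂ] F) : ∑' i, ‖T (ψ i)‖ₑ ^ 2 ≠ ⊤ := by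
  have h : ∑' i, ‖T (ψ i)‖ₑ ^ 2 ≤ ‖T‖ₑ ^ 2 * ∑' i, ‖ψ i‖ₑ ^ 2 := by
    rw [← ENNReal.tsum_mul_left]
    refine ENNReal.tsum_le_tsum fun i => ?_
    rw [← mul_pow]
    exact pow_le_pow_left₀ zero_le (T.le_opENorm _) 2
  exact ne_top_of_le_ne_top (ENNReal.mul_ne_top (by simp) hψ) h

theorem Decomposes.opTrace_mul_left {ι : Type*} {ψ : ι → H} {σ : H →L[ℂ] H} (h : Decomposes ψ σ)
    (hσ : σ.IsPositive) (h1 : ∑' i, ‖ψ i‖ₑ ^ 2 ≠ ⊤) (T : H →L[ℂ] H) :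
    opTrace (T * σ) = ∑' i, ⟪ψ i, T (ψ i)⟫_ℂ := by
  rw [← tsum_tsum_inner_mul_inner (onb H) h1 (tsum_enorm_clm_ne_top h1 T), opTrace]
  refine tsum_congr fun n => ?_
  have h2 := (hasSum_inner_rankOne (h.hasSum_rankOne hσ h1)
    (ContinuousLinearMap.adjoint T (onb H n)) (onb H n)).tsum_eq
  simp_rw [ContinuousLinearMap.adjoint_inner_left] at h2
  exact h2.symm

theorem Decomposes.opTrace_mul_right {ι : Type*} {ψ : ι → H} {σ : H →L[ℂ] H} (h : Decomposes ψ σ)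
    (hσ : σ.IsPositive) (h1 : ∑' i, ‖ψ i‖ₑ ^ 2 ≠ ⊤) (T : H →L[ℂ] H) :
    opTrace (σ * T) = ∑' i, ⟪ψ i, T (ψ i)⟫_ℂ := by
  simp_rw [← ContinuousLinearMap.adjoint_inner_left]
  rw [← tsum_tsum_inner_mul_inner (onb H)
    (tsum_enorm_clm_ne_top h1 (ContinuousLinearMap.adjoint T)) h1, opTrace]
  refine tsum_congr fun n => ?_
  have h2 := (hasSum_inner_rankOne (h.hasSum_rankOne hσ h1) (onb H n) (T (onb H n))).tsum_eq
  simp_rw [ContinuousLinearMap.adjoint_inner_left]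
  exact h2.symm

theorem opTrace_rankOne (x y : H) : opTrace (InnerProductSpace.rankOne ℂ x y) = ⟪y, x⟫_ℂ := by
  rw [opTrace, ← (onb H).tsum_inner_mul_inner]
  refine tsum_congr fun n => ?_
  simp

/-- Rank-one operators A read off the matrix elements. This uniqueness is needed because `predual`
is defined by a choice. -/
theorem eq_of_opTrace_mul_eq {σ τ : H →L[ℂ] H} (h : ∀ A, opTrace (σ * A) = opTrace (τ * A)) :
    σ = τ := by
  ext x
  refine ext_inner_left ℂ fun y => ?_
  have := h (InnerProductSpace.rankOne ℂ x y)
  have e : ∀ T : H →L[ℂ] H, T * InnerProductSpace.rankOne ℂ x y =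
      InnerProductSpace.rankOne ℂ (T x) y := fun T => InnerProductSpace.comp_rankOne x y T
  rwa [e, e, opTrace_rankOne, opTrace_rankOne] at this

end Traces

/-! ## Energy-constrained norms in terms of families of vectors -/

namespace PosOp

variable {H : Type*} [NormedAddCommGroup H] [InnerProductSpace ℂ H] [CompleteSpace H]

/-- The energy ⟪x, G x⟫ of a unit vector is at most ‖G x‖, which can be made arbitrarily small. -/
theorem InfZero.exists_low_energy {G : PosOp H} (hG : G.InfZero) {δ : ℝ≥0∞} (hδ : 0 < δ) :
    ∃ χ : H, ‖χ‖ = 1 ∧ sqNormOp G.sqrt.op χ ≤ δ := by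
  obtain ⟨ε, hε, hεδ⟩ : ∃ ε : ℝ, 0 < ε ∧ ENNReal.ofReal ε ≤ δ := by
    obtain ⟨r, hr0, hr⟩ := ENNReal.lt_iff_exists_nnreal_btwn.1 hδ
    exact ⟨r, by simpa using hr0, by simpa using hr.le⟩
  have hlt : ∃ t ∈ {t : ℝ | ∃ x : G.op.domain, ‖(x : H)‖ = 1 ∧ t = ‖G.op x‖}, t < ε := by
    by_contra! hcon
    exact absurd (hG.2 (fun t ht => hcon t ht)) (not_le.2 hε)
  obtain ⟨t, ⟨x, hx1, rfl⟩, ht⟩ := hlt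
  obtain ⟨z, hz1, -⟩ := (G.sqrt_spec _ _).1 (G.op.mem_graph x)
  refine ⟨x, hx1, le_trans ?_ hεδ⟩
  rw [sqNormOp_of_mem_graph hz1, ← ofReal_norm_sq_eq_enorm_sq,
    ← G.re_inner_eq_norm_sqrt_sq (G.op.mem_graph x) hz1]
  refine ENNReal.ofReal_le_ofReal (le_trans (re_inner_le_norm (𝕜 := ℂ) _ _) ?_)
  rw [hx1, one_mul]
  exact ht.le

/-- A vector of prescribed norm and small energy. -/
theorem InfZero.exists_completion {G : PosOp H} (hG : G.InfZero) {c e E : ℝ≥0∞} (hc : c ≤ 1)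
    (he : e < E) : ∃ χ : H, c + ‖χ‖ₑ ^ 2 = 1 ∧ e + sqNormOp G.sqrt.op χ ≤ E := by
  obtain ⟨χ, h1, h2⟩ := hG.exists_low_energy (tsub_pos_of_lt he)
  have hχ : ‖χ‖ₑ = 1 := by rw [← ofReal_norm, h1]; simp
  obtain ⟨t, ht⟩ : ∃ t : ℝ≥0, (t : ℝ≥0∞) = 1 - c :=
    ⟨(1 - c).toNNReal, ENNReal.coe_toNNReal (ne_top_of_le_ne_top ENNReal.one_ne_top tsub_le_self)⟩
  refine ⟨((NNReal.sqrt t : ℝ) : ℂ) • χ, ?_, ?_⟩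
  · rw [enorm_sqrt_smul, hχ, ht, one_pow, mul_one, add_tsub_cancel_of_le hc]
  · have h3 : sqNormOp G.sqrt.op (((NNReal.sqrt t : ℝ) : ℂ) • χ) ≤ E - e := by
      rcases eq_or_ne t 0 with rfl | h0
      · simp [sqNormOp_zero]
      · rw [sqNormOp_sqrt_smul _ h0, ht]
        calc (1 - c) * sqNormOp G.sqrt.op χ ≤ 1 * (E - e) := by gcongr; exact tsub_le_self
          _ = E - e := one_mul _
    calc e + _ ≤ e + (E - e) := by gcongr
      _ = E := add_tsub_cancel_of_le he.le

theorem tsum_sumElim {ι : Type*} (f : H → ℝ≥0∞) (ψ : ι → H) (χ : H) :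
    ∑' s : ι ⊕ Unit, f (Sum.elim ψ (fun _ => χ) s) = ∑' i, f (ψ i) + f χ := by
  rw [Summable.tsum_sum ENNReal.summable ENNReal.summable]
  simp

/-- A subnormalized family is completed to a normalized one at an arbitrarily small energy cost. -/
theorem InfZero.exists_normalized {ι : Type*} {ψ : ι → H} {G : PosOp H} (hG : G.InfZero)
    {E : ℝ≥0∞} (h1 : ∑' i, ‖ψ i‖ₑ ^ 2 ≤ 1) (hE : ∑' i, sqNormOp G.sqrt.op (ψ i) < E) :
    ∃ χ : H, ∑' s : ι ⊕ Unit, ‖Sum.elim ψ (fun _ => χ) s‖ₑ ^ 2 = 1 ∧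
      ∑' s : ι ⊕ Unit, sqNormOp G.sqrt.op (Sum.elim ψ (fun _ => χ) s) ≤ E := by
  obtain ⟨χ, hχ1, hχ2⟩ := hG.exists_completion h1 hE
  refine ⟨χ, ?_, ?_⟩
  · rw [tsum_sumElim (fun x => ‖x‖ₑ ^ 2), hχ1]
  · rwa [tsum_sumElim (sqNormOp G.sqrt.op)]

theorem tsum_sqNormOp_le_eNorm_sq_of_eq_one {ι : Type*} {ψ : ι → H} {G : PosOp H} (A : G.BG)
    {E : ℝ≥0∞} (h1 : ∑' i, ‖ψ i‖ₑ ^ 2 = 1) (hE : ∑' i, sqNormOp G.sqrt.op (ψ i) ≤ E)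
    (hS : ∑' i, sqNormOp G.sqrt.op (ψ i) ≠ ⊤) :
    ∑' i, sqNormOp (G.toPMap A) (ψ i) ≤ G.eNorm E A ^ 2 := by
  have h1' : ∑' i, ‖ψ i‖ₑ ^ 2 ≠ ⊤ := by rw [h1]; exact ENNReal.one_ne_top
  obtain ⟨σ, hσ, hd⟩ := exists_decomposes h1'
  have hst : IsState σ := ⟨hσ, by rw [hd.posTrace_eq, h1]⟩
  have hen : G.energy σ ≤ E := by rw [hd.energy_eq hσ]; exact hE
  have hle : (trConj (G.toPMap A) σ) ^ (1 / 2 : ℝ) ≤ G.eNorm E A :=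
    le_iSup₂_of_le σ hst (le_iSup_of_le hen le_rfl)
  rw [← hd.trConj_eq hσ G A h1' hS]
  calc trConj (G.toPMap A) σ = ((trConj (G.toPMap A) σ) ^ (1 / 2 : ℝ)) ^ 2 := by
        rw [← ENNReal.rpow_natCast, ← ENNReal.rpow_mul]; norm_num
    _ ≤ _ := pow_le_pow_left₀ zero_le hle 2

/-- The energy-constrained norm also controls subnormalized families. -/
theorem InfZero.tsum_sqNormOp_le_eNorm_sq {ι : Type*} {ψ : ι → H} {G : PosOp H} (hG : G.InfZero)
    (A : G.BG) {E : ℝ≥0∞} (h1 : ∑' i, ‖ψ i‖ₑ ^ 2 ≤ 1)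
    (hE : ∑' i, sqNormOp G.sqrt.op (ψ i) ≤ E) (hS : ∑' i, sqNormOp G.sqrt.op (ψ i) ≠ ⊤) :
    ∑' i, sqNormOp (G.toPMap A) (ψ i) ≤ G.eNorm E A ^ 2 := by
  -- Without energy there is no room for a completing vector. Dividing by the trace c ≤ 1 normalizes
  -- the family instead; its energy stays 0 and the left side can only grow.
  rcases eq_or_ne (∑' i, sqNormOp G.sqrt.op (ψ i)) 0 with he | he
  · rcases eq_or_ne (∑' i, ‖ψ i‖ₑ ^ 2) 0 with hc | hc
    · have hψ : ∀ i, ψ i = 0 := fun i => by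
        have := ENNReal.tsum_eq_zero.1 hc i
        simpa using this
      simp [hψ, sqNormOp_zero]
    · have hct : ∑' i, ‖ψ i‖ₑ ^ 2 ≠ ⊤ := ne_top_of_le_ne_top ENNReal.one_ne_top h1
      obtain ⟨c, hcc⟩ : ∃ c : ℝ≥0, (c : ℝ≥0∞) = ∑' i, ‖ψ i‖ₑ ^ 2 :=
        ⟨_, ENNReal.coe_toNNReal hct⟩
      have hc0 : c ≠ 0 := by rintro rfl; exact hc (by rw [← hcc]; simp)
      have hci : c⁻¹ ≠ 0 := inv_ne_zero hc0
      have key := tsum_sqNormOp_le_eNorm_sq_of_eq_one (E := E)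
        (ψ := fun i => ((NNReal.sqrt c⁻¹ : ℝ) : ℂ) • ψ i) A
        (by simp_rw [enorm_sqrt_smul]
            rw [ENNReal.tsum_mul_left, ← hcc, ← ENNReal.coe_mul, inv_mul_cancel₀ hc0]; simp)
        (by simp_rw [sqNormOp_sqrt_smul _ hci]; rw [ENNReal.tsum_mul_left, he]; simp)
        (by simp_rw [sqNormOp_sqrt_smul _ hci]; rw [ENNReal.tsum_mul_left, he]; simp)
      simp_rw [sqNormOp_sqrt_smul _ hci] at key
      rw [ENNReal.tsum_mul_left] at key
      refine le_trans ?_ key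
      refine le_mul_of_one_le_left' ?_
      rw [← hcc] at h1
      have hc1 : c ≤ 1 := by exact_mod_cast h1
      have : 1 ≤ c⁻¹ := (one_le_inv₀ (pos_iff_ne_zero.2 hc0)).2 hc1
      exact_mod_cast this
  -- With positive energy e, scaling by t < 1 frees the amount (1 - t)e for a completing vector;
  -- then t tends to 1.
  · refine ENNReal.le_of_forall_lt_one_mul_le fun t ht => ?_
    lift t to ℝ≥0 using ne_top_of_lt ht
    rcases eq_or_ne t 0 with rfl | ht0
    · simp
    set e := ∑' i, sqNormOp G.sqrt.op (ψ i)
    have hte : (t : ℝ≥0∞) * e < e := by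
      calc (t : ℝ≥0∞) * e < 1 * e := by gcongr
        _ = e := one_mul e
    obtain ⟨χ, hχ1, hχ2⟩ := hG.exists_normalized (E := e)
      (ψ := fun i => ((NNReal.sqrt t : ℝ) : ℂ) • ψ i)
      (by simp_rw [enorm_sqrt_smul]; rw [ENNReal.tsum_mul_left]; exact mul_le_one' ht.le h1)
      (by simp_rw [sqNormOp_sqrt_smul _ ht0]; rwa [ENNReal.tsum_mul_left])
    refine le_trans ?_ (tsum_sqNormOp_le_eNorm_sq_of_eq_one A hχ1 (hχ2.trans hE)
      (ne_top_of_le_ne_top hS hχ2))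
    rw [tsum_sumElim (sqNormOp (G.toPMap A))]
    simp_rw [sqNormOp_sqrt_smul _ ht0]
    rw [ENNReal.tsum_mul_left]
    exact le_self_add

theorem eNorm_le {G : PosOp H} {A : G.BG} {E : ℝ≥0∞} {c : ℝ≥0∞}
    (h : ∀ ψ : onbIndex H → H, ∑' i, ‖ψ i‖ₑ ^ 2 = 1 → ∑' i, sqNormOp G.sqrt.op (ψ i) ≤ E →
      ∑' i, sqNormOp (G.toPMap A) (ψ i) ≤ c ^ 2) : G.eNorm E A ≤ c := by
  refine iSup_le fun ρ => iSup₂_le fun hρ hE => ?_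
  have hd := decomposes_sqrt hρ.1
  have := h _ (by rw [← hd.posTrace_eq, hρ.2]) hE
  calc (trConj (G.toPMap A) ρ) ^ (1 / 2 : ℝ) ≤ (c ^ 2) ^ (1 / 2 : ℝ) :=
        ENNReal.rpow_le_rpow this (by norm_num)
    _ = c := by rw [← ENNReal.rpow_natCast, ← ENNReal.rpow_mul]; norm_num

/-- A relative bound controls the energy-constrained norm. -/
theorem eNorm_sq_le_of_relBoundWith {G : PosOp H} {A : G.BG} {E : ℝ≥0} {a b : ℝ}
    (h : RelBoundWith G.sqrt.op A.1 a b) :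
    G.eNorm E A ≤ ENNReal.ofReal √(a ^ 2 + b ^ 2 * E) := by
  refine eNorm_le fun ψ h1 hE => ?_
  have hS : ∑' i, sqNormOp G.sqrt.op (ψ i) ≠ ⊤ := ne_top_of_le_ne_top ENNReal.coe_ne_top hE
  have hmem := mem_sqrt_domain_of_tsum_ne_top hS
  rw [← ENNReal.ofReal_pow (Real.sqrt_nonneg _), Real.sq_sqrt (by positivity)]
  calc ∑' i, sqNormOp (G.toPMap A) (ψ i)
      ≤ ∑' i, (ENNReal.ofReal (a ^ 2) * ‖ψ i‖ₑ ^ 2 +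
          ENNReal.ofReal (b ^ 2) * sqNormOp G.sqrt.op (ψ i)) := by
        refine ENNReal.tsum_le_tsum fun i => ?_
        rw [sqNormOp_of_mem (A := G.toPMap A) (hmem i), sqNormOp_of_mem (hmem i)]
        simp_rw [← ofReal_norm_sq_eq_enorm_sq]
        rw [← ENNReal.ofReal_mul (by positivity), ← ENNReal.ofReal_mul (by positivity),
          ← ENNReal.ofReal_add (by positivity) (by positivity)]
        exact ENNReal.ofReal_le_ofReal (h ⟨ψ i, hmem i⟩)
    _ = ENNReal.ofReal (a ^ 2) * ∑' i, ‖ψ i‖ₑ ^ 2 +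
          ENNReal.ofReal (b ^ 2) * ∑' i, sqNormOp G.sqrt.op (ψ i) := by
        rw [ENNReal.tsum_add, ENNReal.tsum_mul_left, ENNReal.tsum_mul_left]
    _ ≤ ENNReal.ofReal (a ^ 2) * 1 + ENNReal.ofReal (b ^ 2) * E := by gcongr; exact h1.le
    _ = ENNReal.ofReal (a ^ 2 + b ^ 2 * E) := by
        rw [mul_one, ENNReal.ofReal_add (by positivity) (by positivity),
          ENNReal.ofReal_mul (by positivity), ENNReal.ofReal_coe_nnreal]

/-- The energy-constrained norm gives a relative bound. -/
theorem InfZero.norm_sq_le_of_eNorm_le {G : PosOp H} (hG : G.InfZero) {A : G.BG} {E : ℝ≥0}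
    (hE : 0 < E) {c : ℝ} (hc : 0 ≤ c) (h : G.eNorm E A ≤ ENNReal.ofReal c)
    (x : G.sqrt.op.domain) :
    ‖A.1 x‖ ^ 2 ≤ c ^ 2 * (‖(x : H)‖ ^ 2 + ‖G.sqrt.op x‖ ^ 2 / E) := by
  rcases eq_or_ne x 0 with rfl | hx
  · simp
  have hx' : 0 < ‖(x : H)‖ := by simpa using hx
  have hE' : (0 : ℝ) < E := hE
  -- The vector N^{-1/2} x has squared norm at most 1 and energy at most E simultaneously.
  set N : ℝ := ‖(x : H)‖ ^ 2 + ‖G.sqrt.op x‖ ^ 2 / E with hN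
  have hNpos : 0 < N := by positivity
  let t : ℝ≥0 := ⟨N⁻¹, by positivity⟩
  have ht0 : t ≠ 0 := fun h0 => by
    have : N⁻¹ = 0 := congrArg NNReal.toReal h0
    exact (inv_ne_zero hNpos.ne') this
  have htE : (t : ℝ≥0∞) = ENNReal.ofReal N⁻¹ := (ENNReal.ofReal_coe_nnreal (p := t)).symm
  have key := hG.tsum_sqNormOp_le_eNorm_sq (ι := Unit) (E := E) A
    (ψ := fun _ => ((NNReal.sqrt t : ℝ) : ℂ) • (x : H))
  simp only [tsum_fintype, Finset.univ_unique, Finset.sum_singleton, enorm_sqrt_smul] at key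
  simp only [sqNormOp_sqrt_smul _ ht0, sqNormOp_of_mem (A := G.toPMap A) x.2, sqNormOp_of_mem x.2,
    ← ofReal_norm_sq_eq_enorm_sq, htE] at key
  rw [← ENNReal.ofReal_mul (by positivity), ← ENNReal.ofReal_mul (by positivity),
    ← ENNReal.ofReal_mul (by positivity)] at key
  have h1 := key (by
      rw [ENNReal.ofReal_le_one, inv_mul_le_iff₀ hNpos, mul_one, hN]
      exact le_add_of_nonneg_right (by positivity)) (by
      rw [← ENNReal.ofReal_coe_nnreal]
      refine ENNReal.ofReal_le_ofReal ?_
      rw [inv_mul_le_iff₀ hNpos, hN, add_mul, div_mul_cancel₀ _ hE'.ne']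
      exact le_add_of_nonneg_left (by positivity)) ENNReal.ofReal_ne_top
  have h2 : ENNReal.ofReal (N⁻¹ * ‖A.1 x‖ ^ 2) ≤ ENNReal.ofReal (c ^ 2) := by
    refine h1.trans ?_
    rw [ENNReal.ofReal_pow hc]
    exact pow_le_pow_left₀ zero_le h 2
  rw [ENNReal.ofReal_le_ofReal_iff (by positivity), inv_mul_le_iff₀ hNpos] at h2
  linarith

end PosOp

/-! ## The Hilbert space tensor product and its slices -/

section Tensor

variable {H K : Type*} [NormedAddCommGroup H] [InnerProductSpace ℂ H]
  [NormedAddCommGroup K] [InnerProductSpace ℂ K]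

/-- `x ↦ x ⊗ y`. -/
def tensL (H : Type*) [NormedAddCommGroup H] [InnerProductSpace ℂ H] (y : K) :
    H →L[ℂ] HTensor H K :=
  UniformSpace.Completion.toComplL.comp ((TensorProduct.mkL ℂ H K).flip y)

/-- `y ↦ x ⊗ y`. -/
def tensR (K : Type*) [NormedAddCommGroup K] [InnerProductSpace ℂ K] (x : H) :
    K →L[ℂ] HTensor H K :=
  UniformSpace.Completion.toComplL.comp (TensorProduct.mkL ℂ H K x)

theorem tensL_apply (x : H) (y : K) : tensL H y x = tens x y := rfl

theorem tensR_apply (x : H) (y : K) : tensR K x y = tens x y := rfl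

theorem inner_tens (x x' : H) (y y' : K) :
    ⟪tens x y, tens x' y'⟫_ℂ = ⟪x, x'⟫_ℂ * ⟪y, y'⟫_ℂ := by
  simp [tens]

theorem norm_tens (x : H) (y : K) : ‖tens x y‖ = ‖x‖ * ‖y‖ := by
  simp [tens]

theorem ampl_tens (A : H →L[ℂ] H) (x : H) (y : K) : ampl K A (tens x y) = tens (A x) y := by
  simp [ampl, tens]

theorem dense_span_tens :
    Dense (Submodule.span ℂ {ξ : HTensor H K | ∃ x y, ξ = tens x y} : Set (HTensor H K)) := by
  refine Dense.mono ?_ (UniformSpace.Completion.denseRange_coe (α := H ⊗[ℂ] K))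
  rintro _ ⟨t, rfl⟩
  induction t using TensorProduct.induction_on with
  | zero => exact Submodule.zero_mem _
  | tmul x y => exact Submodule.subset_span ⟨x, y, rfl⟩
  | add s t hs ht =>
    rw [UniformSpace.Completion.coe_add]
    exact Submodule.add_mem _ hs ht

theorem clm_ext_tens {F : Type*} [NormedAddCommGroup F] [NormedSpace ℂ F]
    {S T : HTensor H K →L[ℂ] F} (h : ∀ x y, S (tens x y) = T (tens x y)) : S = T := by
  refine ContinuousLinearMap.ext_on dense_span_tens ?_
  rintro _ ⟨x, y, rfl⟩
  exact h x y

theorem eq_zero_of_inner_tens {ξ : HTensor H K} (h : ∀ x y, ⟪tens x y, ξ⟫_ℂ = 0) : ξ = 0 := by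
  have : innerSL ℂ ξ = 0 := clm_ext_tens fun x y => by
    rw [innerSL_apply_apply, ← inner_conj_symm, h]; simp
  have h2 := congrArg (fun T => T ξ) this
  simpa using h2

theorem ampl_one : ampl K (1 : H →L[ℂ] H) = 1 :=
  clm_ext_tens fun x y => by rw [ampl_tens]; rfl

theorem ampl_mul (A B : H →L[ℂ] H) : ampl K (A * B) = ampl K A * ampl K B :=
  clm_ext_tens fun x y => by
    change _ = ampl K A (ampl K B (tens x y))
    simp only [ampl_tens]; rfl

variable [CompleteSpace H]

/-- The slice of a tensor along `y`, determined by `⟪x, slice y ξ⟫ = ⟪x ⊗ y, ξ⟫`. -/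
def slice (y : K) : HTensor H K →L[ℂ] H := ContinuousLinearMap.adjoint (tensL H y)

theorem inner_slice (x : H) (y : K) (ξ : HTensor H K) : ⟪x, slice y ξ⟫_ℂ = ⟪tens x y, ξ⟫_ℂ :=
  ContinuousLinearMap.adjoint_inner_right _ _ _

theorem slice_tens (x : H) (y y' : K) : slice y (tens x y') = ⟪y, y'⟫_ℂ • x :=
  ext_inner_left ℂ fun h => by
    rw [inner_slice, inner_tens, inner_smul_right, mul_comm]

theorem adjoint_ampl (A : H →L[ℂ] H) :
    ContinuousLinearMap.adjoint (ampl K A) = ampl K (ContinuousLinearMap.adjoint A) := by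
  refine clm_ext_tens fun x y => sub_eq_zero.1 (eq_zero_of_inner_tens fun x' y' => ?_)
  rw [inner_sub_right, ContinuousLinearMap.adjoint_inner_right, ampl_tens, ampl_tens, inner_tens,
    inner_tens, ContinuousLinearMap.adjoint_inner_right, sub_self]

theorem slice_ampl (A : H →L[ℂ] H) (y : K) (ξ : HTensor H K) :
    slice y (ampl K A ξ) = A (slice y ξ) :=
  ext_inner_left ℂ fun h => by
    rw [inner_slice, ← ContinuousLinearMap.adjoint_inner_left, adjoint_ampl, ampl_tens,
      ← inner_slice, ContinuousLinearMap.adjoint_inner_left]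

theorem slice_add (y y' : K) (ξ : HTensor H K) : slice (y + y') ξ = slice y ξ + slice y' ξ :=
  ext_inner_left ℂ fun h => by
    rw [inner_add_right, inner_slice, inner_slice, inner_slice, ← inner_add_left,
      ← tensR_apply, map_add]; rfl

theorem slice_smul (c : ℂ) (y : K) (ξ : HTensor H K) :
    slice (c • y) ξ = (starRingEnd ℂ) c • slice y ξ :=
  ext_inner_left ℂ fun h => by
    rw [inner_smul_right, inner_slice, inner_slice, ← tensR_apply, map_smul, inner_smul_left]; rfl

theorem norm_slice_le (y : K) (ξ : HTensor H K) : ‖slice y ξ‖ ≤ ‖y‖ * ‖ξ‖ := by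
  have h1 : ‖slice y ξ‖ ^ 2 = (⟪tens (slice y ξ) y, ξ⟫_ℂ).re := by
    rw [← inner_slice, re_inner_self_eq_norm_sq]
  have h2 : (⟪tens (slice y ξ) y, ξ⟫_ℂ).re ≤ ‖slice y ξ‖ * ‖y‖ * ‖ξ‖ := by
    rw [← norm_tens]; exact re_inner_le_norm (𝕜 := ℂ) _ _
  by_contra! hlt
  have : 0 < ‖slice y ξ‖ := lt_of_le_of_lt (by positivity) hlt
  nlinarith

/-- `x ↦ x ⊗ y` for a unit vector `y`. -/
def tensIsometry (H : Type*) [NormedAddCommGroup H] [InnerProductSpace ℂ H] (y : K)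
    (hy : ‖y‖ = 1) : H →ₗᵢ[ℂ] HTensor H K :=
  ⟨(tensL H y : H →ₗ[ℂ] HTensor H K), fun x => by
    change ‖tens x y‖ = ‖x‖
    rw [norm_tens, hy, mul_one]⟩

variable [CompleteSpace K] {κ : Type*} (f : HilbertBasis κ ℂ K)

theorem eq_zero_of_slice_eq_zero {ξ : HTensor H K} (h : ∀ k, slice (f k) ξ = 0) : ξ = 0 := by
  refine eq_zero_of_inner_tens fun x y => ?_
  have h1 : ContinuousLinearMap.adjoint (tensR K x) ξ = 0 := by
    have h2 := f.enorm_sq_eq_tsum (ContinuousLinearMap.adjoint (tensR K x) ξ)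
    have h3 : ∀ k, ⟪f k, ContinuousLinearMap.adjoint (tensR K x) ξ⟫_ℂ = 0 := fun k => by
      rw [ContinuousLinearMap.adjoint_inner_right, tensR_apply, ← inner_slice, h k,
        inner_zero_right]
    simpa [h3] using h2
  rw [← tensR_apply, ← ContinuousLinearMap.adjoint_inner_right, h1, inner_zero_right]

/-- The subspaces H ⊗ f_k are orthogonal, and a vector orthogonal to all of them has only zero
slices. Tensors thereby become square-summable families of slices. -/
theorem isHilbertSum_tens : IsHilbertSum ℂ (fun _ : κ => H)
    (fun k => tensIsometry H (f k) (f.orthonormal.1 k)) := by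
  refine IsHilbertSum.mk ?_ ?_
  · intro i j hij x y
    change ⟪tens x (f i), tens y (f j)⟫_ℂ = 0
    rw [inner_tens, f.orthonormal.2 hij, mul_zero]
  · rw [top_le_iff, Submodule.topologicalClosure_eq_top_iff, Submodule.eq_bot_iff]
    intro ξ hξ
    refine eq_zero_of_slice_eq_zero f fun k => ext_inner_left ℂ fun x => ?_
    rw [inner_slice, inner_zero_right]
    rw [Submodule.mem_orthogonal] at hξ
    exact hξ _ (Submodule.mem_iSup_of_mem k ⟨x, rfl⟩)

/-- The decomposition of `H ⊗ K` given by an orthonormal basis of `K`. -/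
def sliceEquiv : HTensor H K ≃ₗᵢ[ℂ] lp (fun _ : κ => H) 2 :=
  (isHilbertSum_tens f).linearIsometryEquiv

theorem hasSum_sliceEquiv (ξ : HTensor H K) :
    HasSum (fun k => tens (sliceEquiv f ξ k) (f k)) ξ := by
  have h := (isHilbertSum_tens (H := H) f).hasSum_linearIsometryEquiv_symm (sliceEquiv f ξ)
  rw [sliceEquiv, LinearIsometryEquiv.symm_apply_apply] at h
  exact h

theorem sliceEquiv_apply (ξ : HTensor H K) (k : κ) : sliceEquiv f ξ k = slice (f k) ξ := by
  classical
  have h := (hasSum_sliceEquiv f ξ).mapL (slice (f k))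
  simp_rw [slice_tens, orthonormal_iff_ite.1 f.orthonormal, ite_smul, one_smul, zero_smul] at h
  have h2 := hasSum_ite_eq k (sliceEquiv f ξ k)
  refine HasSum.unique (h2.congr_fun fun j => ?_) h
  by_cases hj : j = k
  · subst hj; simp
  · simp [hj, Ne.symm hj]

theorem hasSum_tens_slice (ξ : HTensor H K) :
    HasSum (fun k => tens (slice (f k) ξ) (f k)) ξ := by
  simpa only [sliceEquiv_apply] using hasSum_sliceEquiv f ξ

theorem hasSum_norm_slice_sq (ξ : HTensor H K) :
    HasSum (fun k => ‖slice (f k) ξ‖ ^ 2) (‖ξ‖ ^ 2) := by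
  have h := lp.hasSum_norm (p := 2) (by norm_num) (sliceEquiv f ξ)
  simpa [sliceEquiv_apply] using h

theorem hasSum_inner_slice (ξ η : HTensor H K) :
    HasSum (fun k => ⟪slice (f k) ξ, slice (f k) η⟫_ℂ) ⟪ξ, η⟫_ℂ := by
  have h := lp.hasSum_inner (𝕜 := ℂ) (sliceEquiv f ξ) (sliceEquiv f η)
  simpa [sliceEquiv_apply] using h

theorem enorm_sq_eq_tsum_slice (ξ : HTensor H K) :
    ‖ξ‖ₑ ^ 2 = ∑' k, ‖slice (f k) ξ‖ₑ ^ 2 := by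
  have h := hasSum_norm_slice_sq f ξ
  rw [← ofReal_tsum_norm_sq h.summable, h.tsum_eq, ofReal_norm_sq_eq_enorm_sq]

theorem ext_slice {ξ η : HTensor H K} (h : ∀ k, slice (f k) ξ = slice (f k) η) : ξ = η :=
  sub_eq_zero.1 (eq_zero_of_slice_eq_zero f fun k => by rw [map_sub, h, sub_self])

theorem memlp_of_summable_norm_sq {x : κ → H} (h : Summable fun k => ‖x k‖ ^ 2) :
    Memℓp x 2 := by
  rw [memℓp_gen_iff (by norm_num)]
  simpa using h

theorem exists_slice_eq {x : κ → H} (h : Summable fun k => ‖x k‖ ^ 2) :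
    ∃ ξ : HTensor H K, ∀ k, slice (f k) ξ = x k :=
  ⟨(sliceEquiv f).symm ⟨x, memlp_of_summable_norm_sq h⟩, fun k => by
    rw [← sliceEquiv_apply, LinearIsometryEquiv.apply_symm_apply]⟩

end Tensor

/-! ## Amplifications of unbounded operators -/

section Amplification

variable {H K : Type*} [NormedAddCommGroup H] [InnerProductSpace ℂ H] [CompleteSpace H]
  [NormedAddCommGroup K] [InnerProductSpace ℂ K]

/-- The closed graph of `S ⊗ I_K`. -/
abbrev amplGraph (K : Type*) [NormedAddCommGroup K] [InnerProductSpace ℂ K] (S : H →ₗ.[ℂ] H) :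
    Submodule ℂ (HTensor H K × HTensor H K) :=
  (Submodule.span ℂ {p : HTensor H K × HTensor H K |
    ∃ (x : S.domain) (y : K), p = (tens (x : H) y, tens (S x) y)}).topologicalClosure

/-- Slicing both components is continuous and sends each generator to a multiple of a point of the
graph of S, which is closed. -/
theorem slice_mem_graph_of_mem_amplGraph (S : PosOp H) {p : HTensor H K × HTensor H K}
    (hp : p ∈ amplGraph K S.op) (y : K) : (slice y p.1, slice y p.2) ∈ S.op.graph := by
  let L : HTensor H K × HTensor H K →L[ℂ] H × H := (slice y).prodMap (slice y)
  have hcl : IsClosed (L ⁻¹' (S.op.graph : Set (H × H))) :=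
    (IsSelfAdjoint.isClosed S.selfAdjoint).preimage L.continuous
  have hle : amplGraph K S.op ≤
      S.op.graph.comap (L : HTensor H K × HTensor H K →ₗ[ℂ] H × H) := by
    refine Submodule.topologicalClosure_minimal _ (Submodule.span_le.2 ?_) hcl
    rintro _ ⟨x, z, rfl⟩
    change (slice y (tens (x : H) z), slice y (tens (S.op x) z)) ∈ S.op.graph
    rw [slice_tens, slice_tens]
    exact S.op.graph.smul_mem _ (S.op.mem_graph x)
  exact hle hp

theorem tens_mem_amplGraph (S : PosOp H) {x x' : H} (h : (x, x') ∈ S.op.graph) (y : K) :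
    (tens x y, tens x' y) ∈ amplGraph K S.op := by
  refine Submodule.le_topologicalClosure _ (Submodule.subset_span ?_)
  have hx := LinearPMap.mem_domain_of_mem_graph h
  exact ⟨⟨x, hx⟩, y, by rw [(LinearPMap.image_iff hx).2 h]⟩

variable [CompleteSpace K]

/-- This is what makes the `toLinearPMap` in `amplPMap` have the closed span as its actual graph. -/
theorem amplGraph_functional (S : PosOp H) (p : HTensor H K × HTensor H K)
    (hp : p ∈ amplGraph K S.op) (h0 : p.1 = 0) : p.2 = 0 := by
  obtain ⟨w, f, -⟩ := exists_hilbertBasis ℂ K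
  refine eq_zero_of_slice_eq_zero f fun k => ?_
  exact S.op.graph_fst_eq_zero_snd (slice_mem_graph_of_mem_amplGraph S hp (f k)) (by simp [h0])

theorem graph_amplPMap (S : PosOp H) : (amplPMap K S.op).graph = amplGraph K S.op :=
  Submodule.toLinearPMap_graph_eq _ (amplGraph_functional S)

/-- The partial sums of ∑ slice ⊗ f_k lie in the graph, which is closed. Together with the converse
for slices this describes S ⊗ I slice by slice. -/
theorem mem_amplGraph_of_slice {κ : Type*} (f : HilbertBasis κ ℂ K) (S : PosOp H)
    {ξ η : HTensor H K} (h : ∀ k, (slice (f k) ξ, slice (f k) η) ∈ S.op.graph) :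
    (ξ, η) ∈ amplGraph K S.op := by
  have h1 : HasSum (fun k => (tens (slice (f k) ξ) (f k), tens (slice (f k) η) (f k))) (ξ, η) :=
    (hasSum_tens_slice f ξ).prodMk (hasSum_tens_slice f η)
  refine (Submodule.isClosed_topologicalClosure _).mem_of_tendsto h1
    (Filter.Eventually.of_forall fun s => ?_)
  exact Submodule.sum_mem _ fun k _ => tens_mem_amplGraph S (h k) (f k)

theorem slice_mem_domain (S : PosOp H) (ξ : (amplPMap K S.op).domain) (y : K) :
    (slice y (ξ : HTensor H K), slice y (amplPMap K S.op ξ)) ∈ S.op.graph := by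
  have h := (amplPMap K S.op).mem_graph ξ
  rw [graph_amplPMap] at h
  exact slice_mem_graph_of_mem_amplGraph S h y

/-- A vector whose slices have finite total energy belongs to the domain of `S ⊗ I`. -/
theorem mem_amplPMap_domain {κ : Type*} (f : HilbertBasis κ ℂ K) (S : PosOp H) {ξ : HTensor H K}
    (h : ∑' k, sqNormOp S.op (slice (f k) ξ) ≠ ⊤) : ξ ∈ (amplPMap K S.op).domain := by
  have hmem : ∀ k, slice (f k) ξ ∈ S.op.domain := fun k =>
    mem_domain_of_sqNormOp_ne_top (ENNReal.ne_top_of_tsum_ne_top h k)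
  have hs : Summable fun k => ‖S.op ⟨slice (f k) ξ, hmem k⟩‖ ^ 2 := by
    simp_rw [fun k => sqNormOp_of_mem (hmem k)] at h
    exact summable_norm_sq_of_tsum_enorm_ne_top h
  obtain ⟨η, hη⟩ := exists_slice_eq f hs
  have hg : (ξ, η) ∈ (amplPMap K S.op).graph := by
    rw [graph_amplPMap]
    refine mem_amplGraph_of_slice f S fun k => ?_
    rw [hη]
    exact S.op.mem_graph ⟨_, hmem k⟩
  exact LinearPMap.mem_domain_of_mem_graph hg

/-- An `S ⊗ I`-bounded operator is determined by its values on elementary tensors. -/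
theorem eq_zero_of_relBounded_of_tens (S : PosOp H)
    {T : (amplPMap K S.op).domain →ₗ[ℂ] HTensor H K} (hT : IsRelBounded (amplPMap K S.op) T)
    (h0 : ∀ (x : S.op.domain) (y : K) (h : tens (x : H) y ∈ (amplPMap K S.op).domain),
      T ⟨tens (x : H) y, h⟩ = 0) : T = 0 := by
  obtain ⟨a, b, ha, hb, hab⟩ := hT
  have hspan : ∀ p ∈ Submodule.span ℂ {p : HTensor H K × HTensor H K |
      ∃ (x : S.op.domain) (y : K), p = (tens (x : H) y, tens (S.op x) y)},
      ∃ h : p.1 ∈ (amplPMap K S.op).domain, T ⟨p.1, h⟩ = 0 := by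
    intro p hp
    induction hp using Submodule.span_induction with
    | mem p hp =>
      obtain ⟨x, y, rfl⟩ := hp
      have hg := tens_mem_amplGraph S (S.op.mem_graph x) y
      rw [← graph_amplPMap] at hg
      exact ⟨LinearPMap.mem_domain_of_mem_graph hg, h0 x y _⟩
    | zero => exact ⟨Submodule.zero_mem _, T.map_zero⟩
    | add p q _ _ hp hq =>
      obtain ⟨hp, hp0⟩ := hp
      obtain ⟨hq, hq0⟩ := hq
      refine ⟨Submodule.add_mem _ hp hq, ?_⟩
      have : (⟨(p + q).1, Submodule.add_mem _ hp hq⟩ : (amplPMap K S.op).domain) =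
        ⟨p.1, hp⟩ + ⟨q.1, hq⟩ := rfl
      rw [this, map_add, hp0, hq0, add_zero]
    | smul c p _ hp =>
      obtain ⟨hp, hp0⟩ := hp
      refine ⟨Submodule.smul_mem _ c hp, ?_⟩
      have : (⟨(c • p).1, Submodule.smul_mem _ c hp⟩ : (amplPMap K S.op).domain) =
        c • ⟨p.1, hp⟩ := rfl
      rw [this, map_smul, hp0, smul_zero]
  ext ξ
  -- The span of elementary tensors is a core: p_n tends to (ξ, (S ⊗ I)ξ) in the graph and T
  -- vanishes at the first component of p_n, so the relative bound at the difference forces T ξ = 0.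
  have hξ := (amplPMap K S.op).mem_graph ξ
  rw [graph_amplPMap] at hξ
  obtain ⟨p, hp, hlim⟩ := mem_closure_iff_seq_limit.1 hξ
  rw [Prod.tendsto_iff] at hlim
  have h1 : Filter.Tendsto (fun n => (a ^ 2 * ‖(ξ : HTensor H K) - (p n).1‖ ^ 2 +
      b ^ 2 * ‖amplPMap K S.op ξ - (p n).2‖ ^ 2)) Filter.atTop (𝓝 0) := by
    have e1 := ((hlim.1.const_sub (ξ : HTensor H K)).norm.pow 2).const_mul (a ^ 2)
    have e2 := ((hlim.2.const_sub (amplPMap K S.op ξ)).norm.pow 2).const_mul (b ^ 2)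
    simpa using e1.add e2
  have h2 : ∀ n, ‖T ξ‖ ^ 2 ≤ a ^ 2 * ‖(ξ : HTensor H K) - (p n).1‖ ^ 2 +
      b ^ 2 * ‖amplPMap K S.op ξ - (p n).2‖ ^ 2 := fun n => by
    obtain ⟨hn, hn0⟩ := hspan (p n) (hp n)
    have hg : p n ∈ (amplPMap K S.op).graph := by
      rw [graph_amplPMap]; exact Submodule.le_topologicalClosure _ (hp n)
    have h3 := hab (ξ - ⟨(p n).1, hn⟩)
    have h4 : amplPMap K S.op ⟨(p n).1, hn⟩ = (p n).2 := ((LinearPMap.image_iff hn).2 hg).symm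
    rwa [map_sub, hn0, sub_zero, LinearPMap.map_sub, h4] at h3
  have h3 : ‖T ξ‖ ^ 2 ≤ 0 := ge_of_tendsto h1 (Filter.Eventually.of_forall h2)
  simpa using h3

theorem IsAmplExtension.unique (S : PosOp H) {A : S.op.domain →ₗ[ℂ] H}
    {T T' : (amplPMap K S.op).domain →ₗ[ℂ] HTensor H K} (hT : IsAmplExtension S.op A T)
    (hT' : IsAmplExtension S.op A T') : T = T' := by
  refine sub_eq_zero.1 (eq_zero_of_relBounded_of_tens S
    ((relBoundedOps (amplPMap K S.op)).sub_mem hT.1 hT'.1) fun x y h => ?_)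
  rw [LinearMap.sub_apply, hT.2, hT'.2, sub_self]

/-- The amplification `A ⊗ I_K` of a `√G`-bounded operator, described by its slices. -/
theorem exists_amplExtension {κ : Type*} (f : HilbertBasis κ ℂ K) (G : PosOp H) (A : G.BG) :
    ∃ T : (amplPMap K G.sqrt.op).domain →ₗ[ℂ] HTensor H K,
      IsAmplExtension G.sqrt.op A.1 T ∧
      ∀ (ξ : (amplPMap K G.sqrt.op).domain) (k : κ), slice (f k) (T ξ) =
        A.1 ⟨slice (f k) (ξ : HTensor H K),
          LinearPMap.mem_domain_of_mem_graph (slice_mem_domain G.sqrt ξ (f k))⟩ := by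
  obtain ⟨a, b, ha, hb, hA⟩ := A.2
  have hbd : ∀ (ξ : (amplPMap K G.sqrt.op).domain) (k : κ),
      ‖A.1 ⟨slice (f k) (ξ : HTensor H K),
        LinearPMap.mem_domain_of_mem_graph (slice_mem_domain G.sqrt ξ (f k))⟩‖ ^ 2 ≤
      a ^ 2 * ‖slice (f k) (ξ : HTensor H K)‖ ^ 2 +
        b ^ 2 * ‖slice (f k) (amplPMap K G.sqrt.op ξ)‖ ^ 2 := fun ξ k => by
    refine (hA _).trans_eq ?_
    have h := (LinearPMap.image_iff (LinearPMap.mem_domain_of_mem_graph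
      (slice_mem_domain G.sqrt ξ (f k)))).2 (slice_mem_domain G.sqrt ξ (f k))
    rw [← h]
  have hbs : ∀ ξ : (amplPMap K G.sqrt.op).domain, HasSum (fun k =>
      a ^ 2 * ‖slice (f k) (ξ : HTensor H K)‖ ^ 2 +
        b ^ 2 * ‖slice (f k) (amplPMap K G.sqrt.op ξ)‖ ^ 2)
      (a ^ 2 * ‖(ξ : HTensor H K)‖ ^ 2 + b ^ 2 * ‖amplPMap K G.sqrt.op ξ‖ ^ 2) := fun ξ =>
    ((hasSum_norm_slice_sq f (ξ : HTensor H K)).mul_left _).add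
      ((hasSum_norm_slice_sq f (amplPMap K G.sqrt.op ξ)).mul_left _)
  have hsm : ∀ ξ : (amplPMap K G.sqrt.op).domain, Summable fun k =>
      ‖A.1 ⟨slice (f k) (ξ : HTensor H K),
        LinearPMap.mem_domain_of_mem_graph (slice_mem_domain G.sqrt ξ (f k))⟩‖ ^ 2 := fun ξ =>
    Summable.of_nonneg_of_le (fun _ => by positivity) (hbd ξ) (hbs ξ).summable
  -- The relative bound makes the vectors A(slice) square summable, so they are the slices of a
  -- unique tensor; uniqueness supplies linearity.
  choose T0 hT0 using fun ξ => exists_slice_eq f (hsm ξ)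
  let T : (amplPMap K G.sqrt.op).domain →ₗ[ℂ] HTensor H K :=
    { toFun := T0
      map_add' := fun ξ η => ext_slice f fun k => by
        rw [map_add, hT0, hT0, hT0, ← map_add]
        congr 1
        ext
        simp
      map_smul' := fun c ξ => ext_slice f fun k => by
        rw [map_smul, hT0, hT0, RingHom.id_apply, ← map_smul]
        congr 1
        ext
        simp }
  refine ⟨T, ⟨⟨a, b, ha, hb, fun ξ => ?_⟩, fun x y h => ext_slice f fun k => ?_⟩, hT0⟩
  · refine hasSum_le (fun k => ?_) (hasSum_norm_slice_sq f (T ξ)) (hbs ξ)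
    have := hbd ξ k
    rwa [← hT0 ξ k] at this
  · change slice (f k) (T0 _) = _
    rw [hT0, slice_tens (A.1 x), ← map_smul]
    congr 1
    ext
    simp [slice_tens]

/-- The amplifications of the cutoffs converge to the amplification of the operator. -/
theorem tendsto_ampl_cutoff (G : PosOp H) (A : G.BG)
    {T : (amplPMap K G.sqrt.op).domain →ₗ[ℂ] HTensor H K} (hT : IsAmplExtension G.sqrt.op A.1 T)
    (ξ : (amplPMap K G.sqrt.op).domain) :
    Filter.Tendsto (fun n => ampl K (G.cutoff A n) (ξ : HTensor H K)) Filter.atTop (𝓝 (T ξ)) := by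
  obtain ⟨w, f, -⟩ := exists_hilbertBasis ℂ K
  obtain ⟨T', hT', hsl⟩ := exists_amplExtension f G A
  obtain rfl := hT.unique G.sqrt hT'
  obtain ⟨a, b, ha, hb, hA⟩ := A.2
  have hmem := fun k => LinearPMap.mem_domain_of_mem_graph (slice_mem_domain G.sqrt ξ (f k))
  have hsum := ((hasSum_norm_slice_sq f (ξ : HTensor H K)).summable.mul_left (a ^ 2)).add
      ((hasSum_norm_slice_sq f (amplPMap K G.sqrt.op ξ)).summable.mul_left (b ^ 2))
  have hnorm : ∀ n, ∑' k, ‖A.1 ⟨slice (f k) (ξ : HTensor H K), hmem k⟩ -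
      G.cutoff A n (slice (f k) (ξ : HTensor H K))‖ ^ 2 =
      ‖T ξ - ampl K (G.cutoff A n) (ξ : HTensor H K)‖ ^ 2 := fun n => by
    rw [← (hasSum_norm_slice_sq f (T ξ - ampl K (G.cutoff A n) (ξ : HTensor H K))).tsum_eq]
    simp_rw [map_sub, slice_ampl, hsl]
  have hlim := tendsto_tsum_of_dominated_convergence (𝓕 := Filter.atTop)
    (f := fun n k => ‖A.1 ⟨slice (f k) (ξ : HTensor H K), hmem k⟩ -
      G.cutoff A n (slice (f k) (ξ : HTensor H K))‖ ^ 2) (g := fun _ => 0) hsum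
    (fun k => by
      have := ((G.tendsto_cutoff A ⟨_, hmem k⟩).const_sub (A.1 ⟨_, hmem k⟩)).norm.pow 2
      simpa using this)
    (Filter.Eventually.of_forall fun n k => by
      rw [Real.norm_of_nonneg (by positivity)]
      refine (G.norm_sub_cutoff_sq_le A hA n ⟨_, hmem k⟩).trans_eq ?_
      have h := (LinearPMap.image_iff (hmem k)).2 (slice_mem_domain G.sqrt ξ (f k))
      rw [← h])
  simp_rw [hnorm, tsum_zero] at hlim
  rw [tendsto_iff_norm_sub_tendsto_zero]
  have := hlim.sqrt
  simpa [norm_sub_rev] using this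

end Amplification

/-! ## Stinespring representations of normal completely positive maps -/

section Stinespring

variable {H H' : Type*} [NormedAddCommGroup H] [InnerProductSpace ℂ H] [CompleteSpace H]
  [NormedAddCommGroup H'] [InnerProductSpace ℂ H'] [CompleteSpace H']

theorem CStarAlgebra.exists_eq_star_mul_self {A : Type*} [NonUnitalCStarAlgebra A]
    [PartialOrder A] [StarOrderedRing A] {a : A} (h : 0 ≤ a) : ∃ b, a = star b * b :=
  CStarAlgebra.nonneg_iff_eq_star_mul_self.1 h

/-- The matrix (a_i* a_j) is B*B for a B whose only nonzero row is (a_j). Complete positivity keeps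
it positive under Φ, and a positive element of the matrix C*-algebra is again of the form N*N. -/
theorem CompletelyPositiveMap.exists_gram (Φ : (H →L[ℂ] H) →CP (H' →L[ℂ] H')) {n : Type*}
    [Fintype n] (a : n → H →L[ℂ] H) :
    ∃ N : n → n → H' →L[ℂ] H', ∀ i j, Φ (star (a i) * a j) = ∑ k, star (N k i) * N k j := by
  classical
  rcases isEmpty_or_nonempty n with hn | ⟨⟨k₀⟩⟩
  · exact ⟨fun i => isEmptyElim i, fun i => isEmptyElim i⟩
  let B : CStarMatrix n n (H →L[ℂ] H) := CStarMatrix.ofMatrix fun k j => if k = k₀ then a j else 0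
  have hB : ∀ i j, (star B * B) i j = star (a i) * a j := fun i j => by
    have hk : ∀ k j, B k j = if k = k₀ then a j else 0 := fun k j => rfl
    simp [CStarMatrix.mul_apply, CStarMatrix.star_apply, hk]
  have h0 : 0 ≤ (star B * B).map Φ := Φ.map_cstarMatrix_nonneg _ (star_mul_self_nonneg B)
  obtain ⟨N, hN⟩ := CStarAlgebra.exists_eq_star_mul_self h0
  refine ⟨fun k j => N k j, fun i j => ?_⟩
  rw [← hB i j]
  have := congrFun (congrFun hN i) j
  simpa [CStarMatrix.mul_apply, CStarMatrix.star_apply] using this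

/-- Opposite entries of a Gram matrix are adjoint to each other. -/
theorem CompletelyPositiveMap.map_star_mul (Φ : (H →L[ℂ] H) →CP (H' →L[ℂ] H'))
    (a b : H →L[ℂ] H) : star (Φ (star a * b)) = Φ (star b * a) := by
  obtain ⟨N, hN⟩ := Φ.exists_gram (n := Bool) fun i => if i then a else b
  have h1 := hN true false
  have h2 := hN false true
  simp only [if_true, Bool.false_eq_true, if_false] at h1 h2
  rw [h1, h2]
  simp

/-- The kernel `(a, b) ↦ Φ(a* b)`. -/
def cpKernel (Φ : (H →L[ℂ] H) →CP (H' →L[ℂ] H')) :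
    Matrix (H →L[ℂ] H) (H →L[ℂ] H) (H' →L[ℂ] H') := Matrix.of fun a b => Φ (star a * b)

/-- On finitely supported families the quadratic form is ∑_k ‖∑_i N_{ki} v_i‖², by the Gram
factorization. The reproducing kernel space of this kernel then plays the role of the GNS-type space
in Stinespring's construction. -/
theorem cpKernel_posSemidef (Φ : (H →L[ℂ] H) →CP (H' →L[ℂ] H')) : (cpKernel Φ).PosSemidef := by
  have h := (RKHS.posSemidef_tfae (K := cpKernel Φ)).out 0 2
  refine h.2 ⟨?_, fun vv => ?_⟩
  · ext1 a b
    simp only [Matrix.conjTranspose_apply, cpKernel, Matrix.of_apply]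
    exact Φ.map_star_mul b a
  · obtain ⟨N, hN⟩ := Φ.exists_gram (n := vv.support) fun i => (i : H →L[ℂ] H)
    have h1 : (vv.sum fun x w => vv.sum fun x' w' => ⟪cpKernel Φ x' x w, w'⟫_ℂ) =
        ∑ k, ⟪∑ i : vv.support, N k i (vv i), ∑ i : vv.support, N k i (vv i)⟫_ℂ := by
      simp_rw [sum_inner, inner_sum]
      rw [Finsupp.sum, ← Finset.sum_coe_sort, Finset.sum_comm]
      refine Finset.sum_congr rfl fun i _ => ?_
      rw [Finsupp.sum, ← Finset.sum_coe_sort, Finset.sum_comm]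
      refine Finset.sum_congr rfl fun j _ => ?_
      simp only [cpKernel, Matrix.of_apply]
      rw [hN j i]
      simp [ContinuousLinearMap.star_eq_adjoint,
        ContinuousLinearMap.adjoint_inner_left]
    rw [h1, map_sum]
    exact Finset.sum_nonneg fun k _ => inner_self_nonneg

/-- A Hilbert space with vectors `a x`, `a` a bounded operator, whose inner products are given by
`Φ(a* b)`. -/
theorem CompletelyPositiveMap.exists_feature {H : Type u} {H' : Type v}
    [NormedAddCommGroup H] [InnerProductSpace ℂ H] [CompleteSpace H]
    [NormedAddCommGroup H'] [InnerProductSpace ℂ H'] [CompleteSpace H']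
    (Φ : (H →L[ℂ] H) →CP (H' →L[ℂ] H')) :
    ∃ (L : Type (max u v)) (_ : NormedAddCommGroup L) (_ : InnerProductSpace ℂ L)
      (_ : CompleteSpace L) (q : (H →L[ℂ] H) → H' →L[ℂ] L),
      ∀ a b x y, ⟪q a x, q b y⟫_ℂ = ⟪x, Φ (star a * b) y⟫_ℂ := by
  have : Fact (cpKernel Φ).PosSemidef := ⟨cpKernel_posSemidef Φ⟩
  refine ⟨RKHS.OfKernel (cpKernel Φ), inferInstance, inferInstance, inferInstance,
    RKHS.kerFun (RKHS.OfKernel (cpKernel Φ)), fun a b x y => ?_⟩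
  rw [← RKHS.kernel_inner, RKHS.OfKernel.kernel_ofKernel]
  change ⟪Φ (star b * a) x, y⟫_ℂ = _
  rw [← Φ.map_star_mul, ContinuousLinearMap.star_eq_adjoint,
    ContinuousLinearMap.adjoint_inner_left]

/-- Orthonormal vectors are at distance √2, so balls of radius 1/2 around them are disjoint. -/
theorem Orthonormal.countable_of_separable {E ι : Type*} [NormedAddCommGroup E]
    [InnerProductSpace ℂ E] [TopologicalSpace.SeparableSpace E] {v : ι → E}
    (hv : Orthonormal ℂ v) : Countable ι := by
  refine Pairwise.countable_of_isOpen_disjoint (s := fun i => Metric.ball (v i) (1 / 2)) ?_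
    (fun i => Metric.isOpen_ball) (fun i => ⟨v i, Metric.mem_ball_self (by norm_num)⟩)
  intro i j hij
  refine Metric.ball_disjoint_ball ?_
  have h1 : ‖v i - v j‖ ^ 2 = 2 := by
    have := norm_sub_sq (𝕜 := ℂ) (v i) (v j)
    rw [hv.2 hij, hv.1, hv.1] at this
    norm_num at this
    exact this
  rw [dist_eq_norm]
  nlinarith [norm_nonneg (v i - v j)]

/-- A separable Hilbert space embeds isometrically into one in any prescribed universe. -/
theorem exists_isometry_separable (E : Type*) [NormedAddCommGroup E] [InnerProductSpace ℂ E]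
    [CompleteSpace E] [TopologicalSpace.SeparableSpace E] :
    ∃ (K : Type w) (_ : NormedAddCommGroup K) (_ : InnerProductSpace ℂ K) (_ : CompleteSpace K)
      (_ : TopologicalSpace.SeparableSpace K), Nonempty (E →ₗᵢ[ℂ] K) := by
  obtain ⟨s, f, -⟩ := exists_hilbertBasis ℂ E
  have : Countable s := f.orthonormal.countable_of_separable
  obtain ⟨g, hg⟩ := Countable.exists_injective_nat s
  let e : HilbertBasis (ULift.{w} ℕ) ℂ (lp (fun _ : ULift.{w} ℕ => ℂ) 2) := default
  have he : Orthonormal ℂ fun i : s => e (ULift.up (g i)) :=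
    e.orthonormal.comp _ (ULift.up_injective.comp hg)
  refine ⟨lp (fun _ : ULift.{w} ℕ => ℂ) 2, inferInstance, inferInstance, inferInstance, ?_,
    ⟨(he.orthogonalFamily.linearIsometry).comp f.repr.toLinearIsometry⟩⟩
  rw [← TopologicalSpace.isSeparable_univ_iff]
  have h1 : TopologicalSpace.IsSeparable (Set.range e) := (Set.countable_range e).isSeparable
  have h2 := (h1.span (R := ℂ)).closure
  rw [← Submodule.topologicalClosure_coe, e.dense_span] at h2
  exact h2

end Stinespring

/-! ### Existence of a Stinespring operator, built from rank-one operators -/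

section StinespringExistence

variable {H H' : Type*} [NormedAddCommGroup H] [InnerProductSpace ℂ H] [CompleteSpace H]
  [NormedAddCommGroup H'] [InnerProductSpace ℂ H'] [CompleteSpace H']

open InnerProductSpace (rankOne)

theorem star_rankOne (x y : H) : star (rankOne ℂ x y) = rankOne ℂ y x := by
  rw [ContinuousLinearMap.star_eq_adjoint, InnerProductSpace.adjoint_rankOne]

theorem rankOne_mul_rankOne (x y z t : H) :
    rankOne ℂ x y * rankOne ℂ z t = ⟪y, z⟫_ℂ • rankOne ℂ x t :=
  InnerProductSpace.rankOne_comp_rankOne x y z t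

theorem re_inner_le_of_le {A B : H →L[ℂ] H} (h : A ≤ B) (x : H) :
    (⟪x, A x⟫_ℂ).re ≤ (⟪x, B x⟫_ℂ).re := by
  have h1 := ((ContinuousLinearMap.le_def A B).1 h).re_inner_nonneg_right x
  rw [sub_apply, inner_sub_right, map_sub] at h1
  exact sub_nonneg.1 h1

theorem le_of_re_inner_le {A B : H →L[ℂ] H} (hA : IsSelfAdjoint A) (hB : IsSelfAdjoint B)
    (h : ∀ x, (⟪x, A x⟫_ℂ).re ≤ (⟪x, B x⟫_ℂ).re) : A ≤ B := by
  rw [ContinuousLinearMap.le_def, ContinuousLinearMap.isPositive_def']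
  refine ⟨hB.sub hA, fun x => ?_⟩
  rw [ContinuousLinearMap.reApplyInnerSelf_apply, inner_re_symm, sub_apply,
    inner_sub_right, map_sub]
  exact sub_nonneg.2 (h x)

/-- Vectors `b_i* x` in a separable space `K` whose inner products are given by
`Φ(|b_i⟩⟨b_j|)`. -/
theorem CompletelyPositiveMap.exists_feature_basis [TopologicalSpace.SeparableSpace H]
    [TopologicalSpace.SeparableSpace H'] (Φ : (H →L[ℂ] H) →CP (H' →L[ℂ] H')) {e : H}
    (he : ‖e‖ = 1) {ι : Type*} (b : HilbertBasis ι ℂ H) :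
    ∃ (K : Type w) (_ : NormedAddCommGroup K) (_ : InnerProductSpace ℂ K) (_ : CompleteSpace K)
      (_ : TopologicalSpace.SeparableSpace K) (p : ι → H' →L[ℂ] K),
      ∀ i j x y, ⟪p i x, p j y⟫_ℂ = ⟪x, Φ (rankOne ℂ (b i) (b j)) y⟫_ℂ := by
  obtain ⟨L, _, _, _, q, hq⟩ := Φ.exists_feature
  have : Countable ι := b.orthonormal.countable_of_separable
  let M : Submodule ℂ L :=
    (Submodule.span ℂ (⋃ i, Set.range (q (rankOne ℂ e (b i))))).topologicalClosure
  have hsep : TopologicalSpace.IsSeparable (M : Set L) := by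
    rw [Submodule.topologicalClosure_coe]
    refine (TopologicalSpace.IsSeparable.span (R := ℂ) ?_).closure
    exact TopologicalSpace.IsSeparable.iUnion fun i =>
      TopologicalSpace.isSeparable_range (q _).continuous
  have : TopologicalSpace.SeparableSpace M := hsep.separableSpace
  have : CompleteSpace M := (Submodule.isClosed_topologicalClosure _).completeSpace_coe
  obtain ⟨K, _, _, _, _, ⟨U⟩⟩ := exists_isometry_separable.{w} M
  have hmem : ∀ i x, q (rankOne ℂ e (b i)) x ∈ M := fun i x =>
    Submodule.le_topologicalClosure _ (Submodule.subset_span (Set.mem_iUnion.2 ⟨i, x, rfl⟩))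
  -- The vectors are the features of |e⟩⟨b_i|: since ‖e‖ = 1, (|e⟩⟨b_i|)* |e⟩⟨b_j| = |b_i⟩⟨b_j|.
  -- Countably many such ranges span a separable space.
  refine ⟨K, inferInstance, inferInstance, inferInstance, inferInstance,
    fun i => U.toContinuousLinearMap.comp ((q (rankOne ℂ e (b i))).codRestrict M (hmem i)),
    fun i j x y => ?_⟩
  change ⟪U _, U _⟫_ℂ = _
  rw [LinearIsometry.inner_map_map, Submodule.coe_inner]
  change ⟪q _ x, q _ y⟫_ℂ = _
  rw [hq, star_rankOne, rankOne_mul_rankOne, inner_self_eq_norm_sq_to_K, he]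
  simp

/-- The projection onto the span of finitely many basis vectors. -/
def basisProj {ι : Type*} (b : HilbertBasis ι ℂ H) (s : Finset ι) : H →L[ℂ] H :=
  ∑ i ∈ s, rankOne ℂ (b i) (b i)

section BasisProj

variable {ι : Type*} (b : HilbertBasis ι ℂ H) (s : Finset ι)

theorem basisProj_isSelfAdjoint : IsSelfAdjoint (basisProj b s) := by
  rw [isSelfAdjoint_iff, basisProj, star_sum]
  simp_rw [star_rankOne]

theorem basisProj_mul_self : basisProj b s * basisProj b s = basisProj b s := by
  classical
  simp only [basisProj, Finset.sum_mul, Finset.mul_sum, rankOne_mul_rankOne,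
    orthonormal_iff_ite.1 b.orthonormal]
  refine Finset.sum_congr rfl fun i hi => ?_
  simp [ite_smul, hi]

theorem re_inner_basisProj (x : H) :
    (⟪x, basisProj b s x⟫_ℂ).re = ∑ i ∈ s, ‖⟪b i, x⟫_ℂ‖ ^ 2 := by
  simp only [basisProj, sum_apply, InnerProductSpace.rankOne_apply, inner_sum,
    inner_smul_right, Complex.re_sum]
  refine Finset.sum_congr rfl fun i _ => ?_
  rw [← inner_conj_symm x (b i), Complex.mul_conj, Complex.normSq_eq_norm_sq,
    Complex.ofReal_re]

theorem basisProj_mono {s t : Finset ι} (h : s ⊆ t) : basisProj b s ≤ basisProj b t := by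
  refine le_of_re_inner_le (basisProj_isSelfAdjoint b s) (basisProj_isSelfAdjoint b t) fun x => ?_
  rw [re_inner_basisProj, re_inner_basisProj]
  exact Finset.sum_le_sum_of_subset_of_nonneg h fun _ _ _ => by positivity

theorem basisProj_le_one : basisProj b s ≤ 1 := by
  refine le_of_re_inner_le (basisProj_isSelfAdjoint b s) (IsSelfAdjoint.one _) fun x => ?_
  rw [re_inner_basisProj, one_apply_eq_self, re_inner_self_eq_norm_sq]
  exact b.orthonormal.sum_inner_products_le x

theorem norm_basisProj_le_one : ‖basisProj b s‖ ≤ 1 := by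
  refine ContinuousLinearMap.opNorm_le_bound _ zero_le_one fun x => ?_
  rw [one_mul]
  refine le_of_sq_le_sq ?_ (norm_nonneg _)
  have h1 : ⟪basisProj b s x, basisProj b s x⟫_ℂ = ⟪x, basisProj b s x⟫_ℂ := by
    have := (basisProj_isSelfAdjoint b s).isSymmetric x (basisProj b s x)
    refine this.trans ?_
    change ⟪x, (basisProj b s * basisProj b s) x⟫_ℂ = _
    rw [basisProj_mul_self]
  rw [← re_inner_self_eq_norm_sq, h1, re_inner_basisProj]
  exact b.orthonormal.sum_inner_products_le x

theorem isLUB_basisProj : IsLUB (Set.range (basisProj b)) 1 := by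
  refine ⟨?_, fun B hB => ?_⟩
  · rintro _ ⟨s, rfl⟩
    exact basisProj_le_one b s
  -- The empty projection is 0, so an upper bound is positive.
  have hsa : IsSelfAdjoint B := by
    have h0 : basisProj b ∅ ≤ B := hB ⟨∅, rfl⟩
    rw [basisProj, Finset.sum_empty] at h0
    exact IsSelfAdjoint.of_nonneg h0
  refine le_of_re_inner_le (IsSelfAdjoint.one _) hsa fun x => ?_
  have h1 : HasSum (fun i => ‖⟪b i, x⟫_ℂ‖ ^ 2) (‖x‖ ^ 2) := by
    have h := Complex.hasSum_re (b.hasSum_inner_mul_inner x x)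
    rw [re_inner_self_eq_norm_sq] at h
    refine h.congr_fun fun i => ?_
    rw [← inner_conj_symm x (b i), mul_comm, Complex.mul_conj, Complex.normSq_eq_norm_sq,
      Complex.ofReal_re]
  rw [one_apply_eq_self, re_inner_self_eq_norm_sq]
  refine le_of_tendsto h1 (Filter.Eventually.of_forall fun s => ?_)
  have := re_inner_le_of_le (hB ⟨s, rfl⟩) x
  rwa [re_inner_basisProj] at this

theorem basisProj_mul_mul (A : H →L[ℂ] H) : basisProj b s * A * basisProj b s =
    ∑ i ∈ s, ∑ j ∈ s, ⟪b i, A (b j)⟫_ℂ • rankOne ℂ (b i) (b j) := by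
  simp only [basisProj, Finset.sum_mul, Finset.mul_sum]
  refine Finset.sum_comm.trans (Finset.sum_congr rfl fun i _ => Finset.sum_congr rfl fun j _ => ?_)
  rw [mul_assoc]
  have : A * rankOne ℂ (b j) (b j) = rankOne ℂ (A (b j)) (b j) :=
    InnerProductSpace.comp_rankOne _ _ A
  rw [this, rankOne_mul_rankOne]

end BasisProj

/-! ### Assembly of V x = ∑ b_i ⊗ p_i x and its comparison with Φ -/

section Assembly

variable {K : Type*} [NormedAddCommGroup K] [InnerProductSpace ℂ K] [CompleteSpace K]
  {Φ : (H →L[ℂ] H) →CP (H' →L[ℂ] H')} {ι : Type*} {b : HilbertBasis ι ℂ H} {p : ι → H' →L[ℂ] K}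

theorem CompletelyPositiveMap.re_inner_map_le (hsub : Φ 1 ≤ 1) {A : H →L[ℂ] H} (hA : A ≤ 1)
    (x : H') : (⟪x, Φ A x⟫_ℂ).re ≤ ‖x‖ ^ 2 := by
  refine (re_inner_le_of_le ((OrderHomClass.mono Φ hA).trans hsub) x).trans_eq ?_
  rw [one_apply_eq_self, re_inner_self_eq_norm_sq]

theorem inner_sum_tens_ampl
    (hp : ∀ i j x y, ⟪p i x, p j y⟫_ℂ = ⟪x, Φ (rankOne ℂ (b i) (b j)) y⟫_ℂ)
    (s : Finset ι) (A : H →L[ℂ] H) (x y : H') :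
    ⟪∑ i ∈ s, tens (b i) (p i x), ampl K A (∑ i ∈ s, tens (b i) (p i y))⟫_ℂ =
      ⟪x, Φ (basisProj b s * A * basisProj b s) y⟫_ℂ := by
  simp only [basisProj_mul_mul, map_sum, map_smul, sum_apply,
    smul_apply, inner_sum, sum_inner, ampl_tens, inner_tens, hp,
    inner_smul_right]
  exact Finset.sum_comm

theorem norm_sum_tens_sq
    (hp : ∀ i j x y, ⟪p i x, p j y⟫_ℂ = ⟪x, Φ (rankOne ℂ (b i) (b j)) y⟫_ℂ)
    (s : Finset ι) (x : H') :
    ‖∑ i ∈ s, tens (b i) (p i x)‖ ^ 2 = (⟪x, Φ (basisProj b s) x⟫_ℂ).re := by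
  have h := inner_sum_tens_ampl hp s 1 x x
  rw [ampl_one, mul_one, basisProj_mul_self] at h
  rw [← h, one_apply_eq_self, re_inner_self_eq_norm_sq]

/-- The terms are orthogonal, and the squared norm of a partial sum is ⟪x, Φ(P_s) x⟫ ≤ ‖x‖² for the
basis projection P_s. -/
theorem summable_tens (hsub : Φ 1 ≤ 1)
    (hp : ∀ i j x y, ⟪p i x, p j y⟫_ℂ = ⟪x, Φ (rankOne ℂ (b i) (b j)) y⟫_ℂ) (x : H') :
    Summable fun i => tens (b i) (p i x) := by
  let J : ι → K →ₗᵢ[ℂ] HTensor H K := fun i =>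
    ⟨(tensR K (b i) : K →ₗ[ℂ] HTensor H K), fun y => by
      change ‖tens (b i) y‖ = ‖y‖
      rw [norm_tens, b.orthonormal.1 i, one_mul]⟩
  have hJ : OrthogonalFamily ℂ (fun _ : ι => K) J := fun i j hij x y => by
    change ⟪tens (b i) x, tens (b j) y⟫_ℂ = 0
    rw [inner_tens, b.orthonormal.2 hij, zero_mul]
  have h1 := hJ.summable_iff_norm_sq_summable fun i => p i x
  refine h1.2 (summable_of_sum_le (c := ‖x‖ ^ 2) (fun _ => by positivity) fun s => ?_)
  rw [← hJ.norm_sum (fun i => p i x) s]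
  change ‖∑ i ∈ s, tens (b i) (p i x)‖ ^ 2 ≤ _
  rw [norm_sum_tens_sq hp]
  exact CompletelyPositiveMap.re_inner_map_le hsub (basisProj_le_one b s) x

theorem exists_hasSum_tens (hsub : Φ 1 ≤ 1)
    (hp : ∀ i j x y, ⟪p i x, p j y⟫_ℂ = ⟪x, Φ (rankOne ℂ (b i) (b j)) y⟫_ℂ) :
    ∃ V : H' →L[ℂ] HTensor H K, ∀ x, HasSum (fun i => tens (b i) (p i x)) (V x) := by
  have hs := fun x => (summable_tens hsub hp x).hasSum
  let V : H' →ₗ[ℂ] HTensor H K :=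
    { toFun := fun x => ∑' i, tens (b i) (p i x)
      map_add' := fun x y => by
        refine (((hs x).add (hs y)).congr_fun fun i => ?_).tsum_eq
        rw [map_add, ← tensR_apply, map_add]; rfl
      map_smul' := fun c x => by
        refine (((hs x).const_smul c).congr_fun fun i => ?_).tsum_eq
        rw [map_smul, ← tensR_apply, map_smul]; rfl }
  refine ⟨V.mkContinuous 1 fun x => ?_, hs⟩
  rw [one_mul]
  refine le_of_tendsto (hs x).norm (Filter.Eventually.of_forall fun s => ?_)
  refine le_of_sq_le_sq ?_ (norm_nonneg _)
  rw [norm_sum_tens_sq hp]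
  exact CompletelyPositiveMap.re_inner_map_le hsub (basisProj_le_one b s) x

/-- The forms of Φ(P_s) increase to that of V*V. By normality Φ(1) is the least upper bound of the
Φ(P_s), hence Φ(1) ≤ V*V, while Φ(P_s) ≤ Φ(1) gives the reverse inequality. -/
theorem tendsto_re_inner_map_basisProj (hnormal : IsNormalMap Φ)
    (hsub : Φ 1 ≤ 1) (hp : ∀ i j x y, ⟪p i x, p j y⟫_ℂ = ⟪x, Φ (rankOne ℂ (b i) (b j)) y⟫_ℂ)
    (x : H') : Filter.Tendsto (fun s => (⟪x, Φ (basisProj b s) x⟫_ℂ).re) Filter.atTop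
      (𝓝 (⟪x, Φ 1 x⟫_ℂ).re) := by
  classical
  obtain ⟨V, hV⟩ := exists_hasSum_tens hsub hp
  have hlim : ∀ x, Filter.Tendsto (fun s => (⟪x, Φ (basisProj b s) x⟫_ℂ).re) Filter.atTop
      (𝓝 (‖V x‖ ^ 2)) := fun x => by
    simp_rw [← norm_sum_tens_sq hp]
    exact (hV x).norm.pow 2
  have hmono : ∀ {s t : Finset ι}, s ⊆ t → Φ (basisProj b s) ≤ Φ (basisProj b t) := fun h =>
    OrderHomClass.mono Φ (basisProj_mono b h)
  have hLUB := hnormal (Set.range (basisProj b)) (Set.range_nonempty _) (by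
    rintro _ ⟨s, rfl⟩ _ ⟨t, rfl⟩
    exact ⟨_, ⟨s ∪ t, rfl⟩, basisProj_mono b Finset.subset_union_left,
      basisProj_mono b Finset.subset_union_right⟩) 1 (isLUB_basisProj b)
  have hsa : ∀ s, IsSelfAdjoint (Φ (basisProj b s)) := fun s => by
    have := Φ.map_star_mul (basisProj b s) (basisProj b s)
    rwa [(basisProj_isSelfAdjoint b s).star_eq, basisProj_mul_self] at this
  have hVV : ∀ x, (⟪x, ((ContinuousLinearMap.adjoint V).comp V) x⟫_ℂ).re = ‖V x‖ ^ 2 := fun x => by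
    rw [ContinuousLinearMap.comp_apply, ContinuousLinearMap.adjoint_inner_right,
      re_inner_self_eq_norm_sq]
  have hVsa : IsSelfAdjoint ((ContinuousLinearMap.adjoint V).comp V) := by
    rw [isSelfAdjoint_iff, ContinuousLinearMap.star_eq_adjoint, ContinuousLinearMap.adjoint_comp,
      ContinuousLinearMap.adjoint_adjoint]
  have hub : Φ 1 ≤ (ContinuousLinearMap.adjoint V).comp V := by
    refine hLUB.2 ?_
    rintro _ ⟨_, ⟨s, rfl⟩, rfl⟩
    refine le_of_re_inner_le (hsa s) hVsa fun x => ?_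
    rw [hVV]
    refine ge_of_tendsto (hlim x) ?_
    filter_upwards [Filter.eventually_ge_atTop s] with t ht
    exact re_inner_le_of_le (hmono ht) x
  have heq : ‖V x‖ ^ 2 = (⟪x, Φ 1 x⟫_ℂ).re := by
    refine le_antisymm ?_ ?_
    · refine le_of_tendsto (hlim x) (Filter.Eventually.of_forall fun s => ?_)
      exact re_inner_le_of_le (OrderHomClass.mono Φ (basisProj_le_one b s)) x
    · rw [← hVV]
      exact re_inner_le_of_le hub x
  rw [← heq]
  exact hlim x

/-- In the feature space, Φ(A) - Φ(PAP) splits into two inner products, each with a factor q(1 - P).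
The squared norm of q(1 - P)x is the form of Φ(1) - Φ(P) at x, which tends to 0. -/
theorem tendsto_inner_map_basisProj (hnormal : IsNormalMap Φ)
    (hsub : Φ 1 ≤ 1) (hp : ∀ i j x y, ⟪p i x, p j y⟫_ℂ = ⟪x, Φ (rankOne ℂ (b i) (b j)) y⟫_ℂ)
    (A : H →L[ℂ] H) (x y : H') :
    Filter.Tendsto (fun s => ⟪x, Φ (basisProj b s * A * basisProj b s) y⟫_ℂ) Filter.atTop
      (𝓝 ⟪x, Φ A y⟫_ℂ) := by
  obtain ⟨L, _, _, _, q, hq⟩ := Φ.exists_feature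
  have hq0 : ∀ x, Filter.Tendsto (fun s => ‖q (1 - basisProj b s) x‖) Filter.atTop (𝓝 0) := by
    intro x
    have h1 : ∀ s, ‖q (1 - basisProj b s) x‖ ^ 2 =
        (⟪x, Φ 1 x⟫_ℂ).re - (⟪x, Φ (basisProj b s) x⟫_ℂ).re := fun s => by
      rw [← re_inner_self_eq_norm_sq, hq, star_sub, star_one,
        (basisProj_isSelfAdjoint b s).star_eq, mul_sub, sub_mul, sub_mul, basisProj_mul_self]
      simp
    have h2 := ((tendsto_re_inner_map_basisProj hnormal hsub hp x).const_sub
      (⟪x, Φ 1 x⟫_ℂ).re).sqrt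
    simp_rw [← h1, sub_self, Real.sqrt_zero] at h2
    simpa using h2
  have hqb : ∀ (a : H →L[ℂ] H) (x : H'), ‖q a x‖ ≤ ‖a‖ * ‖x‖ := fun a x => by
    refine le_of_sq_le_sq ?_ (by positivity)
    have h1 : star a * a ≤ algebraMap ℝ _ (‖a‖ ^ 2) := CStarAlgebra.star_mul_le_algebraMap_norm_sq
    have h2 := re_inner_le_of_le (OrderHomClass.mono Φ h1) x
    have h3 : Φ (algebraMap ℝ (H →L[ℂ] H) (‖a‖ ^ 2)) = ((‖a‖ ^ 2 : ℝ) : ℂ) • Φ 1 := by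
      rw [← map_smul]
      congr 1
    rw [← re_inner_self_eq_norm_sq, hq, mul_pow]
    refine h2.trans ?_
    rw [h3, smul_apply, inner_smul_right, Complex.re_ofReal_mul]
    exact mul_le_mul_of_nonneg_left (CompletelyPositiveMap.re_inner_map_le hsub le_rfl x)
      (by positivity)
  rw [tendsto_iff_norm_sub_tendsto_zero]
  have hbound : ∀ s, ‖⟪x, Φ (basisProj b s * A * basisProj b s) y⟫_ℂ - ⟪x, Φ A y⟫_ℂ‖ ≤
      ‖q (1 - basisProj b s) x‖ * (‖A‖ * ‖y‖) + (‖A‖ * ‖x‖) * ‖q (1 - basisProj b s) y‖ := by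
    intro s
    set P := basisProj b s with hP
    have hPs : star P = P := (basisProj_isSelfAdjoint b s).star_eq
    have e1 : ⟪q (1 - P) x, q A y⟫_ℂ = ⟪x, Φ (A - P * A) y⟫_ℂ := by
      rw [hq, star_sub, star_one, hPs, sub_mul, one_mul]
    have e2 : ⟪q (star A * P) x, q (1 - P) y⟫_ℂ = ⟪x, Φ (P * A - P * A * P) y⟫_ℂ := by
      rw [hq, star_mul, star_star, hPs, mul_sub, mul_one]
    have e3 : ⟪x, Φ (P * A * P) y⟫_ℂ - ⟪x, Φ A y⟫_ℂ =
        -(⟪q (1 - P) x, q A y⟫_ℂ + ⟪q (star A * P) x, q (1 - P) y⟫_ℂ) := by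
      rw [e1, e2]
      simp only [map_sub, sub_apply, inner_sub_right]
      ring
    rw [e3, norm_neg]
    refine (norm_add_le _ _).trans (add_le_add ?_ ?_)
    · exact (norm_inner_le_norm _ _).trans
        (mul_le_mul_of_nonneg_left (hqb A y) (norm_nonneg _))
    · refine (norm_inner_le_norm _ _).trans
        (mul_le_mul_of_nonneg_right ((hqb _ x).trans ?_) (norm_nonneg _))
      refine mul_le_mul_of_nonneg_right ?_ (norm_nonneg _)
      refine (norm_mul_le _ _).trans ?_
      rw [norm_star]
      exact mul_le_of_le_one_right (norm_nonneg _) (norm_basisProj_le_one b s)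
  refine squeeze_zero (fun _ => norm_nonneg _) hbound ?_
  have := ((hq0 x).mul_const (‖A‖ * ‖y‖)).add ((hq0 y).const_mul (‖A‖ * ‖x‖))
  simpa using this

theorem exists_isStinespring_of_feature (hnormal : IsNormalMap Φ) (hsub : Φ 1 ≤ 1)
    (hp : ∀ i j x y, ⟪p i x, p j y⟫_ℂ = ⟪x, Φ (rankOne ℂ (b i) (b j)) y⟫_ℂ) :
    ∃ V : H' →L[ℂ] HTensor H K, IsStinespring Φ V := by
  obtain ⟨V, hV⟩ := exists_hasSum_tens hsub hp
  refine ⟨V, fun A => ?_⟩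
  ext y
  refine ext_inner_left ℂ fun x => ?_
  rw [ContinuousLinearMap.comp_apply, ContinuousLinearMap.adjoint_inner_right]
  refine tendsto_nhds_unique (tendsto_inner_map_basisProj hnormal hsub hp A x y) ?_
  simp_rw [← inner_sum_tens_ampl hp]
  exact (hV x).inner (((ampl K A).continuous.tendsto _).comp (hV y))

end Assembly

theorem exists_isStinespring [TopologicalSpace.SeparableSpace H]
    [TopologicalSpace.SeparableSpace H'] {Φ : (H →L[ℂ] H) →CP (H' →L[ℂ] H')}
    (hnormal : IsNormalMap Φ) (hsub : Φ 1 ≤ 1) {e : H} (he : ‖e‖ = 1) :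
    ∃ (K : Type w) (_ : NormedAddCommGroup K) (_ : InnerProductSpace ℂ K) (_ : CompleteSpace K)
      (_ : TopologicalSpace.SeparableSpace K) (V : H' →L[ℂ] HTensor H K), IsStinespring Φ V := by
  obtain ⟨K, _, _, _, _, p, hp⟩ := Φ.exists_feature_basis he (onb H)
  obtain ⟨V, hV⟩ := exists_isStinespring_of_feature hnormal hsub hp
  exact ⟨K, _, _, inferInstance, inferInstance, V, hV⟩

end StinespringExistence

/-! ## The predual map and the output energy -/

section OutputEnergy

variable {H H' : Type*} [NormedAddCommGroup H] [InnerProductSpace ℂ H] [CompleteSpace H]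
  [NormedAddCommGroup H'] [InnerProductSpace ℂ H'] [CompleteSpace H']
  {K : Type*} [NormedAddCommGroup K] [InnerProductSpace ℂ K] [CompleteSpace K]
  {Φ : (H →L[ℂ] H) →CP (H' →L[ℂ] H')} {V : H' →L[ℂ] HTensor H K}

theorem IsStinespring.inner_map (hV : IsStinespring Φ V) (A : H →L[ℂ] H) (x y : H') :
    ⟪x, Φ A y⟫_ℂ = ⟪V x, ampl K A (V y)⟫_ℂ := by
  rw [hV A, ContinuousLinearMap.comp_apply, ContinuousLinearMap.adjoint_inner_right]
  rfl

theorem IsStinespring.norm_map_one (hV : IsStinespring Φ V) : ‖Φ 1‖ = ‖V‖ ^ 2 := by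
  have h : Φ 1 = (ContinuousLinearMap.adjoint V).comp V := by
    rw [hV 1, ampl_one]; rfl
  rw [h, ContinuousLinearMap.norm_adjoint_comp_self, sq]

theorem IsStinespring.norm_apply_le (hV : IsStinespring Φ V) (hsub : Φ 1 ≤ 1) (x : H') :
    ‖V x‖ ≤ ‖x‖ := by
  refine le_of_sq_le_sq ?_ (norm_nonneg _)
  have h := hV.inner_map 1 x x
  rw [ampl_one, one_apply_eq_self] at h
  rw [← re_inner_self_eq_norm_sq, ← h]
  exact CompletelyPositiveMap.re_inner_map_le hsub le_rfl x

theorem IsStinespring.enorm_apply_sq_le (hV : IsStinespring Φ V) (hsub : Φ 1 ≤ 1) (x : H') :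
    ‖V x‖ₑ ^ 2 ≤ ‖x‖ₑ ^ 2 := by
  refine pow_le_pow_left₀ zero_le ?_ 2
  rw [← ofReal_norm, ← ofReal_norm]
  exact ENNReal.ofReal_le_ofReal (hV.norm_apply_le hsub x)

theorem IsStinespring.enorm_adjoint_sq_le (hV : IsStinespring Φ V) (η : HTensor H K) :
    ‖ContinuousLinearMap.adjoint V η‖ₑ ^ 2 ≤ ENNReal.ofReal ‖Φ 1‖ * ‖η‖ₑ ^ 2 := by
  rw [hV.norm_map_one, ← ofReal_norm_sq_eq_enorm_sq, ← ofReal_norm_sq_eq_enorm_sq,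
    ← ENNReal.ofReal_mul (by positivity), ← mul_pow]
  refine ENNReal.ofReal_le_ofReal (pow_le_pow_left₀ (norm_nonneg _) ?_ 2)
  refine (ContinuousLinearMap.le_opNorm _ _).trans_eq ?_
  rw [LinearIsometryEquiv.norm_map]

variable {κ : Type*} (f : HilbertBasis κ ℂ K)

theorem tsum_enorm_slice {ι : Type*} (φ : ι → H') :
    ∑' p : ι × κ, ‖slice (f p.2) (V (φ p.1))‖ₑ ^ 2 = ∑' i, ‖V (φ i)‖ₑ ^ 2 := by
  rw [ENNReal.tsum_prod (f := fun i k => ‖slice (f k) (V (φ i))‖ₑ ^ 2)]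
  simp_rw [← enorm_sq_eq_tsum_slice f]

/-- The vectors `V_k φ_i` decompose the image of `∑ᵢ |φᵢ⟩⟨φᵢ|` under the predual map. -/
theorem IsStinespring.decomposes_predual (hV : IsStinespring Φ V) {ι : Type*} {φ : ι → H'}
    {ρ : H' →L[ℂ] H'} (hρ : ρ.IsPositive) (hd : Decomposes φ ρ) (h1 : ∑' i, ‖φ i‖ₑ ^ 2 ≠ ⊤) :
    (predual Φ ρ).IsPositive ∧
      Decomposes (fun p : ι × κ => slice (f p.2) (V (φ p.1))) (predual Φ ρ) := by
  have h2 : ∑' p : ι × κ, ‖slice (f p.2) (V (φ p.1))‖ₑ ^ 2 ≠ ⊤ := by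
    rw [tsum_enorm_slice]
    exact tsum_enorm_clm_ne_top h1 V
  obtain ⟨σ, hσ, hdσ⟩ := exists_decomposes h2
  -- Both traces are computed from their decompositions; they agree because ⟪V x, (A ⊗ I) V x⟫ is
  -- the sum over k of ⟪V_k x, A V_k x⟫.
  have htr : ∀ A : H →L[ℂ] H, opTrace (σ * A) = opTrace (Φ A * ρ) := fun A => by
    rw [hdσ.opTrace_mul_right hσ h2, hd.opTrace_mul_left hρ h1]
    have hs : Summable fun p : ι × κ =>
        ⟪slice (f p.2) (V (φ p.1)), A (slice (f p.2) (V (φ p.1)))⟫_ℂ := by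
      refine Summable.of_norm_bounded
        ((summable_norm_sq_of_tsum_enorm_ne_top h2).mul_left ‖A‖) fun p => ?_
      refine (norm_inner_le_norm _ _).trans ?_
      nlinarith [A.le_opNorm (slice (f p.2) (V (φ p.1))),
        norm_nonneg (slice (f p.2) (V (φ p.1)))]
    rw [hs.tsum_prod]
    refine tsum_congr fun i => ?_
    rw [hV.inner_map, ← (hasSum_inner_slice f _ _).tsum_eq]
    simp_rw [slice_ampl]
  have hex : ∃ σ : H →L[ℂ] H, IsPosTraceClass σ ∧
      ∀ A : H →L[ℂ] H, opTrace (σ * A) = opTrace (Φ A * ρ) :=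
    ⟨σ, ⟨hσ, by rwa [hdσ.posTrace_eq]⟩, htr⟩
  have heq : predual Φ ρ = σ := by
    rw [predual, dif_pos hex]
    exact eq_of_opTrace_mul_eq fun A => (hex.choose_spec.2 A).trans (htr A).symm
  rw [heq]
  exact ⟨hσ, hdσ⟩

/-- The energy `∑ₖ ‖√G V_k x‖²` of the image of `|x⟩⟨x|`. -/
def outForm (G : PosOp H) (V : H' →L[ℂ] HTensor H K) (x : H') : ℝ≥0∞ :=
  ∑' k, sqNormOp G.sqrt.op (slice (f k) (V x))

theorem outForm_sqrt_smul (G : PosOp H) {t : ℝ≥0} (ht : t ≠ 0) (x : H') :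
    outForm f G V (((NNReal.sqrt t : ℝ) : ℂ) • x) = t * outForm f G V x := by
  simp_rw [outForm, map_smul, sqNormOp_sqrt_smul _ ht, ENNReal.tsum_mul_left]

theorem tsum_sqNormOp_slice (G : PosOp H) {ι : Type*} (φ : ι → H') :
    ∑' p : ι × κ, sqNormOp G.sqrt.op (slice (f p.2) (V (φ p.1))) = ∑' i, outForm f G V (φ i) :=
  ENNReal.tsum_prod (f := fun i k => sqNormOp G.sqrt.op (slice (f k) (V (φ i))))

theorem IsStinespring.energy_predual (hV : IsStinespring Φ V) (G : PosOp H) {ι : Type*}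
    {φ : ι → H'} {ρ : H' →L[ℂ] H'} (hρ : ρ.IsPositive) (hd : Decomposes φ ρ)
    (h1 : ∑' i, ‖φ i‖ₑ ^ 2 ≠ ⊤) :
    G.energy (predual Φ ρ) = ∑' i, outForm f G V (φ i) := by
  obtain ⟨h2, h3⟩ := hV.decomposes_predual f hρ hd h1
  rw [h3.energy_eq h2, tsum_sqNormOp_slice]

variable {G : PosOp H} {G' : PosOp H'}

theorem exists_isState {ι : Type*} {φ : ι → H'} (h1 : ∑' i, ‖φ i‖ₑ ^ 2 = 1) :
    ∃ ρ : H' →L[ℂ] H', IsState ρ ∧ Decomposes φ ρ := by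
  obtain ⟨ρ, hρ, hd⟩ := exists_decomposes (ψ := φ) (by rw [h1]; exact ENNReal.one_ne_top)
  exact ⟨ρ, ⟨hρ, by rw [hd.posTrace_eq, h1]⟩, hd⟩

theorem IsLimited.tsum_outForm_ne_top (hL : IsLimited G G' Φ) (hV : IsStinespring Φ V)
    {ι : Type*} {φ : ι → H'} (h1 : ∑' i, ‖φ i‖ₑ ^ 2 = 1)
    (hS : ∑' i, sqNormOp G'.sqrt.op (φ i) ≠ ⊤) : ∑' i, outForm f G V (φ i) ≠ ⊤ := by
  obtain ⟨ρ, hρ, hd⟩ := exists_isState h1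
  have h := hL ρ hρ (by rw [hd.energy_eq hρ.1]; exact hS.lt_top)
  rw [hV.energy_predual f G hρ.1 hd (by rw [h1]; exact ENNReal.one_ne_top)] at h
  exact h.ne

theorem IsStinespring.isLimited (hV : IsStinespring Φ V)
    (h : ∀ φ : onbIndex H' → H', ∑' i, ‖φ i‖ₑ ^ 2 = 1 →
      ∑' i, sqNormOp G'.sqrt.op (φ i) ≠ ⊤ → ∑' i, outForm f G V (φ i) ≠ ⊤) :
    IsLimited G G' Φ := by
  intro ρ hρ hE
  have hd := decomposes_sqrt hρ.1
  have h1 : ∑' i, ‖CFC.sqrt ρ (onb H' i)‖ₑ ^ 2 = 1 := by rw [← hd.posTrace_eq, hρ.2]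
  rw [hV.energy_predual f G hρ.1 hd (by rw [h1]; exact ENNReal.one_ne_top)]
  exact (h _ h1 hE.ne).lt_top

theorem IsStinespring.tsum_outForm_le_of_eq_one (hV : IsStinespring Φ V) {E : ℝ≥0}
    {ι : Type*} {φ : ι → H'} (h1 : ∑' i, ‖φ i‖ₑ ^ 2 = 1)
    (hE : ∑' i, sqNormOp G'.sqrt.op (φ i) ≤ E) :
    ∑' i, outForm f G V (φ i) ≤ outEnergy G G' Φ E := by
  obtain ⟨ρ, hρ, hd⟩ := exists_isState h1
  rw [← hV.energy_predual f G hρ.1 hd (by rw [h1]; exact ENNReal.one_ne_top)]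
  exact le_iSup₂_of_le ρ hρ (le_iSup_of_le (by rw [hd.energy_eq hρ.1]; exact hE) le_rfl)

theorem IsStinespring.outEnergy_le (hV : IsStinespring Φ V) {E : ℝ≥0} {c : ℝ≥0∞}
    (h : ∀ φ : onbIndex H' → H', ∑' i, ‖φ i‖ₑ ^ 2 = 1 →
      ∑' i, sqNormOp G'.sqrt.op (φ i) ≤ E → ∑' i, outForm f G V (φ i) ≤ c) :
    outEnergy G G' Φ E ≤ c := by
  refine iSup_le fun ρ => iSup₂_le fun hρ hE => ?_
  have hd := decomposes_sqrt hρ.1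
  have h1 : ∑' i, ‖CFC.sqrt ρ (onb H' i)‖ₑ ^ 2 = 1 := by rw [← hd.posTrace_eq, hρ.2]
  rw [hV.energy_predual f G hρ.1 hd (by rw [h1]; exact ENNReal.one_ne_top)]
  exact h _ h1 hE

/-- Scaling by t < 1 leaves energy to spare for a completing vector, whose nonnegative output energy
is discarded; then t tends to 1. -/
theorem IsStinespring.tsum_outForm_le (hV : IsStinespring Φ V) (hG' : G'.InfZero) {E : ℝ≥0}
    (hE0 : 0 < E) {ι : Type*} {φ : ι → H'} (h1 : ∑' i, ‖φ i‖ₑ ^ 2 ≤ 1)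
    (hE : ∑' i, sqNormOp G'.sqrt.op (φ i) ≤ E) :
    ∑' i, outForm f G V (φ i) ≤ outEnergy G G' Φ E := by
  refine ENNReal.le_of_forall_lt_one_mul_le fun t ht => ?_
  lift t to ℝ≥0 using ne_top_of_lt ht
  rcases eq_or_ne t 0 with rfl | ht0
  · simp
  have htE : (t : ℝ≥0∞) * ∑' i, sqNormOp G'.sqrt.op (φ i) < E := by
    calc (t : ℝ≥0∞) * ∑' i, sqNormOp G'.sqrt.op (φ i) ≤ t * E := by gcongr
      _ < 1 * E := by
        have hE0' : (E : ℝ≥0∞) ≠ 0 := by simpa using hE0.ne'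
        gcongr
        exact ENNReal.coe_ne_top
      _ = E := one_mul _
  obtain ⟨χ, hχ1, hχ2⟩ := hG'.exists_normalized (E := E)
    (ψ := fun i => ((NNReal.sqrt t : ℝ) : ℂ) • φ i)
    (by simp_rw [enorm_sqrt_smul]; rw [ENNReal.tsum_mul_left]; exact mul_le_one' ht.le h1)
    (by simp_rw [sqNormOp_sqrt_smul _ ht0]; rwa [ENNReal.tsum_mul_left])
  refine le_trans ?_ (hV.tsum_outForm_le_of_eq_one f hχ1 hχ2)
  rw [PosOp.tsum_sumElim (outForm f G V)]
  simp_rw [outForm_sqrt_smul f G ht0]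
  rw [ENNReal.tsum_mul_left]
  exact le_self_add

/-- The output energy of a limited map is bounded on every set of states of bounded energy. -/
theorem IsLimited.outEnergy_lt_top (hL : IsLimited G G' Φ) (hV : IsStinespring Φ V) (E : ℝ≥0) :
    outEnergy G G' Φ E < ⊤ := by
  obtain ⟨s, f, -⟩ := exists_hilbertBasis ℂ K
  by_contra htop
  rw [not_lt, top_le_iff] at htop
  have hex : ∀ n : ℕ, ∃ φ : onbIndex H' → H', ∑' i, ‖φ i‖ₑ ^ 2 = 1 ∧
      ∑' i, sqNormOp G'.sqrt.op (φ i) ≤ E ∧ 2 ^ (n + 1) ≤ ∑' i, outForm f G V (φ i) := by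
    intro n
    by_contra! hcon
    have h := hV.outEnergy_le f fun φ h1 h2 => (hcon φ h1 h2).le
    rw [htop, top_le_iff] at h
    exact ENNReal.pow_ne_top ENNReal.ofNat_ne_top h
  choose φ h1 h2 h3 using hex
  -- The weights sum to 1, so the mixture is a state of energy at most E, yet every component
  -- contributes at least 2^{-(n+1)} · 2^{n+1} = 1 to the output energy.
  let t : ℕ → ℝ≥0 := fun n => (2⁻¹) ^ (n + 1)
  have ht0 : ∀ n, t n ≠ 0 := fun n => pow_ne_zero _ (by norm_num)
  have htsum : ∑' n, (t n : ℝ≥0∞) = 1 := by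
    have h := ENNReal.tsum_geometric_add_one 2⁻¹
    simp only [t, ENNReal.coe_pow, ENNReal.coe_inv_two]
    rw [h, ENNReal.one_sub_inv_two, inv_inv]
    exact ENNReal.inv_mul_cancel two_ne_zero ENNReal.ofNat_ne_top
  let ψ : ℕ × onbIndex H' → H' := fun p => ((NNReal.sqrt (t p.1) : ℝ) : ℂ) • φ p.1 p.2
  have hψ : ∀ g : H' → ℝ≥0∞, (∀ n x, g (((NNReal.sqrt (t n) : ℝ) : ℂ) • x) = t n * g x) →
      ∑' p, g (ψ p) = ∑' n, t n * ∑' i, g (φ n i) := fun g hg => by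
    rw [ENNReal.tsum_prod (f := fun n i => g (((NNReal.sqrt (t n) : ℝ) : ℂ) • φ n i))]
    simp_rw [hg, ENNReal.tsum_mul_left]
  refine hL.tsum_outForm_ne_top f hV (φ := ψ) ?_ ?_ ?_
  · rw [hψ (fun x => ‖x‖ₑ ^ 2) fun n x => enorm_sqrt_smul _ _]
    simp_rw [h1, mul_one]
    exact htsum
  · rw [hψ (sqNormOp G'.sqrt.op) fun n x => sqNormOp_sqrt_smul _ (ht0 n) _]
    refine ne_top_of_le_ne_top (b := (E : ℝ≥0∞)) ENNReal.coe_ne_top ?_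
    calc ∑' n, t n * ∑' i, sqNormOp G'.sqrt.op (φ n i) ≤ ∑' n, (t n : ℝ≥0∞) * E :=
          ENNReal.tsum_le_tsum fun n => by gcongr; exact h2 n
      _ = E := by rw [ENNReal.tsum_mul_right, htsum, one_mul]
  · rw [hψ (outForm f G V) fun n x => outForm_sqrt_smul f G (ht0 n) _, ← top_le_iff]
    have htop1 : (⊤ : ℝ≥0∞) = ∑' _ : ℕ, 1 := by
      rw [ENNReal.tsum_const_eq_top_of_ne_zero one_ne_zero]
    rw [htop1]
    refine ENNReal.tsum_le_tsum fun n => ?_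
    calc (1 : ℝ≥0∞) = t n * 2 ^ (n + 1) := by
          simp only [t, ENNReal.coe_pow, ENNReal.coe_inv_two]
          rw [← mul_pow, ENNReal.inv_mul_cancel two_ne_zero ENNReal.ofNat_ne_top, one_pow]
      _ ≤ _ := by gcongr; exact h3 n

/-- Multiplying a state by E/F ≤ 1 lowers its energy bound from F to E and leaves it subnormalized.
In other words, Y_Φ(E)/E is nonincreasing. -/
theorem IsStinespring.outEnergy_le_mul (hV : IsStinespring Φ V) (hG' : G'.InfZero) {E F : ℝ≥0}
    (hE : 0 < E) (hEF : E ≤ F) :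
    ((E / F : ℝ≥0) : ℝ≥0∞) * outEnergy G G' Φ F ≤ outEnergy G G' Φ E := by
  obtain ⟨s, f, -⟩ := exists_hilbertBasis ℂ K
  have hF : 0 < F := hE.trans_le hEF
  set t : ℝ≥0 := E / F with ht
  have ht0 : t ≠ 0 := (div_pos hE hF).ne'
  have ht1 : t ≤ 1 := div_le_one_of_le₀ hEF zero_le
  have hle : outEnergy G G' Φ F ≤ outEnergy G G' Φ E / t := by
    refine hV.outEnergy_le f fun φ h1 hF' => ?_
    rw [ENNReal.le_div_iff_mul_le (.inl (by simpa using ht0)) (.inl ENNReal.coe_ne_top), mul_comm,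
      ← ENNReal.tsum_mul_left]
    simp_rw [← outForm_sqrt_smul f G ht0]
    refine hV.tsum_outForm_le f hG' hE ?_ ?_
    · simp_rw [enorm_sqrt_smul]
      rw [ENNReal.tsum_mul_left, h1, mul_one]
      exact_mod_cast ht1
    · simp_rw [sqNormOp_sqrt_smul _ ht0]
      rw [ENNReal.tsum_mul_left]
      calc (t : ℝ≥0∞) * ∑' i, sqNormOp G'.sqrt.op (φ i) ≤ t * F := by gcongr
        _ = E := by rw [← ENNReal.coe_mul, ht, div_mul_cancel₀ _ hF.ne']
  rwa [ENNReal.le_div_iff_mul_le (.inl (by simpa using ht0)) (.inl ENNReal.coe_ne_top),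
    mul_comm] at hle

/-- The output energy of a single vector. -/
theorem IsStinespring.outForm_le (hV : IsStinespring Φ V) (hG' : G'.InfZero) {E : ℝ≥0}
    (hE : 0 < E) (x : G'.sqrt.op.domain) :
    outForm f G V (x : H') ≤
      outEnergy G G' Φ E * ENNReal.ofReal (‖(x : H')‖ ^ 2 + ‖G'.sqrt.op x‖ ^ 2 / E) := by
  rcases eq_or_ne x 0 with rfl | hx
  · simp [outForm, sqNormOp_zero]
  have hx' : 0 < ‖(x : H')‖ := by simpa using hx
  have hE' : (0 : ℝ) < E := hE
  set N : ℝ := ‖(x : H')‖ ^ 2 + ‖G'.sqrt.op x‖ ^ 2 / E with hN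
  have hNpos : 0 < N := by positivity
  let t : ℝ≥0 := ⟨N⁻¹, by positivity⟩
  have ht0 : t ≠ 0 := fun h0 => by
    have : N⁻¹ = 0 := congrArg NNReal.toReal h0
    exact (inv_ne_zero hNpos.ne') this
  have htE : (t : ℝ≥0∞) = ENNReal.ofReal N⁻¹ := (ENNReal.ofReal_coe_nnreal (p := t)).symm
  have key := hV.tsum_outForm_le (ι := Unit) (G := G) f hG' hE
    (φ := fun _ => ((NNReal.sqrt t : ℝ) : ℂ) • (x : H'))
  simp only [tsum_fintype, Finset.univ_unique, Finset.sum_singleton, enorm_sqrt_smul] at key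
  simp only [outForm_sqrt_smul f G ht0, sqNormOp_sqrt_smul _ ht0, sqNormOp_of_mem x.2,
    ← ofReal_norm_sq_eq_enorm_sq, htE] at key
  rw [← ENNReal.ofReal_mul (by positivity), ← ENNReal.ofReal_mul (by positivity)] at key
  have h1 := key (by
      rw [ENNReal.ofReal_le_one, inv_mul_le_iff₀ hNpos, mul_one, hN]
      exact le_add_of_nonneg_right (by positivity)) (by
      rw [← ENNReal.ofReal_coe_nnreal]
      refine ENNReal.ofReal_le_ofReal ?_
      rw [inv_mul_le_iff₀ hNpos, hN, add_mul, div_mul_cancel₀ _ hE'.ne']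
      exact le_add_of_nonneg_left (by positivity))
  rw [ENNReal.ofReal_inv_of_pos hNpos, mul_comm, ← div_eq_mul_inv] at h1
  rwa [ENNReal.div_le_iff (by simpa using hNpos) ENNReal.ofReal_ne_top] at h1

end OutputEnergy

/-! ## The induced map between spaces of relatively bounded operators -/

section Induced

variable {H H' : Type*} [NormedAddCommGroup H] [InnerProductSpace ℂ H] [CompleteSpace H]
  [NormedAddCommGroup H'] [InnerProductSpace ℂ H'] [CompleteSpace H']
  {K : Type*} [NormedAddCommGroup K] [InnerProductSpace ℂ K] [CompleteSpace K]
  {Φ : (H →L[ℂ] H) →CP (H' →L[ℂ] H')} {V : H' →L[ℂ] HTensor H K}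
  {G : PosOp H} {G' : PosOp H'}

theorem IsAmplExtension.add {A B : G.BG} {T T' : (amplPMap K G.sqrt.op).domain →ₗ[ℂ] HTensor H K}
    (hT : IsAmplExtension G.sqrt.op A.1 T) (hT' : IsAmplExtension G.sqrt.op B.1 T') :
    IsAmplExtension G.sqrt.op (A + B).1 (T + T') := by
  refine ⟨(relBoundedOps (amplPMap K G.sqrt.op)).add_mem hT.1 hT'.1, fun x y h => ?_⟩
  have e : (A + B).1 x = A.1 x + B.1 x := rfl
  rw [LinearMap.add_apply, hT.2, hT'.2, e, ← tensL_apply, ← tensL_apply, ← tensL_apply, map_add]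

theorem IsAmplExtension.smul {A : G.BG} {T : (amplPMap K G.sqrt.op).domain →ₗ[ℂ] HTensor H K}
    (c : ℂ) (hT : IsAmplExtension G.sqrt.op A.1 T) :
    IsAmplExtension G.sqrt.op (c • A).1 (c • T) := by
  refine ⟨(relBoundedOps (amplPMap K G.sqrt.op)).smul_mem c hT.1, fun x y h => ?_⟩
  have e : (c • A).1 x = c • A.1 x := rfl
  rw [LinearMap.smul_apply, hT.2, e, ← tensL_apply, ← tensL_apply, map_smul]

theorem isAmplExtension_incl (A : H →L[ℂ] H) : IsAmplExtension G.sqrt.op (G.incl A).1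
    (boundedRestrict (amplPMap K G.sqrt.op) (ampl K A)).1 :=
  ⟨(boundedRestrict (amplPMap K G.sqrt.op) (ampl K A)).2, fun x y _ => ampl_tens A (x : H) y⟩

/-- The norm of an amplified operator in terms of the slices. -/
theorem IsAmplExtension.enorm_sq_eq {κ : Type*} (f : HilbertBasis κ ℂ K) {A : G.BG}
    {T : (amplPMap K G.sqrt.op).domain →ₗ[ℂ] HTensor H K} (hT : IsAmplExtension G.sqrt.op A.1 T)
    (ξ : (amplPMap K G.sqrt.op).domain) :
    ‖T ξ‖ₑ ^ 2 = ∑' k, sqNormOp (G.toPMap A) (slice (f k) (ξ : HTensor H K)) := by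
  obtain ⟨T', hT', hsl⟩ := exists_amplExtension f G A
  obtain rfl := hT.unique G.sqrt hT'
  rw [enorm_sq_eq_tsum_slice f]
  refine tsum_congr fun k => ?_
  have hm := LinearPMap.mem_domain_of_mem_graph (slice_mem_domain G.sqrt ξ (f k))
  rw [sqNormOp_of_mem (A := G.toPMap A) hm, hsl]
  rfl

theorem IsLimited.mem_amplPMap_domain (hL : IsLimited G G' Φ) (hV : IsStinespring Φ V)
    (hG' : G'.InfZero) (x : G'.sqrt.op.domain) : V (x : H') ∈ (amplPMap K G.sqrt.op).domain := by
  obtain ⟨s, f, -⟩ := exists_hilbertBasis ℂ K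
  exact _root_.mem_amplPMap_domain f G.sqrt (ne_top_of_le_ne_top
    (ENNReal.mul_ne_top (hL.outEnergy_lt_top hV 1).ne ENNReal.ofReal_ne_top)
    (hV.outForm_le f hG' one_pos x))

/-- The relative bound of `V* (A ⊗ I) V`. -/
theorem IsLimited.norm_adjoint_sq_le (hL : IsLimited G G' Φ) (hV : IsStinespring Φ V)
    (hsub : Φ 1 ≤ 1) (hG' : G'.InfZero) {A : G.BG}
    {T : (amplPMap K G.sqrt.op).domain →ₗ[ℂ] HTensor H K} (hT : IsAmplExtension G.sqrt.op A.1 T)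
    {a b : ℝ} (hA : RelBoundWith G.sqrt.op A.1 a b) {E : ℝ≥0} (hE : 0 < E)
    (x : G'.sqrt.op.domain) (hx : V (x : H') ∈ (amplPMap K G.sqrt.op).domain) :
    ‖ContinuousLinearMap.adjoint V (T ⟨V (x : H'), hx⟩)‖ ^ 2 ≤
      √(‖Φ 1‖ * (a ^ 2 + b ^ 2 * (outEnergy G G' Φ E).toReal)) ^ 2 * ‖(x : H')‖ ^ 2 +
      (√((outEnergy G G' Φ E).toReal / E * ‖Φ 1‖) * b) ^ 2 * ‖G'.sqrt.op x‖ ^ 2 := by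
  obtain ⟨s, f, -⟩ := exists_hilbertBasis ℂ K
  set y := (outEnergy G G' Φ E).toReal with hy
  have hyE : outEnergy G G' Φ E = ENNReal.ofReal y :=
    (ENNReal.ofReal_toReal (hL.outEnergy_lt_top hV E).ne).symm
  have hy0 : 0 ≤ y := ENNReal.toReal_nonneg
  have hm : ∀ k, slice (f k) (V (x : H')) ∈ G.sqrt.op.domain := fun k =>
    LinearPMap.mem_domain_of_mem_graph (slice_mem_domain G.sqrt ⟨_, hx⟩ (f k))
  have h1 : ‖T ⟨V (x : H'), hx⟩‖ₑ ^ 2 ≤ ENNReal.ofReal (a ^ 2) * ‖(x : H')‖ₑ ^ 2 +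
      ENNReal.ofReal (b ^ 2) * outForm f G V (x : H') := by
    rw [hT.enorm_sq_eq f]
    calc ∑' k, sqNormOp (G.toPMap A) (slice (f k) (V (x : H')))
        ≤ ∑' k, (ENNReal.ofReal (a ^ 2) * ‖slice (f k) (V (x : H'))‖ₑ ^ 2 +
            ENNReal.ofReal (b ^ 2) * sqNormOp G.sqrt.op (slice (f k) (V (x : H')))) := by
          refine ENNReal.tsum_le_tsum fun k => ?_
          rw [sqNormOp_of_mem (A := G.toPMap A) (hm k), sqNormOp_of_mem (hm k)]
          simp_rw [← ofReal_norm_sq_eq_enorm_sq]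
          rw [← ENNReal.ofReal_mul (by positivity), ← ENNReal.ofReal_mul (by positivity),
            ← ENNReal.ofReal_add (by positivity) (by positivity)]
          exact ENNReal.ofReal_le_ofReal (hA ⟨_, hm k⟩)
      _ = ENNReal.ofReal (a ^ 2) * ‖V (x : H')‖ₑ ^ 2 +
            ENNReal.ofReal (b ^ 2) * outForm f G V (x : H') := by
          rw [ENNReal.tsum_add, ENNReal.tsum_mul_left, ENNReal.tsum_mul_left,
            ← enorm_sq_eq_tsum_slice f]
          rfl
      _ ≤ _ := by
          exact add_le_add_left (mul_le_mul_right (hV.enorm_apply_sq_le hsub x) _) _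
  have h2 := (hV.enorm_adjoint_sq_le _).trans (mul_le_mul_right (h1.trans
    (add_le_add_right (mul_le_mul_right (hV.outForm_le f hG' hE x) _) _)) (ENNReal.ofReal ‖Φ 1‖))
  rw [hyE, ← ofReal_norm_sq_eq_enorm_sq, ← ofReal_norm_sq_eq_enorm_sq,
    ← ENNReal.ofReal_mul hy0, ← ENNReal.ofReal_mul (by positivity),
    ← ENNReal.ofReal_mul (by positivity), ← ENNReal.ofReal_add (by positivity) (by positivity),
    ← ENNReal.ofReal_mul (by positivity), ENNReal.ofReal_le_ofReal_iff (by positivity)] at h2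
  rw [Real.sq_sqrt (by positivity), mul_pow, Real.sq_sqrt (by positivity)]
  refine h2.trans_eq ?_
  ring

theorem IsLimited.exists_isInducedBy (hL : IsLimited G G' Φ) (hV : IsStinespring Φ V)
    (hsub : Φ 1 ≤ 1) (hG' : G'.InfZero) : ∃ Ψ : G.BG →ₗ[ℂ] G'.BG, IsInducedBy G G' V Ψ := by
  obtain ⟨s, f, -⟩ := exists_hilbertBasis ℂ K
  choose T hT _ using fun A : G.BG => exists_amplExtension f G A
  have hm := hL.mem_amplPMap_domain hV hG'
  have hTadd : ∀ A B, T (A + B) = T A + T B := fun A B =>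
    (hT (A + B)).unique G.sqrt ((hT A).add (hT B))
  have hTsmul : ∀ (c : ℂ) A, T (c • A) = c • T A := fun c A =>
    (hT (c • A)).unique G.sqrt ((hT A).smul c)
  let W : G'.sqrt.op.domain →ₗ[ℂ] (amplPMap K G.sqrt.op).domain :=
    LinearMap.codRestrict _ ((V : H' →ₗ[ℂ] HTensor H K).domRestrict _) hm
  let Ψ : G.BG →ₗ[ℂ] G'.BG :=
    { toFun := fun A => ⟨(ContinuousLinearMap.adjoint V : HTensor H K →ₗ[ℂ] H') ∘ₗ T A ∘ₗ W, by
        obtain ⟨a, b, -, hb, hA⟩ := A.2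
        exact ⟨_, _, Real.sqrt_nonneg _, by positivity, fun x =>
          hL.norm_adjoint_sq_le hV hsub hG' (hT A) hA one_pos x (hm x)⟩⟩
      map_add' := fun A B => by
        ext x
        simp [hTadd]
      map_smul' := fun c A => by
        ext x
        simp [hTsmul] }
  exact ⟨Ψ, fun A => ⟨T A, hT A, fun x => ⟨hm x, rfl⟩⟩⟩

/-- The approximants involve only Φ on bounded operators, so the limit cannot depend on V. -/
theorem IsInducedBy.tendsto (hV : IsStinespring Φ V) {Ψ : G.BG →ₗ[ℂ] G'.BG}
    (hΨ : IsInducedBy G G' V Ψ) (A : G.BG) (x : G'.sqrt.op.domain) :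
    Filter.Tendsto (fun n => Φ (G.cutoff A n) (x : H')) Filter.atTop (𝓝 ((Ψ A).1 x)) := by
  obtain ⟨T, hT, h⟩ := hΨ A
  obtain ⟨hx, he⟩ := h x
  rw [he]
  simp_rw [fun n => hV (G.cutoff A n)]
  exact ((ContinuousLinearMap.adjoint V).continuous.tendsto _).comp
    (tendsto_ampl_cutoff G A hT ⟨_, hx⟩)

/-- The induced map does not depend on the Stinespring representation. -/
theorem IsInducedBy.eq {K' : Type*} [NormedAddCommGroup K'] [InnerProductSpace ℂ K']
    [CompleteSpace K'] {V' : H' →L[ℂ] HTensor H K'} (hV : IsStinespring Φ V)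
    (hV' : IsStinespring Φ V') {Ψ Ψ' : G.BG →ₗ[ℂ] G'.BG} (hΨ : IsInducedBy G G' V Ψ)
    (hΨ' : IsInducedBy G G' V' Ψ') : Ψ = Ψ' := by
  ext A x
  exact tendsto_nhds_unique (hΨ.tendsto hV A x) (hΨ'.tendsto hV' A x)

theorem IsInducedBy.map_incl (hV : IsStinespring Φ V) {Ψ : G.BG →ₗ[ℂ] G'.BG}
    (hΨ : IsInducedBy G G' V Ψ) (A : H →L[ℂ] H) : Ψ (G.incl A) = G'.incl (Φ A) := by
  obtain ⟨T, hT, h⟩ := hΨ (G.incl A)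
  ext x
  obtain ⟨hx, he⟩ := h x
  rw [he, hT.unique G.sqrt (isAmplExtension_incl A), hV A]
  rfl

theorem IsInducedBy.relBoundWith (hL : IsLimited G G' Φ) (hV : IsStinespring Φ V)
    (hsub : Φ 1 ≤ 1) (hG' : G'.InfZero) {Ψ : G.BG →ₗ[ℂ] G'.BG} (hΨ : IsInducedBy G G' V Ψ)
    {A : G.BG} {a b : ℝ} (hA : RelBoundWith G.sqrt.op A.1 a b) {E : ℝ≥0} (hE : 0 < E) :
    RelBoundWith G'.sqrt.op (Ψ A).1
      √(‖Φ 1‖ * (a ^ 2 + b ^ 2 * (outEnergy G G' Φ E).toReal))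
      (√((outEnergy G G' Φ E).toReal / E * ‖Φ 1‖) * b) := by
  obtain ⟨T, hT, h⟩ := hΨ A
  intro x
  obtain ⟨hx, he⟩ := h x
  rw [he]
  exact hL.norm_adjoint_sq_le hV hsub hG' hT hA hE x hx

/-- The vectors V_k φ_i form a subnormalized family of energy at most Y_Φ(E), to which the norm of A
applies; the outer V* costs ‖V‖² = ‖Φ(1)‖. -/
theorem IsInducedBy.eNorm_le (hL : IsLimited G G' Φ) (hV : IsStinespring Φ V)
    (hsub : Φ 1 ≤ 1) (hG : G.InfZero) {Ψ : G.BG →ₗ[ℂ] G'.BG} (hΨ : IsInducedBy G G' V Ψ)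
    (A : G.BG) (E : ℝ≥0) :
    G'.eNorm E (Ψ A) ≤ ENNReal.ofReal (√‖Φ 1‖) * G.eNorm (outEnergy G G' Φ E) A := by
  obtain ⟨s, f, -⟩ := exists_hilbertBasis ℂ K
  obtain ⟨T, hT, h⟩ := hΨ A
  refine PosOp.eNorm_le fun φ h1 hE => ?_
  have hm := mem_sqrt_domain_of_tsum_ne_top (ne_top_of_le_ne_top ENNReal.coe_ne_top hE)
  rw [mul_pow, ← ENNReal.ofReal_pow (Real.sqrt_nonneg _), Real.sq_sqrt (norm_nonneg _)]
  have hY := (tsum_sqNormOp_slice f G φ).trans_le (hV.tsum_outForm_le_of_eq_one f h1 hE)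
  calc ∑' i, sqNormOp (G'.toPMap (Ψ A)) (φ i)
      ≤ ∑' i, ENNReal.ofReal ‖Φ 1‖ *
          ∑' k, sqNormOp (G.toPMap A) (slice (f k) (V (φ i))) := by
        refine ENNReal.tsum_le_tsum fun i => ?_
        obtain ⟨hx, he⟩ := h ⟨φ i, hm i⟩
        rw [sqNormOp_of_mem (A := G'.toPMap (Ψ A)) (hm i)]
        change ‖(Ψ A).1 ⟨φ i, hm i⟩‖ₑ ^ 2 ≤ _
        rw [he, ← hT.enorm_sq_eq f ⟨_, hx⟩]
        exact hV.enorm_adjoint_sq_le _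
    _ = ENNReal.ofReal ‖Φ 1‖ *
          ∑' p : onbIndex H' × s, sqNormOp (G.toPMap A) (slice (f p.2) (V (φ p.1))) := by
        rw [ENNReal.tsum_mul_left,
          ENNReal.tsum_prod (f := fun i k => sqNormOp (G.toPMap A) (slice (f k) (V (φ i))))]
    _ ≤ ENNReal.ofReal ‖Φ 1‖ * G.eNorm (outEnergy G G' Φ E) A ^ 2 := by
        gcongr
        refine hG.tsum_sqNormOp_le_eNorm_sq A ?_ hY
          (ne_top_of_le_ne_top (hL.outEnergy_lt_top hV E).ne hY)
        rw [tsum_enorm_slice, ← h1]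
        exact ENNReal.tsum_le_tsum fun i => hV.enorm_apply_sq_le hsub _

theorem PosOp.InfZero.eNorm_le_sqrt_max_mul (hG : G.InfZero) (A : G.BG) {F : ℝ≥0∞} (hF : F ≠ ⊤)
    {E : ℝ≥0} (hE : 0 < E) :
    G.eNorm F A ≤ ENNReal.ofReal √(max 1 (F.toReal / E)) * G.eNorm E A := by
  lift F to ℝ≥0 using hF
  -- Scaling by 1/m brings energy F down to at most E, and m ≥ 1 keeps the family subnormalized.
  set m : ℝ≥0 := max 1 (F / E) with hm
  have hm' : (max 1 ((F : ℝ≥0∞).toReal / E) : ℝ) = m := by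
    rw [hm]; push_cast; rfl
  have hm1 : 1 ≤ m := le_max_left _ _
  have hm0 : m ≠ 0 := (one_pos.trans_le hm1).ne'
  have hi0 : m⁻¹ ≠ 0 := inv_ne_zero hm0
  have hmF : m⁻¹ * F ≤ E := by
    rw [inv_mul_le_iff₀ (pos_iff_ne_zero.2 hm0), ← div_le_iff₀ hE]
    exact le_max_right _ _
  refine PosOp.eNorm_le fun ψ h1 h2 => ?_
  rw [hm', mul_pow, ← ENNReal.ofReal_pow (Real.sqrt_nonneg _), Real.sq_sqrt m.coe_nonneg,
    ENNReal.ofReal_coe_nnreal]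
  have e2 : ∑' i, sqNormOp G.sqrt.op (((NNReal.sqrt m⁻¹ : ℝ) : ℂ) • ψ i) ≤ E := by
    simp_rw [sqNormOp_sqrt_smul _ hi0]
    rw [ENNReal.tsum_mul_left]
    calc ((m⁻¹ : ℝ≥0) : ℝ≥0∞) * ∑' i, sqNormOp G.sqrt.op (ψ i) ≤ (m⁻¹ : ℝ≥0) * F := by gcongr
      _ ≤ E := by exact_mod_cast hmF
  have key := hG.tsum_sqNormOp_le_eNorm_sq (E := E) A
    (ψ := fun i => ((NNReal.sqrt m⁻¹ : ℝ) : ℂ) • ψ i)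
    (by simp_rw [enorm_sqrt_smul]
        rw [ENNReal.tsum_mul_left, h1, mul_one]
        exact_mod_cast inv_le_one_of_one_le₀ hm1) e2 (ne_top_of_le_ne_top ENNReal.coe_ne_top e2)
  simp_rw [sqNormOp_sqrt_smul _ hi0] at key
  rw [ENNReal.tsum_mul_left] at key
  calc ∑' i, sqNormOp (G.toPMap A) (ψ i)
      = m * ((m⁻¹ : ℝ≥0) * ∑' i, sqNormOp (G.toPMap A) (ψ i)) := by
        rw [← mul_assoc, ← ENNReal.coe_mul, mul_inv_cancel₀ hm0, ENNReal.coe_one, one_mul]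
    _ ≤ _ := by gcongr

theorem IsLimited.eNorm_outEnergy_le (hL : IsLimited G G' Φ) (hV : IsStinespring Φ V)
    (hG : G.InfZero) (A : G.BG) {E : ℝ≥0} (hE : 0 < E) :
    ENNReal.ofReal (√‖Φ 1‖) * G.eNorm (outEnergy G G' Φ E) A ≤
      ENNReal.ofReal (√(max 1 ((outEnergy G G' Φ E).toReal / E) * ‖Φ 1‖)) * G.eNorm E A := by
  refine (mul_le_mul_right (hG.eNorm_le_sqrt_max_mul A (hL.outEnergy_lt_top hV E).ne hE) _).trans_eq
    ?_
  rw [← mul_assoc, ← ENNReal.ofReal_mul (Real.sqrt_nonneg _),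
    ← Real.sqrt_mul (norm_nonneg _), mul_comm ‖Φ 1‖]

theorem IsInducedBy.isENormContinuous (hL : IsLimited G G' Φ) (hV : IsStinespring Φ V)
    (hsub : Φ 1 ≤ 1) (hG : G.InfZero) {Ψ : G.BG →ₗ[ℂ] G'.BG} (hΨ : IsInducedBy G G' V Ψ)
    {E : ℝ≥0} (hE : 0 < E) : IsENormContinuous G G' Φ E := by
  intro A ε hε
  -- The added 1 keeps the divisor nonzero when Φ(1) = 0.
  set c : ℝ≥0∞ := ENNReal.ofReal (√(max 1 ((outEnergy G G' Φ E).toReal / E) * ‖Φ 1‖)) + 1 with hc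
  have hct : c ≠ ⊤ := ENNReal.add_ne_top.2 ⟨ENNReal.ofReal_ne_top, ENNReal.one_ne_top⟩
  have hc0 : c ≠ 0 := (zero_lt_one.trans_le le_add_self).ne'
  refine ⟨ε / c, ENNReal.div_pos hε.ne' hct, fun B hB => ?_⟩
  rw [ENNReal.lt_div_iff_mul_lt (.inl hc0) (.inl hct), mul_comm] at hB
  rw [← map_sub, ← hΨ.map_incl hV]
  calc _ ≤ _ := (hΨ.eNorm_le hL hV hsub hG _ E).trans (hL.eNorm_outEnergy_le hV hG _ hE)
    _ ≤ c * G.eNorm E (G.incl (B - A)) := by gcongr; exact le_self_add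
    _ < ε := hB

theorem IsLimited.exists_tendsto_outEnergy_div (hL : IsLimited G G' Φ) (hV : IsStinespring Φ V)
    (hG' : G'.InfZero) : ∃ k : ℝ, Filter.Tendsto
      (fun E : ℝ≥0 => (outEnergy G G' Φ E).toReal / (E : ℝ)) Filter.atTop (𝓝 k) := by
  -- Freezing the ratio below E = 1 makes it antitone on the whole half-line, including 0, without
  -- changing its limit.
  let g : ℝ≥0 → ℝ := fun E => (outEnergy G G' Φ (max E 1)).toReal / (max E 1 : ℝ≥0)
  have hanti : Antitone g := fun E F hEF => by
    have hE : 0 < max E 1 := one_pos.trans_le (le_max_right _ _)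
    have hF : 0 < max F 1 := one_pos.trans_le (le_max_right _ _)
    have h := ENNReal.toReal_mono (hL.outEnergy_lt_top hV _).ne
      (hV.outEnergy_le_mul (G := G) hG' hE (max_le_max_right 1 hEF))
    rw [ENNReal.toReal_mul, ENNReal.coe_toReal, NNReal.coe_div] at h
    have hE' : (0 : ℝ) < (max E 1 : ℝ≥0) := hE
    have hF' : (0 : ℝ) < (max F 1 : ℝ≥0) := hF
    change _ / _ ≤ _ / _
    rw [le_div_iff₀ hE']
    refine le_trans (le_of_eq ?_) h
    ring
  refine ⟨_, (tendsto_atTop_ciInf hanti ⟨0, ?_⟩).congr' ?_⟩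
  · rintro _ ⟨E, rfl⟩
    exact div_nonneg ENNReal.toReal_nonneg NNReal.zero_le_coe
  · filter_upwards [Filter.eventually_ge_atTop 1] with E hE
    simp only [g, max_eq_left hE]

theorem bddBelow_relBound {X Y : Type*} [NormedAddCommGroup X] [InnerProductSpace ℂ X]
    [NormedAddCommGroup Y] [InnerProductSpace ℂ Y] (S : X →ₗ.[ℂ] X) (A : S.domain →ₗ[ℂ] Y) :
    BddBelow {b : ℝ | 0 ≤ b ∧ ∃ a : ℝ, 0 ≤ a ∧ RelBoundWith S A a b} :=
  ⟨0, fun _ hb => hb.1⟩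

theorem IsInducedBy.bound_le (hL : IsLimited G G' Φ) (hV : IsStinespring Φ V)
    (hsub : Φ 1 ≤ 1) (hG' : G'.InfZero) {Ψ : G.BG →ₗ[ℂ] G'.BG} (hΨ : IsInducedBy G G' V Ψ)
    {k : ℝ} (hk : Filter.Tendsto (fun E : ℝ≥0 => (outEnergy G G' Φ E).toReal / (E : ℝ))
      Filter.atTop (𝓝 k)) (A : G.BG) : G'.bound (Ψ A) ≤ √(k * ‖Φ 1‖) * G.bound A := by
  -- For a fixed admissible pair (a, b) every E gives an admissible pair for Ψ(A). Its first entry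
  -- may grow with E, but only the second matters as E tends to infinity.
  have hb : ∀ b ∈ {b : ℝ | 0 ≤ b ∧ ∃ a : ℝ, 0 ≤ a ∧ RelBoundWith G.sqrt.op A.1 a b},
      G'.bound (Ψ A) ≤ √(k * ‖Φ 1‖) * b := by
    rintro b ⟨hb0, a, -, hA⟩
    refine ge_of_tendsto ((hk.mul_const ‖Φ 1‖).sqrt.mul_const b) ?_
    filter_upwards [Filter.eventually_gt_atTop 0] with E hE
    exact csInf_le (bddBelow_relBound _ _) ⟨by positivity, _, Real.sqrt_nonneg _,
      hΨ.relBoundWith hL hV hsub hG' hA hE⟩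
  have hne : {b : ℝ | 0 ≤ b ∧ ∃ a : ℝ, 0 ≤ a ∧ RelBoundWith G.sqrt.op A.1 a b}.Nonempty := by
    obtain ⟨a, b, ha, hb, h⟩ := A.2
    exact ⟨b, hb, a, ha, h⟩
  rcases (Real.sqrt_nonneg (k * ‖Φ 1‖)).eq_or_lt with h0 | hpos
  · obtain ⟨b, hbm⟩ := hne
    simpa [← h0] using hb b hbm
  · rw [← div_le_iff₀' hpos]
    exact le_csInf hne fun b hbm => (div_le_iff₀' hpos).2 (hb b hbm)

theorem PosOp.bound_nonneg (G : PosOp H) (A : G.BG) : 0 ≤ G.bound A :=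
  Real.sInf_nonneg fun _ hb => hb.1

end Induced

/-! ## Continuous maps that are limited -/

section Converse

open InnerProductSpace (rankOne)

variable {H H' : Type*} [NormedAddCommGroup H] [InnerProductSpace ℂ H] [CompleteSpace H]
  [NormedAddCommGroup H'] [InnerProductSpace ℂ H'] [CompleteSpace H']
  {K : Type*} [NormedAddCommGroup K] [InnerProductSpace ℂ K] [CompleteSpace K]
  {Φ : (H →L[ℂ] H) →CP (H' →L[ℂ] H')} {V : H' →L[ℂ] HTensor H K}
  {G : PosOp H} {G' : PosOp H'}

/-- Here z = √G d and ⟪z, x⟫ = ⟪d, √G x⟫, so the bound involves ‖d‖ but not ‖z‖. These are the test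
operators for the converse. -/
theorem PosOp.relBoundWith_rankOne (G : PosOp H) (η : H) {d z : H}
    (hd : (d, z) ∈ G.sqrt.op.graph) :
    RelBoundWith G.sqrt.op (G.incl (rankOne ℂ η z)).1 0 (‖η‖ * ‖d‖) := fun x => by
  have h : (G.incl (rankOne ℂ η z)).1 x = ⟪d, G.sqrt.op x⟫_ℂ • η := by
    rw [← G.sqrt.graph_inner_symm hd (G.sqrt.op.mem_graph x)]
    rfl
  have h2 : ‖(G.incl (rankOne ℂ η z)).1 x‖ ≤ ‖η‖ * ‖d‖ * ‖G.sqrt.op x‖ := by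
    rw [h, norm_smul]
    nlinarith [norm_inner_le_norm (𝕜 := ℂ) d (G.sqrt.op x), norm_nonneg η]
  have := pow_le_pow_left₀ (norm_nonneg _) h2 2
  rw [mul_pow] at this
  simpa using this

theorem IsENormContinuous.exists_norm_map_rankOne_le {E : ℝ≥0} (hE : 0 < E)
    (hc : IsENormContinuous G G' Φ E) (hG' : G'.InfZero) :
    ∃ C : ℝ, 0 ≤ C ∧ ∀ (η d z : H), (d, z) ∈ G.sqrt.op.graph → ∀ x : G'.sqrt.op.domain,
      ‖Φ (rankOne ℂ η z) (x : H')‖ ≤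
        C * ‖η‖ * ‖d‖ * √(‖(x : H')‖ ^ 2 + ‖G'.sqrt.op x‖ ^ 2 / E) := by
  obtain ⟨δ, hδ, h⟩ := hc 0 1 one_pos
  simp only [map_zero, sub_zero] at h
  obtain ⟨r, hr0, hrδ⟩ := ENNReal.lt_iff_exists_nnreal_btwn.1 hδ
  have hr : (0 : ℝ) < r := by simpa using hr0
  have small : ∀ (η d z : H), (d, z) ∈ G.sqrt.op.graph → ‖η‖ * ‖d‖ * √E ≤ r →
      ∀ x : G'.sqrt.op.domain, ‖Φ (rankOne ℂ η z) (x : H')‖ ≤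
        √(‖(x : H')‖ ^ 2 + ‖G'.sqrt.op x‖ ^ 2 / E) := by
    intro η d z hd hm x
    have h1 := PosOp.eNorm_sq_le_of_relBoundWith (E := E) (G.relBoundWith_rankOne η hd)
    rw [zero_pow two_ne_zero, zero_add, Real.sqrt_mul (by positivity),
      Real.sqrt_sq (by positivity)] at h1
    have h2 : G.eNorm E (G.incl (rankOne ℂ η z)) < δ := by
      refine h1.trans_lt (lt_of_le_of_lt ?_ hrδ)
      rw [← ENNReal.ofReal_coe_nnreal]
      exact ENNReal.ofReal_le_ofReal hm
    have h3 := hG'.norm_sq_le_of_eNorm_le hE zero_le_one (by simpa using (h _ h2).le) x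
    rw [one_pow, one_mul] at h3
    exact Real.le_sqrt_of_sq_le h3
  refine ⟨√E / r, by positivity, fun η d z hd x => ?_⟩
  set N := √(‖(x : H')‖ ^ 2 + ‖G'.sqrt.op x‖ ^ 2 / E) with hN
  have hN0 : 0 ≤ N := Real.sqrt_nonneg _
  -- Rescaling η by r/t reaches the range where continuity at 0 applies. Taking t strictly larger
  -- avoids a division by zero when η or d vanishes; t then decreases to its limit.
  have big : ∀ t : ℝ, ‖η‖ * ‖d‖ * √E < t → ‖Φ (rankOne ℂ η z) (x : H')‖ ≤ t / r * N := by
    intro t ht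
    have ht0 : 0 < t := lt_of_le_of_lt (by positivity) ht
    have h1 := small (((r / t : ℝ) : ℂ) • η) d z hd (by
      rw [norm_smul, Complex.norm_real, Real.norm_of_nonneg (by positivity), mul_assoc, mul_assoc,
        div_mul_eq_mul_div, div_le_iff₀ ht0]
      have := mul_le_mul_of_nonneg_left ht.le hr.le
      linarith) x
    rw [map_smul, smul_apply, map_smul, smul_apply,
      norm_smul, Complex.norm_real, Real.norm_of_nonneg (by positivity),
      ← le_div_iff₀' (by positivity)] at h1
    refine h1.trans_eq ?_
    rw [← hN]
    field_simp
  have hlim : Filter.Tendsto (fun t : ℝ => t / r * N) (𝓝[>] (‖η‖ * ‖d‖ * √E))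
      (𝓝 (‖η‖ * ‖d‖ * √E / r * N)) :=
    ((Filter.tendsto_id.div_const (r : ℝ)).mul_const N).mono_left nhdsWithin_le_nhds
  refine (ge_of_tendsto hlim (eventually_nhdsWithin_of_forall big)).trans_eq ?_
  ring

theorem adjoint_tensR_tens (η x : H) (y : K) :
    ContinuousLinearMap.adjoint (tensR K η) (tens x y) = ⟪η, x⟫_ℂ • y :=
  ext_inner_left ℂ fun k => by
    rw [ContinuousLinearMap.adjoint_inner_right, tensR_apply, inner_tens, inner_smul_right]

theorem ampl_rankOne (h η : H) :
    ampl K (rankOne ℂ h η) = (tensR K h).comp (ContinuousLinearMap.adjoint (tensR K η)) :=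
  clm_ext_tens fun x y => by
    rw [ampl_tens, ContinuousLinearMap.comp_apply, adjoint_tensR_tens, map_smul, tensR_apply,
      InnerProductSpace.rankOne_apply, ← tensL_apply, map_smul, tensL_apply]

/-- The link between Φ and slices: with ξ = V y and ζ = V x it turns ⟪y, Φ(|η⟩⟨h|) x⟫ into an inner
product of h with a slice of V x. -/
theorem inner_ampl_rankOne (η h : H) (ξ ζ : HTensor H K) :
    ⟪ξ, ampl K (rankOne ℂ η h) ζ⟫_ℂ =
      ⟪h, slice (ContinuousLinearMap.adjoint (tensR K η) ξ) ζ⟫_ℂ := by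
  rw [inner_slice, ← tensR_apply, ← ContinuousLinearMap.comp_apply, ← ampl_rankOne,
    ← InnerProductSpace.adjoint_rankOne, ← adjoint_ampl, ContinuousLinearMap.adjoint_inner_right]

theorem continuous_slice_left (ξ : HTensor H K) : Continuous fun y : K => slice y ξ :=
  AddMonoidHomClass.continuous_of_bound
    (AddMonoidHom.mk' (fun y : K => slice y ξ) fun y y' => slice_add y y' ξ) ‖ξ‖ fun y => by
      rw [mul_comm]; exact norm_slice_le y ξ

/-- The subspace of the environment that is reached by `V`. -/
def environment (V : H' →L[ℂ] HTensor H K) : Submodule ℂ K :=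
  Submodule.span ℂ {κ | ∃ η x, κ = ContinuousLinearMap.adjoint (tensR K η) (V x)}

theorem inner_tens_of_mem_environment_orthogonal {κ : K} (hκ : κ ∈ (environment V)ᗮ) (η : H)
    (x : H') : ⟪tens η κ, V x⟫_ℂ = 0 := by
  rw [← tensR_apply, ← ContinuousLinearMap.adjoint_inner_right]
  exact (Submodule.mem_orthogonal' _ _).1 hκ _ (Submodule.subset_span ⟨η, x, rfl⟩)

theorem slice_eq_zero_of_mem_environment_orthogonal {κ : K} (hκ : κ ∈ (environment V)ᗮ) (x : H') :
    slice κ (V x) = 0 :=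
  ext_inner_left ℂ fun h => by
    rw [inner_slice, inner_tens_of_mem_environment_orthogonal hκ, inner_zero_right]

/-- For κ orthogonal to the environment, e ⊗ κ is orthogonal to every (A ⊗ I)V x, because A* can be
moved onto e; minimality gives e ⊗ κ = 0. -/
theorem IsMinimalDilation.environment_orthogonal (hmin : IsMinimalDilation V) {e : H}
    (he : ‖e‖ = 1) : (environment V)ᗮ = ⊥ := by
  rw [Submodule.eq_bot_iff]
  intro κ hκ
  have hle : Submodule.span ℂ {ξ : HTensor H K | ∃ (A : H →L[ℂ] H) (x : H'), ξ = ampl K A (V x)} ≤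
      (ℂ ∙ tens e κ)ᗮ := by
    refine Submodule.span_le.2 ?_
    rintro _ ⟨A, x, rfl⟩
    rw [SetLike.mem_coe, Submodule.mem_orthogonal_singleton_iff_inner_right,
      ← ContinuousLinearMap.adjoint_inner_left, adjoint_ampl, ampl_tens]
    exact inner_tens_of_mem_environment_orthogonal hκ _ _
  have h0 : tens e κ = 0 := Dense.eq_zero_of_inner_left ℂ hmin fun v hv =>
    (Submodule.mem_orthogonal_singleton_iff_inner_right).1 (hle hv)
  have h1 := norm_tens e κ
  rw [h0, norm_zero, he, one_mul] at h1
  exact norm_eq_zero.1 h1.symm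

/-- Slices along the environment have finite energy, by duality with the operators
`|η⟩⟨√G d|`. -/
theorem IsENormContinuous.exists_norm_sqrt_slice_le {E : ℝ≥0} (hE : 0 < E)
    (hc : IsENormContinuous G G' Φ E) (hV : IsStinespring Φ V) (hG' : G'.InfZero) {κ : K}
    (hκ : κ ∈ environment V) : ∃ c : ℝ, 0 ≤ c ∧ ∀ x : G'.sqrt.op.domain,
      ∃ z, (slice κ (V (x : H')), z) ∈ G.sqrt.op.graph ∧
        ‖z‖ ≤ c * √(‖(x : H')‖ ^ 2 + ‖G'.sqrt.op x‖ ^ 2 / E) := by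
  obtain ⟨C, hC, hbd⟩ := hc.exists_norm_map_rankOne_le hE hG'
  induction hκ using Submodule.span_induction with
  | mem κ hκ =>
    obtain ⟨η, y, rfl⟩ := hκ
    refine ⟨‖y‖ * C * ‖η‖, by positivity, fun x => ?_⟩
    -- It suffices to bound ⟪√G d, slice⟫ by a multiple of ‖d‖; this pairing is ⟪y, Φ(|η⟩⟨√G d|) x⟫.
    refine G.sqrt.exists_mem_graph_of_bound (by positivity) fun d z hd => ?_
    rw [← inner_ampl_rankOne, ← hV.inner_map]
    refine (norm_inner_le_norm _ _).trans ?_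
    refine (mul_le_mul_of_nonneg_left (hbd η d z hd x) (norm_nonneg y)).trans_eq ?_
    ring
  | zero =>
    refine ⟨0, le_rfl, fun x => ⟨0, ?_, by simp⟩⟩
    rw [slice_eq_zero_of_mem_environment_orthogonal (Submodule.zero_mem _)]
    exact G.sqrt.op.graph.zero_mem
  | add κ κ' _ _ h h' =>
    obtain ⟨c, hc0, h⟩ := h
    obtain ⟨c', hc0', h'⟩ := h'
    refine ⟨c + c', by positivity, fun x => ?_⟩
    obtain ⟨z, hz, hzc⟩ := h x
    obtain ⟨z', hz', hzc'⟩ := h' x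
    refine ⟨z + z', ?_, ?_⟩
    · rw [slice_add]
      exact G.sqrt.op.graph.add_mem hz hz'
    · rw [add_mul]
      exact (norm_add_le _ _).trans (add_le_add hzc hzc')
  | smul t κ _ h =>
    obtain ⟨c, hc0, h⟩ := h
    refine ⟨‖t‖ * c, by positivity, fun x => ?_⟩
    obtain ⟨z, hz, hzc⟩ := h x
    refine ⟨(starRingEnd ℂ) t • z, ?_, ?_⟩
    · rw [slice_smul]
      exact G.sqrt.op.graph.smul_mem _ hz
    · rw [norm_smul, RCLike.norm_conj, mul_assoc]
      exact mul_le_mul_of_nonneg_left hzc (norm_nonneg t)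

/-- A bound linear in ‖x‖² and ‖√G' x‖² can be summed over a decomposition of the state. -/
theorem IsStinespring.isLimited_of_outForm_le {κ : Type*} (f : HilbertBasis κ ℂ K)
    (hV : IsStinespring Φ V) {E : ℝ≥0} (hE : 0 < E) {C : ℝ≥0∞} (hC : C ≠ ⊤)
    (h : ∀ x : G'.sqrt.op.domain, outForm f G V (x : H') ≤
      C * ENNReal.ofReal (‖(x : H')‖ ^ 2 + ‖G'.sqrt.op x‖ ^ 2 / E)) : IsLimited G G' Φ := by
  refine hV.isLimited f fun φ h1 hS => ?_
  have hm := mem_sqrt_domain_of_tsum_ne_top hS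
  have hE' : (0 : ℝ) < E := hE
  have hle : ∑' i, outForm f G V (φ i) ≤
      C * (1 + (∑' i, sqNormOp G'.sqrt.op (φ i)) * (ENNReal.ofReal (E : ℝ)⁻¹)) := by
    rw [← h1, ← ENNReal.tsum_mul_right, ← ENNReal.tsum_add, ← ENNReal.tsum_mul_left]
    refine ENNReal.tsum_le_tsum fun i => (h ⟨φ i, hm i⟩).trans_eq ?_
    rw [sqNormOp_of_mem (hm i), ENNReal.ofReal_add (by positivity) (by positivity),
      div_eq_mul_inv, ENNReal.ofReal_mul (by positivity), ofReal_norm_sq_eq_enorm_sq,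
      ofReal_norm_sq_eq_enorm_sq]
  exact ne_top_of_le_ne_top (ENNReal.mul_ne_top hC (ENNReal.add_ne_top.2 ⟨ENNReal.one_ne_top,
    ENNReal.mul_ne_top hS ENNReal.ofReal_ne_top⟩)) hle

/-- A continuous map of finite Choi rank is limited. -/
theorem IsENormContinuous.isLimited_of_finiteDimensional [FiniteDimensional ℂ K] {E : ℝ≥0}
    (hE : 0 < E) (hc : IsENormContinuous G G' Φ E) (hV : IsStinespring Φ V)
    (hmin : IsMinimalDilation V) (hG' : G'.InfZero) {e : H} (he : ‖e‖ = 1) :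
    IsLimited G G' Φ := by
  have htop : environment V = ⊤ :=
    Submodule.orthogonal_eq_bot_iff.1 (hmin.environment_orthogonal he)
  let f := (stdOrthonormalBasis ℂ K).toHilbertBasis
  choose c hc0 h using fun k => hc.exists_norm_sqrt_slice_le hE hV hG' (κ := f k)
    (by rw [htop]; exact Submodule.mem_top)
  refine hV.isLimited_of_outForm_le f hE (C := ∑ k, ENNReal.ofReal (c k ^ 2))
    (ENNReal.sum_ne_top.2 fun k _ => ENNReal.ofReal_ne_top) fun x => ?_
  rw [outForm, tsum_fintype, Finset.sum_mul]
  refine Finset.sum_le_sum fun k _ => ?_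
  obtain ⟨z, hz, hzc⟩ := h k x
  rw [sqNormOp_of_mem_graph hz, ← ofReal_norm_sq_eq_enorm_sq,
    ← ENNReal.ofReal_mul (by positivity)]
  refine ENNReal.ofReal_le_ofReal ((pow_le_pow_left₀ (norm_nonneg _) hzc 2).trans_eq ?_)
  rw [mul_pow, Real.sq_sqrt (by positivity)]

/-- The squared norm of ((1 - P) ⊗ I)V x is ⟪x, Φ(1 - P) x⟫ = 0. -/
theorem IsStinespring.apply_slice_eq (hV : IsStinespring Φ V) {P : H →L[ℂ] H}
    (hP : IsStarProjection P) (h1 : Φ 1 = Φ P) (κ : K) (x : H') :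
    P (slice κ (V x)) = slice κ (V x) := by
  have hQ : IsStarProjection (1 - P) := hP.one_sub
  have h2 : ⟪ampl K (1 - P) (V x), ampl K (1 - P) (V x)⟫_ℂ = 0 := by
    rw [← ContinuousLinearMap.adjoint_inner_right, adjoint_ampl,
      ← ContinuousLinearMap.star_eq_adjoint, hQ.isSelfAdjoint.star_eq]
    have h3 : ampl K (1 - P) (ampl K (1 - P) (V x)) = ampl K (1 - P) (V x) := by
      have := congrArg (fun T : HTensor H K →L[ℂ] HTensor H K => T (V x))
        (ampl_mul (K := K) (1 - P) (1 - P))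
      rw [hQ.isIdempotentElem.eq] at this
      exact this.symm
    rw [h3, ← hV.inner_map, map_sub, h1, sub_self, zero_apply,
      inner_zero_right]
  have h4 := slice_ampl (1 - P) κ (V x)
  rw [inner_self_eq_zero.1 h2, map_zero, sub_apply, one_apply_eq_self] at h4
  exact (sub_eq_zero.1 h4.symm).symm

/-- A continuous map that factors through a finite-rank projection is limited. -/
theorem IsENormContinuous.isLimited_of_finiteDimensional_range {E : ℝ≥0} (hE : 0 < E)
    (hc : IsENormContinuous G G' Φ E) (hV : IsStinespring Φ V) (hsub : Φ 1 ≤ 1)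
    (hG' : G'.InfZero) {P : H →L[ℂ] H} (hP : IsStarProjection P)
    (hfin : FiniteDimensional ℂ P.range) (h1 : Φ 1 = Φ P) : IsLimited G G' Φ := by
  obtain ⟨s, f, -⟩ := exists_hilbertBasis ℂ K
  -- Being finite-dimensional, D is closed, so membership of slices extends from the environment to
  -- its closure with no control of the constants.
  let D : Submodule ℂ H := P.range ⊓ G.sqrt.op.domain
  have hDfin : FiniteDimensional ℂ D := Submodule.finiteDimensional_inf_left _ _
  have hDcl : IsClosed (D : Set H) := D.closed_of_finiteDimensional
  have hmem : ∀ (κ : K) (x : G'.sqrt.op.domain), slice κ (V (x : H')) ∈ D := by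
    intro κ x
    have hcl : ∀ p ∈ (environment V).topologicalClosure, slice p (V (x : H')) ∈ D := by
      intro p hp
      refine closure_minimal (t := {p | slice p (V (x : H')) ∈ D}) ?_
        (hDcl.preimage (continuous_slice_left _)) hp
      intro p hp
      obtain ⟨c, -, h⟩ := hc.exists_norm_sqrt_slice_le hE hV hG' hp
      obtain ⟨z, hz, -⟩ := h x
      exact ⟨⟨_, hV.apply_slice_eq hP h1 p x⟩, LinearPMap.mem_domain_of_mem_graph hz⟩
    -- The component orthogonal to the environment contributes a zero slice.
    obtain ⟨p, hp, q, hq, rfl⟩ :=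
      (environment V).topologicalClosure.exists_add_mem_mem_orthogonal κ
    rw [slice_add, slice_eq_zero_of_mem_environment_orthogonal
      (Submodule.orthogonal_le (Submodule.le_topologicalClosure _) hq), add_zero]
    exact hcl p hp
  -- On the finite-dimensional D the operator √G is bounded, which gives one constant for all
  -- slices.
  let S : D →L[ℂ] H := LinearMap.toContinuousLinearMap
    (G.sqrt.op.toFun ∘ₗ Submodule.inclusion inf_le_right)
  refine hV.isLimited_of_outForm_le f hE (C := ENNReal.ofReal (‖S‖ ^ 2)) ENNReal.ofReal_ne_top
    fun x => ?_
  calc outForm f G V (x : H')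
      ≤ ∑' k, ENNReal.ofReal (‖S‖ ^ 2) * ‖slice (f k) (V (x : H'))‖ₑ ^ 2 := by
        refine ENNReal.tsum_le_tsum fun k => ?_
        rw [sqNormOp_of_mem (hmem (f k) x).2, ← ofReal_norm_sq_eq_enorm_sq,
          ← ofReal_norm_sq_eq_enorm_sq, ← ENNReal.ofReal_mul (by positivity), ← mul_pow]
        exact ENNReal.ofReal_le_ofReal (pow_le_pow_left₀ (norm_nonneg _)
          (S.le_opNorm ⟨_, hmem (f k) x⟩) 2)
    _ = ENNReal.ofReal (‖S‖ ^ 2) * ‖V (x : H')‖ₑ ^ 2 := by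
        rw [ENNReal.tsum_mul_left, ← enorm_sq_eq_tsum_slice f]
    _ ≤ _ := by
        refine mul_le_mul_right ((hV.enorm_apply_sq_le hsub x).trans ?_) _
        rw [← ofReal_norm_sq_eq_enorm_sq]
        exact ENNReal.ofReal_le_ofReal (le_add_of_nonneg_right (by positivity))

end Converse

end

theorem theorem2 {H : Type u} {H' : Type v}
    [NormedAddCommGroup H] [InnerProductSpace ℂ H] [CompleteSpace H]
    [TopologicalSpace.SeparableSpace H]
    [NormedAddCommGroup H'] [InnerProductSpace ℂ H'] [CompleteSpace H']
    [TopologicalSpace.SeparableSpace H']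
    (Φ : (H →L[ℂ] H) →CP (H' →L[ℂ] H')) (hnormal : IsNormalMap Φ) (hsub : Φ 1 ≤ 1)
    (G : PosOp H) (G' : PosOp H') (hG : G.InfZero) (hG' : G'.InfZero) :
    -- Part A
    (IsLimited G G' Φ →
      (∀ E : ℝ≥0, 0 < E → IsENormContinuous G G' Φ E) ∧
      (∀ E : ℝ≥0, 0 < E → outEnergy G G' Φ E < ⊤) ∧
      -- Stinespring representations exist, and all of them define the same operator `Ψ`
      (∃ (K : Type w) (_ : NormedAddCommGroup K) (_ : InnerProductSpace ℂ K)
        (_ : CompleteSpace K) (_ : TopologicalSpace.SeparableSpace K)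
        (V : H' →L[ℂ] HTensor H K), IsStinespring Φ V) ∧
      ∃ Ψ : G.BG →ₗ[ℂ] G'.BG,
        (∀ (K : Type w) [NormedAddCommGroup K] [InnerProductSpace ℂ K] [CompleteSpace K]
          [TopologicalSpace.SeparableSpace K] (V : H' →L[ℂ] HTensor H K), IsStinespring Φ V →
          ∀ Ψ' : G.BG →ₗ[ℂ] G'.BG, IsInducedBy G G' V Ψ' ↔ Ψ' = Ψ) ∧
        (∀ A : H →L[ℂ] H, Ψ (G.incl A) = G'.incl (Φ A)) ∧
        (∀ (A : G.BG) (E : ℝ≥0), 0 < E →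
          G'.eNorm E (Ψ A) ≤
            ENNReal.ofReal (√‖Φ 1‖) * G.eNorm (outEnergy G G' Φ E) A ∧
          ENNReal.ofReal (√‖Φ 1‖) * G.eNorm (outEnergy G G' Φ E) A ≤
            ENNReal.ofReal (√(max 1 ((outEnergy G G' Φ E).toReal / E) * ‖Φ 1‖)) * G.eNorm E A) ∧
        (∃ k : ℝ, Filter.Tendsto (fun E : ℝ≥0 => (outEnergy G G' Φ E).toReal / (E : ℝ))
            Filter.atTop (𝓝 k) ∧
          ∀ A : G.BG, G'.bound (Ψ A) ≤ √(k * ‖Φ 1‖) * G.bound A) ∧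
        (∀ A : G.BG, G.bound A = 0 → G'.bound (Ψ A) = 0)) ∧
    -- Part B
    (G'.IsDiscrete →
      (HasFiniteChoiRank Φ ∨
        (G.IsDiscrete ∧ ∃ P : H →L[ℂ] H, IsStarProjection P ∧
          FiniteDimensional ℂ P.range ∧ Φ 1 = Φ P)) →
      (∃ E : ℝ≥0, 0 < E ∧ IsENormContinuous G G' Φ E) →
      IsLimited G G' Φ) := by
  -- Only the existence of a unit vector in H is used here.
  obtain ⟨e, he, -⟩ := hG.exists_low_energy one_pos
  refine ⟨fun hL => ?_, fun _ hcase hcont => ?_⟩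
  · obtain ⟨K, _, _, _, _, V, hV⟩ := exists_isStinespring.{w, u, v} hnormal hsub he
    obtain ⟨Ψ, hΨ⟩ := hL.exists_isInducedBy hV hsub hG'
    obtain ⟨k, hk⟩ := hL.exists_tendsto_outEnergy_div hV hG'
    have hbound := hΨ.bound_le hL hV hsub hG' hk
    refine ⟨fun E hE => hΨ.isENormContinuous hL hV hsub hG hE,
      fun E _ => hL.outEnergy_lt_top hV E, ⟨K, _, _, ‹_›, ‹_›, V, hV⟩, Ψ, ?_, hΨ.map_incl hV,
      fun A E hE => ⟨hΨ.eNorm_le hL hV hsub hG A E, hL.eNorm_outEnergy_le hV hG A hE⟩,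
      ⟨k, hk, hbound⟩, fun A hA => ?_⟩
    · intro K' _ _ _ _ V' hV' Ψ'
      refine ⟨fun hΨ' => hΨ'.eq hV' hV hΨ, ?_⟩
      rintro rfl
      -- The other representation induces some operator, which must coincide with the one already
      -- fixed.
      obtain ⟨Ψ'', hΨ''⟩ := hL.exists_isInducedBy hV' hsub hG'
      rwa [hΨ.eq hV hV' hΨ'']
    · refine le_antisymm ?_ (G'.bound_nonneg _)
      simpa [hA] using hbound A
  · obtain ⟨E, hE, hc⟩ := hcont
    rcases hcase with ⟨K, _, _, V, _, hV, hmin⟩ | ⟨-, P, hP, hfin, h1⟩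
    · have : CompleteSpace K := FiniteDimensional.complete ℂ K
      exact hc.isLimited_of_finiteDimensional hE hV hmin hG' he
    · obtain ⟨K, _, _, _, _, V, hV⟩ := exists_isStinespring.{0, u, v} hnormal hsub he
      exact hc.isLimited_of_finiteDimensional_range hE hV hsub hG' hP hfin h1
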